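/- Let $(S,G)$ be a nonempty compact smooth Riemannian manifold (without boundary) of dimension $m\ge 1$, let $n\ge 2$ be an integer, $\alpha_M>0$, and let $V,\tilde\kappa\in\mathbb R$, $r_0>0$. Put $$a_0=\frac{2n(n-1)}{\alpha_M},\qquad \bar V=\frac{\alpha_M}{n(n-1)}V,\qquad \bar\mu=\tfrac4{n^2}a_0\mu-\tfrac{(m-1)^2}4\quad(\mu\in\mathbb R).$$ Let $E_\mu\subset L^2(S,\mathbb C)$ be the eigenspace of $-\Delta=-\Delta_S$ for the eigenvalue $\mu$, and let $\mathcal H_0\subset L^2(S,\mathbb C)$ be the span of the $E_\mu$ over the eigenvalues $\mu$ with $\bar\mu\le 0$; let $\mu_0,\dots,\mu_{k_0}$ be these eigenvalues. For $I=(0,b)$, $0<b\le\infty$, and $q\in\mathbb R$ let $L^2(I,q)$ be the space of measurable $u:I\to\mathbb C$ with $\int_I r^q|u|^2<\infty$ and scalar product $\int_I r^q u_1\bar u_2$, and $\mathcal H(I,q)=L^2(I,q)\otimes\mathcal H_0$. Put $I_1=(0,r_0)$, $I_2=(0,\infty)$, $p_1=2$, $p_2=\frac{2(n-2)}n$. Let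 $\mathcal H_i(I_i)$ be the completion of $C_c^\infty(I_i)\otimes\mathcal H_0$ with respect to the scalar product norms $$\|\psi\|^2=\sum_{k}\int_{I_1}\{r|\dot u_k|^2-r^{-1}\bar\mu_k|u_k|^2\}\|\eta_k\|^2\ (i=1),\qquad \|\psi\|^2=\sum_k\int_{I_2}\{r|\dot u_k|^2-r^{-1}\bar\mu_k|u_k|^2+r^3|u_k|^2\}\|\eta_k\|^2\ (i=2),$$ for $\psi=\sum_k u_k\eta_k$, $\eta_k\in E_{\mu_k}$ (in general, the sum of such expressions over orthonormal bases of the $E_{\mu_k}$); it is regarded as a subspace of $\mathcal H(I_i,p_i+1)$ through limits of test functions. Let $$H_1\psi=-r^{-1}(r\dot\psi)'-r^{-2}\big(-\tfrac4{n^2}a_0\Delta\psi-\tfrac{(m-1)^2}4\psi\big)-\tfrac{16}{n^2}\bar V r^2\psi+\tfrac{16}{n^2}\tilde\kappa r^{\frac{2(n-2)}n}\psi,$$ $$H_2\psi=-r^{-1}(r\dot\psi)'-r^{-2}\big(-\tfrac4{n^2}a_0\Delta\psi-\tfrac{(m-1)^2}4\psi\big)+\tfrac{16}{n^2}r^2\psi,$$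 and $\hat H_i=r^{-p_i}H_i$ with domain $$D(\hat H_i)=\{\psi\in\mathcal H_i(I_i):\ \hat H_i\psi\in\mathcal H(I_i,p_i+1)\},$$ where $\hat H_i\psi=\chi$ means $\langle\psi,\hat H_i\varphi\rangle=\langle\chi,\varphi\rangle$ for all $\varphi\in C_c^\infty(I_i)\otimes\mathcal H_0$, with the scalar product of $\mathcal H(I_i,p_i+1)$. **Theorem.** The space $\mathcal H_0$ is finite dimensional, and the following holds for $i=1$, with $V,\tilde\kappa$ arbitrary, and for $i=2$, if $\tilde\kappa<0$. The operator $\hat H_i$ is densely defined and selfadjoint in the Hilbert space $\mathcal H(I_i,p_i+1)$. It has a pure point spectrum: its spectrum consists of eigenvalues, and its eigenvectors span a dense subspace. The eigenvalue problem $$\hat H_1\psi=\bar\Lambda\,\tfrac{16}{n^2}\psi\qquad\text{resp.}\qquad \hat H_2\psi=-\lambda\tilde\kappa\,\tfrac{16}{n^2}\psi$$ has a sequence of solutions $(\bar\Lambda_j,\psi_j)_{j\in\mathbb N}$ resp. $(\lambda_j,\psi_j)_{j\in\mathbb N}$ with real eigenvalues and with $(\psi_j)$ orthonormal in $\mathcal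 H(I_i,p_i+1)$, such that $$\bar\Lambda_j\le\bar\Lambda_{j+1},\ \lim_j\bar\Lambda_j=\infty\qquad\text{resp.}\qquad \lambda_j\le\lambda_{j+1},\ \lim_j\lambda_j=\infty .$$ Every solution of the eigenvalue problem with a complex eigenvalue $z$ is a finite linear combination of the $\psi_j$ with eigenvalue $\bar\Lambda_j=z$ resp. $\lambda_j=z$. The $\psi_j$ are complete (their linear span is dense) in $\mathcal H_i(I_i)$ as well as in $\mathcal H(I_i,p_i+1)$. -/

import Mathlib

open MeasureTheory Set Filter Topology Bundle
open scoped ContDiff Manifold ENNReal NNReal ComplexConjugate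

noncomputable section

namespace WheelerDeWitt

/-! ### The Laplacian of the compact Riemannian manifold `S` and the space `𝓗₀` -/

section Laplacian

variable (m : ℕ) {S : Type*} [EMetricSpace S] [ChartedSpace (EuclideanSpace ℝ (Fin m)) S]

instance (x : S) : FiniteDimensional ℝ (TangentSpace (𝓡 m) x) :=
  inferInstanceAs (FiniteDimensional ℝ (EuclideanSpace ℝ (Fin m)))

/-- The differential `dη` of a complex valued function. -/
def differential (η : S → ℂ) (x : S) (v : TangentSpace (𝓡 m) x) : ℂ :=
  mfderiv (𝓡 m) 𝓘(ℝ, ℂ) η x v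

variable [RiemannianBundle (fun x : S => TangentSpace (𝓡 m) x)]

/-- The pointwise scalar product `⟨dη, dφ⟩ = G^{AB} η_A \bar φ_B` of the differentials of two
complex valued functions, computed in an orthonormal basis of the tangent space. -/
def gradInner (η φ : S → ℂ) (x : S) : ℂ :=
  ∑ i, differential m η x (stdOrthonormalBasis ℝ (TangentSpace (𝓡 m) x) i) *
    conj (differential m φ x (stdOrthonormalBasis ℝ (TangentSpace (𝓡 m) x) i))

theorem gradInner_conj (η φ : S → ℂ) (x : S) :
    conj (gradInner m η φ x) = gradInner m φ η x := by
  simp [gradInner, map_sum, mul_comm]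

variable [MeasurableSpace S] [BorelSpace S]

variable (S) in
/-- The Riemannian volume of `S`: the `m`-dimensional Hausdorff measure of the Riemannian distance,
normalized so that it is the Lebesgue measure on Euclidean space. -/
def vol : Measure S := μHE[m]

/-- `-Δη = f` for smooth functions `η`, `f`, where `-Δ = d*d`, that is, `-Δη` is the function with
`∫ ⟨dη, dφ⟩ = ∫ (-Δη) \bar φ` for all smooth `φ`. -/
structure IsNegLaplacian (η f : S → ℂ) : Prop where
  smooth_left : ContMDiff (𝓡 m) 𝓘(ℝ, ℂ) ∞ η
  smooth_right : ContMDiff (𝓡 m) 𝓘(ℝ, ℂ) ∞ f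
  integral_eq : ∀ φ : S → ℂ, ContMDiff (𝓡 m) 𝓘(ℝ, ℂ) ∞ φ →
    ∫ x, gradInner m η φ x ∂(vol m S) = ∫ x, f x * conj (φ x) ∂(vol m S)

variable (S) in
/-- The space `E_μ ⊂ L²(S, ℂ)` spanned by the smooth solutions of `-Δη = μη`. -/
def eigenspace (μ : ℝ) : Submodule ℂ (Lp ℂ 2 (vol m S)) :=
  Submodule.span ℂ {f | ∃ η : S → ℂ, IsNegLaplacian m η (fun x => (μ : ℂ) * η x) ∧
    f =ᵐ[vol m S] η}

theorem eigenspace_orthogonal {μ ν : ℝ} (h : μ ≠ ν) : eigenspace m S μ ⟂ eigenspace m S ν := by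
  rw [eigenspace, eigenspace, Submodule.isOrtho_span]
  rintro f ⟨η, hη, hf⟩ g ⟨ζ, hζ, hg⟩
  have e1 := hη.integral_eq ζ hζ.smooth_left
  have e2 := hζ.integral_eq η hη.smooth_left
  have e3 : ∫ x, gradInner m η ζ x ∂(vol m S) = conj (∫ x, gradInner m ζ η x ∂(vol m S)) := by
    rw [← integral_conj]
    simp only [gradInner_conj]
  rw [e1, e2, ← integral_conj] at e3
  simp only [map_mul, Complex.conj_conj, Complex.conj_ofReal, mul_assoc] at e3
  rw [integral_const_mul, integral_const_mul] at e3
  have e4 : ∫ x, conj (ζ x) * η x ∂(vol m S) = ∫ x, η x * conj (ζ x) ∂(vol m S) := by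
    simp only [mul_comm]
  rw [e4] at e3
  have e5 : ∫ x, η x * conj (ζ x) ∂(vol m S) = 0 := by
    have : ((μ : ℂ) - ν) * ∫ x, η x * conj (ζ x) ∂(vol m S) = 0 := by
      rw [sub_mul, e3, sub_self]
    rcases mul_eq_zero.1 this with h0 | h0
    · exact absurd (by exact_mod_cast sub_eq_zero.1 h0) h
    · exact h0
  rw [← inner_conj_symm, L2.inner_def]
  have : ∫ x, inner ℂ (g x) (f x) ∂(vol m S) = ∫ x, η x * conj (ζ x) ∂(vol m S) := by
    apply integral_congr_ae
    filter_upwards [hf, hg] with x h1 h2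
    rw [h1, h2]
    simp [RCLike.inner_apply]
  rw [this, e5, map_zero]

/-- `a₀ = 2n(n-1)/α_M`. -/
def a₀ (n : ℕ) (αM : ℝ) : ℝ := 2 * n * (n - 1) / αM

/-- `\bar μ = (4/n²) a₀ μ - (m-1)²/4`. -/
def muBar (n : ℕ) (αM μ : ℝ) : ℝ := 4 / (n : ℝ) ^ 2 * a₀ n αM * μ - ((m : ℝ) - 1) ^ 2 / 4

variable (S) in
/-- The eigenspaces `E_μ` with `\bar μ ≤ 0`. (`E_μ = 0` if `μ` is not an eigenvalue.) -/
def lowEigenspace (n : ℕ) (αM : ℝ) (k : {μ : ℝ // muBar m n αM μ ≤ 0}) :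
    Submodule ℂ (Lp ℂ 2 (vol m S)) :=
  eigenspace m S (k : ℝ)

variable (S) in
/-- `𝓗₀ ⊂ L²(S, ℂ)`, the span of the eigenspaces `E_μ` of `-Δ` with `\bar μ ≤ 0`. -/
def H₀ (n : ℕ) (αM : ℝ) : Submodule ℂ (Lp ℂ 2 (vol m S)) :=
  ⨆ k, lowEigenspace m S n αM k

variable (n : ℕ) (αM : ℝ)

theorem orthogonalFamily :
    OrthogonalFamily ℂ (fun k => lowEigenspace m S n αM k)
      fun k => (lowEigenspace m S n αM k).subtypeₗᵢ := by
  intro k l hkl v w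
  exact (eigenspace_orthogonal m (S := S) (fun h => hkl (Subtype.ext h))).inner_eq v.2 w.2

variable (S) in
open Classical in
/-- The decomposition of `𝓗₀` into eigenspaces. -/
def decomposition : (Π₀ k, lowEigenspace m S n αM k) ≃ₗ[ℂ] H₀ m S n αM :=
  (LinearEquiv.ofInjective
    (DFinsupp.lsum ℕ fun k => (lowEigenspace m S n αM k).subtype)
    (orthogonalFamily m n αM).independent.dfinsupp_lsum_injective).trans
    (LinearEquiv.ofEq _ _ (Submodule.iSup_eq_range_dfinsupp_lsum _).symm)

variable (S) in
/-- `-Δ` on `𝓗₀`: multiplication by `μ` on `E_μ`. -/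
def negLaplacian : H₀ m S n αM →ₗ[ℂ] H₀ m S n αM :=
  (decomposition m S n αM).toLinearMap ∘ₗ
    (DFinsupp.mapRange.linearMap fun k =>
      ((k : ℝ) : ℂ) • (LinearMap.id : lowEigenspace m S n αM k →ₗ[ℂ] _)) ∘ₗ
    (decomposition m S n αM).symm.toLinearMap

variable (S) in
theorem decomposition_single (k : {μ : ℝ // muBar m n αM μ ≤ 0})
    (η : lowEigenspace m S n αM k) :
    open Classical in
    ((decomposition m S n αM (DFinsupp.single k η) : H₀ m S n αM) : Lp ℂ 2 (vol m S)) = η := by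
  classical
  exact DFinsupp.lsum_single ℕ (fun k => (lowEigenspace m S n αM k).subtype) k η

theorem negLaplacian_apply (k : {μ : ℝ // muBar m n αM μ ≤ 0}) (η : H₀ m S n αM)
    (hη : (η : Lp ℂ 2 (vol m S)) ∈ eigenspace m S (k : ℝ)) :
    negLaplacian m S n αM η = ((k : ℝ) : ℂ) • η := by
  classical
  obtain ⟨d, rfl⟩ := (decomposition m S n αM).surjective η
  have hd : d = DFinsupp.single k ⟨_, hη⟩ := by
    apply (decomposition m S n αM).injective
    apply Subtype.ext
    exact (decomposition_single m S n αM k ⟨_, hη⟩).symm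
  generalize (⟨_, hη⟩ : lowEigenspace m S n αM k) = e at hd
  subst hd
  simp only [negLaplacian, LinearMap.comp_apply, LinearEquiv.coe_coe, LinearEquiv.symm_apply_apply]
  rw [← map_smul]
  congr 1
  rw [DFinsupp.mapRange.linearMap_apply, DFinsupp.mapRange_single, ← DFinsupp.single_smul]
  rfl

variable (S) in
theorem decomposition_coe (d : Π₀ k, lowEigenspace m S n αM k)
    (s : Finset {μ : ℝ // muBar m n αM μ ≤ 0}) (hs : ∀ k, k ∉ s → d k = 0) :
    ((decomposition m S n αM d : H₀ m S n αM) : Lp ℂ 2 (vol m S)) =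
      ∑ k ∈ s, (d k : Lp ℂ 2 (vol m S)) := by
  classical
  have h1 : ((decomposition m S n αM d : H₀ m S n αM) : Lp ℂ 2 (vol m S)) =
      DFinsupp.lsum ℕ (fun k => (lowEigenspace m S n αM k).subtype) d := rfl
  rw [h1, DFinsupp.lsum_apply_apply, DFinsupp.sumAddHom_apply, DFinsupp.sum]
  apply Finset.sum_subset
  · intro k hk
    by_contra h
    exact (DFinsupp.mem_support_iff.1 hk) (hs k h)
  · intro k _ hk
    have : d k = 0 := by simpa using hk
    simp [this]

variable (S) in
/-- The operator `(4/n²) a₀ Δ + (m-1)²/4` on `𝓗₀`, which is multiplication by `-\bar μ ≥ 0` on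
`E_μ`. -/
def angular : H₀ m S n αM →ₗ[ℂ] H₀ m S n αM :=
  ((((m : ℝ) - 1) ^ 2 / 4 : ℝ) : ℂ) • LinearMap.id -
    ((4 / (n : ℝ) ^ 2 * a₀ n αM : ℝ) : ℂ) • negLaplacian m S n αM

theorem angular_decomposition (d : Π₀ k, lowEigenspace m S n αM k) :
    angular m S n αM (decomposition m S n αM d) = decomposition m S n αM
      (DFinsupp.mapRange.linearMap (fun k : {μ : ℝ // muBar m n αM μ ≤ 0} =>
      ((-muBar m n αM k : ℝ) : ℂ) • (LinearMap.id : lowEigenspace m S n αM k →ₗ[ℂ] _)) d) := by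
  simp only [angular, negLaplacian, LinearMap.sub_apply, LinearMap.smul_apply, LinearMap.id_apply,
    LinearMap.comp_apply, LinearEquiv.coe_coe, LinearEquiv.symm_apply_apply]
  rw [← map_smul, ← map_smul, ← map_sub]
  congr 1
  ext1 k
  simp only [DFinsupp.sub_apply, DFinsupp.smul_apply, DFinsupp.mapRange.linearMap_apply,
    DFinsupp.mapRange_apply, LinearMap.smul_apply, LinearMap.id_apply, smul_smul, ← sub_smul]
  congr 1
  simp only [muBar]
  push_cast
  ring

theorem angular_apply (k : {μ : ℝ // muBar m n αM μ ≤ 0}) (η : H₀ m S n αM)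
    (hη : (η : Lp ℂ 2 (vol m S)) ∈ eigenspace m S (k : ℝ)) :
    angular m S n αM η = ((-muBar m n αM k : ℝ) : ℂ) • η := by
  rw [angular, LinearMap.sub_apply, LinearMap.smul_apply, LinearMap.smul_apply,
    negLaplacian_apply m n αM k η hη, LinearMap.id_apply, smul_smul, ← sub_smul]
  congr 1
  simp only [muBar]
  push_cast
  ring

variable (S) in
theorem inner_decomposition (d d' : Π₀ k, lowEigenspace m S n αM k)
    (s : Finset {μ : ℝ // muBar m n αM μ ≤ 0}) (hd : ∀ k, k ∉ s → d k = 0)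
    (hd' : ∀ k, k ∉ s → d' k = 0) :
    inner ℂ (decomposition m S n αM d) (decomposition m S n αM d') =
      ∑ k ∈ s, inner ℂ (d k) (d' k) := by
  rw [Submodule.coe_inner, decomposition_coe m S n αM d s hd, decomposition_coe m S n αM d' s hd']
  exact (orthogonalFamily m n αM).inner_sum (fun k => d k) (fun k => d' k) s

variable (S) in
theorem angular_isPositive : (angular m S n αM).IsPositive := by
  classical
  have key : ∀ d d' : Π₀ k, lowEigenspace m S n αM k, ∃ s : Finset {μ : ℝ // muBar m n αM μ ≤ 0},
      inner ℂ (angular m S n αM (decomposition m S n αM d)) (decomposition m S n αM d') =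
        ∑ k ∈ s, ((-muBar m n αM k : ℝ) : ℂ) * inner ℂ (d k) (d' k) ∧
      inner ℂ (decomposition m S n αM d) (angular m S n αM (decomposition m S n αM d')) =
        ∑ k ∈ s, ((-muBar m n αM k : ℝ) : ℂ) * inner ℂ (d k) (d' k) := by
    intro d d'
    have hd : ∀ k, k ∉ d.support ∪ d'.support → d k = 0 := by
      intro k hk
      simp only [Finset.mem_union, DFinsupp.mem_support_toFun, not_or, not_not] at hk
      exact hk.1
    have hd' : ∀ k, k ∉ d.support ∪ d'.support → d' k = 0 := by
      intro k hk
      simp only [Finset.mem_union, DFinsupp.mem_support_toFun, not_or, not_not] at hk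
      exact hk.2
    refine ⟨d.support ∪ d'.support, ?_, ?_⟩
    · rw [angular_decomposition, inner_decomposition m S n αM _ _ (d.support ∪ d'.support) ?_ hd']
      · apply Finset.sum_congr rfl
        intro k _
        rw [DFinsupp.mapRange.linearMap_apply, DFinsupp.mapRange_apply, LinearMap.smul_apply,
          LinearMap.id_apply, inner_smul_left, Complex.conj_ofReal]
      · intro k hk
        rw [DFinsupp.mapRange.linearMap_apply, DFinsupp.mapRange_apply, hd k hk, map_zero]
    · rw [angular_decomposition, inner_decomposition m S n αM _ _ (d.support ∪ d'.support) hd ?_]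
      · apply Finset.sum_congr rfl
        intro k _
        rw [DFinsupp.mapRange.linearMap_apply, DFinsupp.mapRange_apply, LinearMap.smul_apply,
          LinearMap.id_apply, inner_smul_right]
      · intro k hk
        rw [DFinsupp.mapRange.linearMap_apply, DFinsupp.mapRange_apply, hd' k hk, map_zero]
  refine ⟨fun f g => ?_, fun f => ?_⟩
  · obtain ⟨d, rfl⟩ := (decomposition m S n αM).surjective f
    obtain ⟨d', rfl⟩ := (decomposition m S n αM).surjective g
    obtain ⟨s, h1, h2⟩ := key d d'
    rw [h1, h2]
  · obtain ⟨d, rfl⟩ := (decomposition m S n αM).surjective f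
    obtain ⟨s, h1, -⟩ := key d d
    rw [h1, map_sum]
    apply Finset.sum_nonneg
    intro k _
    have := mul_nonneg (neg_nonneg.2 k.2) (inner_self_nonneg (𝕜 := ℂ) (x := d k))
    rwa [← RCLike.re_ofReal_mul] at this

end Laplacian

/-! ### Radial function spaces and operators with values in a finite dimensional Hilbert space `F` -/

section Radial

/-- The interval `(0, b)`, where `b = ∞` is allowed. -/
def interval (b : EReal) : Set ℝ := {r | 0 < r ∧ (r : EReal) < b}

theorem isOpen_interval (b : EReal) : IsOpen (interval b) :=
  (isOpen_lt continuous_const continuous_id).inter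
    (isOpen_lt continuous_coe_real_ereal continuous_const)

theorem pos_of_mem {b : EReal} {r : ℝ} (h : r ∈ interval b) : 0 < r := h.1

/-- The measure `r^q dr` on `(0, b)`. -/
def radialMeasure (b : EReal) (q : ℝ) : Measure ℝ :=
  (volume.restrict (interval b)).withDensity fun r => ENNReal.ofReal (r ^ q)

theorem memLp_radial {F : Type*} [NormedAddCommGroup F] {b : EReal} {q : ℝ} {f : ℝ → F} {K : Set ℝ} (hK : IsCompact K)
    (hKI : K ⊆ interval b) (hf : ContinuousOn f (interval b)) (h0 : ∀ r, r ∉ K → f r = 0) :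
    MemLp f 2 (radialMeasure b q) := by
  have hfK : f = K.indicator f := by
    ext r
    by_cases hr : r ∈ K
    · simp [hr]
    · simp [hr, h0 r hr]
  rw [hfK, memLp_indicator_iff_restrict hK.measurableSet]
  have hfin : IsFiniteMeasure ((radialMeasure b q).restrict K) := by
    constructor
    rw [Measure.restrict_apply_univ, radialMeasure, withDensity_apply _ hK.measurableSet,
      Measure.restrict_restrict hK.measurableSet, inter_eq_left.2 hKI]
    have hc : ContinuousOn (fun r : ℝ => r ^ q) K := fun r hr =>
      (Real.continuousAt_rpow_const r q (Or.inl (pos_of_mem (hKI hr)).ne')).continuousWithinAt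
    exact (hc.integrableOn_compact (μ := volume) hK).lintegral_lt_top
  obtain ⟨C, hC⟩ := hK.exists_bound_of_continuousOn (hf.mono hKI)
  refine MemLp.of_bound ?_ C ?_
  · exact (hf.mono hKI).aestronglyMeasurable_of_isCompact hK hK.measurableSet
  · exact (ae_restrict_mem hK.measurableSet).mono hC

variable {F : Type*} [NormedAddCommGroup F] [InnerProductSpace ℂ F]

variable (F) in
/-- `L²(I, q) ⊗ F` for `I = (0, b)`, as the space of `F`-valued functions that are square integrable
with respect to `r^q dr`. -/
abbrev StateSpace (b : EReal) (q : ℝ) : Type _ := Lp F 2 (radialMeasure b q)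

variable (F) in
/-- `C_c^∞(I) ⊗ F` for `I = (0, b)`: the span of the functions `u η`, `u ∈ C_c^∞(I, ℂ)`, `η ∈ F`. -/
def testSpace (b : EReal) : Submodule ℂ (ℝ → F) :=
  Submodule.span ℂ {φ | ∃ u : ℝ → ℂ, ContDiff ℝ ∞ u ∧ HasCompactSupport u ∧
    tsupport u ⊆ interval b ∧ ∃ η : F, φ = fun r => u r • η}

theorem testSpace_spec {b : EReal} {φ : ℝ → F} (h : φ ∈ testSpace F b) :
    ContDiff ℝ ∞ φ ∧ HasCompactSupport φ ∧ tsupport φ ⊆ interval b := by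
  induction h using Submodule.span_induction with
  | mem φ hφ =>
    obtain ⟨u, h1, h2, h3, η, rfl⟩ := hφ
    exact ⟨h1.smul contDiff_const, h2.smul_right, (tsupport_smul_subset_left u _).trans h3⟩
  | zero => exact ⟨contDiff_const, HasCompactSupport.zero, by simp [tsupport]⟩
  | add φ χ _ _ h1 h2 =>
    exact ⟨h1.1.add h2.1, h1.2.1.add h2.2.1,
      (tsupport_add φ χ).trans (union_subset h1.2.2 h2.2.2)⟩
  | smul c φ _ h1 =>
    exact ⟨contDiff_const.smul h1.1, h1.2.1.smul_left (f := fun _ => c),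
      (tsupport_smul_subset_right (fun _ : ℝ => c) φ).trans h1.2.2⟩

theorem comp_mem_testSpace (A : F →ₗ[ℂ] F) {b : EReal} {φ : ℝ → F} (h : φ ∈ testSpace F b) :
    (fun r => A (φ r)) ∈ testSpace F b := by
  induction h using Submodule.span_induction with
  | mem φ hφ =>
    obtain ⟨u, h1, h2, h3, η, rfl⟩ := hφ
    exact Submodule.subset_span ⟨u, h1, h2, h3, A η, by simp⟩
  | zero => simp only [Pi.zero_apply, map_zero]; exact (testSpace F b).zero_mem
  | add φ χ _ _ h1 h2 => simpa using! (testSpace F b).add_mem h1 h2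
  | smul c φ _ h1 => simpa using! (testSpace F b).smul_mem c h1

/-- The canonical map `C_c^∞(I) ⊗ F → L²(I, q) ⊗ F`. -/
def toState (b : EReal) (q : ℝ) : testSpace F b →ₗ[ℂ] StateSpace F b q where
  toFun φ := MemLp.toLp (φ : ℝ → F) (memLp_radial (testSpace_spec φ.2).2.1
    (testSpace_spec φ.2).2.2 (testSpace_spec φ.2).1.continuous.continuousOn
    fun _ hr => image_eq_zero_of_notMem_tsupport hr)
  map_add' _ _ := rfl
  map_smul' _ _ := rfl

/-- The operator `φ ↦ - r⁻¹ (r φ')' + r⁻² A φ + W φ`. -/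
def radialOp (A : F →ₗ[ℂ] F) (W : ℝ → ℝ) (φ : ℝ → F) (r : ℝ) : F :=
  -(r⁻¹ • deriv (fun s => s • deriv φ s) r) + (r ^ 2)⁻¹ • A (φ r) + W r • φ r

theorem radialOp_props (A : F →ₗ[ℂ] F) {W : ℝ → ℝ} (hW : ContinuousOn W (Ioi 0)) (p : ℝ)
    {b : EReal} {φ : ℝ → F} (h : φ ∈ testSpace F b) :
    ContinuousOn (fun r => r ^ (-p) • radialOp A W φ r) (interval b) ∧
      ∀ r, r ∉ tsupport φ → r ^ (-p) • radialOp A W φ r = 0 := by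
  obtain ⟨h1, h2, h3⟩ := testSpace_spec h
  have hA := (testSpace_spec (comp_mem_testSpace A h)).1.continuous
  have hd : ContDiff ℝ ∞ (deriv φ) := (contDiff_infty_iff_deriv.1 h1).2
  have hd2 : Continuous (deriv (fun s : ℝ => s • deriv φ s)) :=
    (contDiff_infty_iff_deriv.1 (contDiff_id.smul hd)).2.continuous
  refine ⟨?_, fun r hr => ?_⟩
  · have hpos : ∀ r ∈ interval b, r ≠ 0 := fun r hr => (pos_of_mem hr).ne'
    have hp : ContinuousOn (fun r : ℝ => r ^ (-p)) (interval b) := fun r hr =>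
      (Real.continuousAt_rpow_const r _ (Or.inl (hpos r hr))).continuousWithinAt
    refine hp.smul ?_
    refine ((ContinuousOn.neg ?_).add ?_).add ?_
    · exact (continuousOn_id.inv₀ hpos).smul hd2.continuousOn
    · exact ((continuousOn_id.pow 2).inv₀ fun r hr => pow_ne_zero 2 (hpos r hr)).smul
        hA.continuousOn
    · exact (hW.mono fun r hr => pos_of_mem hr).smul h1.continuous.continuousOn
  · have e0 : φ =ᶠ[𝓝 r] 0 := notMem_tsupport_iff_eventuallyEq.1 hr
    have e1 : deriv φ =ᶠ[𝓝 r] 0 := by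
      filter_upwards [e0.eventuallyEq_nhds] with s hs
      rw [hs.deriv_eq]
      simp
    have e2 : (fun s : ℝ => s • deriv φ s) =ᶠ[𝓝 r] fun _ => (0 : F) := by
      filter_upwards [e1] with s hs
      simp [hs]
    simp [radialOp, e2.deriv_eq, e0.eq_of_nhds]

theorem radialOp_add (A : F →ₗ[ℂ] F) (W : ℝ → ℝ) {b : EReal} {φ χ : ℝ → F}
    (hφ : φ ∈ testSpace F b) (hχ : χ ∈ testSpace F b) (r : ℝ) :
    radialOp A W (φ + χ) r = radialOp A W φ r + radialOp A W χ r := by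
  have h1 := (testSpace_spec hφ).1
  have h2 := (testSpace_spec hχ).1
  have d1 : ContDiff ℝ ∞ (fun s : ℝ => s • deriv φ s) :=
    contDiff_id.smul (contDiff_infty_iff_deriv.1 h1).2
  have d2 : ContDiff ℝ ∞ (fun s : ℝ => s • deriv χ s) :=
    contDiff_id.smul (contDiff_infty_iff_deriv.1 h2).2
  have e : (fun s : ℝ => s • deriv (φ + χ) s) =
      (fun s : ℝ => s • deriv φ s) + fun s : ℝ => s • deriv χ s := by
    ext1 s
    rw [deriv_add (h1.differentiable (by simp) s) (h2.differentiable (by simp) s), smul_add]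
    rfl
  rw [radialOp, e, deriv_add (d1.differentiable (by simp) r) (d2.differentiable (by simp) r)]
  simp only [radialOp, Pi.add_apply, map_add, smul_add]
  abel

theorem radialOp_smul (A : F →ₗ[ℂ] F) (W : ℝ → ℝ) (c : ℂ) {b : EReal} {φ : ℝ → F}
    (hφ : φ ∈ testSpace F b) (r : ℝ) :
    radialOp A W (c • φ) r = c • radialOp A W φ r := by
  have h1 := (testSpace_spec hφ).1
  have d1 : ContDiff ℝ ∞ (fun s : ℝ => s • deriv φ s) :=
    contDiff_id.smul (contDiff_infty_iff_deriv.1 h1).2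
  have e : (fun s : ℝ => s • deriv (c • φ) s) = c • fun s : ℝ => s • deriv φ s := by
    ext1 s
    rw [deriv_const_smul c (h1.differentiable (by simp) s)]
    simp only [Pi.smul_apply]
    rw [smul_comm]
  rw [radialOp, e, deriv_const_smul c (d1.differentiable (by simp) r)]
  simp only [radialOp, Pi.smul_apply, map_smul, smul_add, smul_neg]
  simp only [smul_comm _ c]

/-- The operator `φ ↦ r^{-p} (- r⁻¹ (r φ')' + r⁻² A φ + W φ)` on `C_c^∞(I) ⊗ F`, with values in
`L²(I, q) ⊗ F`. -/
def hatOp (A : F →ₗ[ℂ] F) (W : ℝ → ℝ) (hW : ContinuousOn W (Ioi 0)) (p : ℝ) (b : EReal) (q : ℝ) :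
    testSpace F b →ₗ[ℂ] StateSpace F b q where
  toFun φ := MemLp.toLp (fun r => r ^ (-p) • radialOp A W φ r)
    (memLp_radial (testSpace_spec φ.2).2.1 (testSpace_spec φ.2).2.2
      (radialOp_props A hW p φ.2).1 (radialOp_props A hW p φ.2).2)
  map_add' φ χ := by
    rw [← MemLp.toLp_add]
    congr 1
    ext1 r
    rw [Submodule.coe_add, radialOp_add A W φ.2 χ.2, smul_add]
    rfl
  map_smul' c φ := by
    rw [RingHom.id_apply, ← MemLp.toLp_const_smul]
    congr 1
    ext1 r
    rw [Submodule.coe_smul, radialOp_smul A W c φ.2, smul_comm]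
    rfl

/-! The form domain: the completion of the test functions for the energy scalar product. -/

/-- The integrand of the energy scalar product,
`r ⟨φ', χ'⟩ + r⁻¹ ⟨A φ, χ⟩ + w r³ ⟨φ, χ⟩`. -/
def energyDensity (A : F →ₗ[ℂ] F) (w : ℝ≥0) (φ χ : ℝ → F) (r : ℝ) : ℂ :=
  r * inner ℂ (deriv φ r) (deriv χ r) + ((r⁻¹ : ℝ) : ℂ) * inner ℂ (A (φ r)) (χ r) +
    ((w * r ^ 3 : ℝ) : ℂ) * inner ℂ (φ r) (χ r)

/-- The energy scalar product. -/
def energy (A : F →ₗ[ℂ] F) (b : EReal) (w : ℝ≥0) (φ χ : ℝ → F) : ℂ :=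
  ∫ r in interval b, energyDensity A w φ χ r

theorem integrableOn_energyDensity (A : F →ₗ[ℂ] F) {b : EReal} (w : ℝ≥0) {φ χ : ℝ → F}
    (hφ : φ ∈ testSpace F b) (hχ : χ ∈ testSpace F b) :
    IntegrableOn (energyDensity A w φ χ) (interval b) := by
  obtain ⟨h1, h2, h3⟩ := testSpace_spec hφ
  have h1' := (testSpace_spec hχ).1
  have hA := (testSpace_spec (comp_mem_testSpace A hφ)).1.continuous
  have hd : Continuous (deriv φ) := (contDiff_infty_iff_deriv.1 h1).2.continuous
  have hd' : Continuous (deriv χ) := (contDiff_infty_iff_deriv.1 h1').2.continuous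
  have hc : ContinuousOn (energyDensity A w φ χ) (interval b) := by
    have hi : ContinuousOn (fun r : ℝ => ((r⁻¹ : ℝ) : ℂ)) (interval b) :=
      Complex.continuous_ofReal.comp_continuousOn
        (continuousOn_id.inv₀ fun r hr => (pos_of_mem hr).ne')
    have c1 : Continuous fun r : ℝ => (r : ℂ) * inner ℂ (deriv φ r) (deriv χ r) :=
      Complex.continuous_ofReal.mul (hd.inner hd')
    have c2 : Continuous fun r : ℝ => inner ℂ (A (φ r)) (χ r) := hA.inner h1'.continuous
    have c3 : Continuous fun r : ℝ => ((w * r ^ 3 : ℝ) : ℂ) * inner ℂ (φ r) (χ r) :=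
      (Complex.continuous_ofReal.comp (continuous_const.mul (continuous_id.pow 3))).mul
        (h1.continuous.inner h1'.continuous)
    exact (c1.continuousOn.add (hi.mul c2.continuousOn)).add c3.continuousOn
  have hint : IntegrableOn (energyDensity A w φ χ) (tsupport φ) :=
    (hc.mono h3).integrableOn_compact h2
  rw [integrableOn_iff_integrable_of_support_subset] at hint
  · exact hint.integrableOn
  · intro r hr
    by_contra h
    apply hr
    have e0 : φ r = 0 := image_eq_zero_of_notMem_tsupport h
    have e1 : deriv φ r = 0 := by
      rw [(notMem_tsupport_iff_eventuallyEq.1 h).deriv_eq]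
      simp
    simp [energyDensity, e0, e1]

theorem energyDensity_self (A : F →ₗ[ℂ] F) (hA : A.IsPositive) (w : ℝ≥0) (φ : ℝ → F) {r : ℝ}
    (hr : 0 < r) : r * ‖deriv φ r‖ ^ 2 ≤ (energyDensity A w φ φ r).re := by
  have e1 : (inner ℂ (deriv φ r) (deriv φ r) : ℂ).re = ‖deriv φ r‖ ^ 2 :=
    (norm_sq_eq_re_inner (𝕜 := ℂ) _).symm
  have e2 : 0 ≤ (inner ℂ (A (φ r)) (φ r) : ℂ).re := hA.2 _
  have e3 : 0 ≤ (inner ℂ (φ r) (φ r) : ℂ).re := inner_self_nonneg (𝕜 := ℂ)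
  rw [energyDensity, Complex.add_re, Complex.add_re, Complex.re_ofReal_mul, Complex.re_ofReal_mul,
    Complex.re_ofReal_mul, e1]
  have := mul_nonneg (inv_nonneg.2 hr.le) e2
  have := mul_nonneg (mul_nonneg w.2 (pow_nonneg hr.le 3)) e3
  simp only [NNReal.val_eq_coe] at this
  linarith

theorem energy_re (A : F →ₗ[ℂ] F) {b : EReal} (w : ℝ≥0) {φ : ℝ → F} (hφ : φ ∈ testSpace F b) :
    (energy A b w φ φ).re = ∫ r in interval b, (energyDensity A w φ φ r).re :=
  (integral_re (𝕜 := ℂ) (integrableOn_energyDensity A w hφ hφ)).symm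

theorem eq_zero_of_energy (A : F →ₗ[ℂ] F) (hA : A.IsPositive) {b : EReal} (w : ℝ≥0) {φ : ℝ → F}
    (hφ : φ ∈ testSpace F b) (h : energy A b w φ φ = 0) : φ = 0 := by
  obtain ⟨h1, h2, h3⟩ := testSpace_spec hφ
  have hd : Continuous (deriv φ) := (contDiff_infty_iff_deriv.1 h1).2.continuous
  have hI := (isOpen_interval b).measurableSet
  have hz : ∫ r in interval b, (energyDensity A w φ φ r).re = 0 := by
    rw [← energy_re A w hφ, h, Complex.zero_re]
  have hnn : ∀ r ∈ interval b, 0 ≤ (energyDensity A w φ φ r).re := fun r hr =>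
    (mul_nonneg (pos_of_mem hr).le (sq_nonneg _)).trans (energyDensity_self A hA w φ (pos_of_mem hr))
  have hae := (setIntegral_eq_zero_iff_of_nonneg_ae ((ae_restrict_mem hI).mono hnn)
    (integrableOn_energyDensity A w hφ hφ).re).1 hz
  have hder : ∀ᵐ r : ℝ, deriv φ r = 0 := by
    filter_upwards [(ae_restrict_iff' hI).1 hae] with r hr
    by_cases hrI : r ∈ interval b
    · have e := energyDensity_self A hA w φ (pos_of_mem hrI)
      have e' : (energyDensity A w φ φ r).re = 0 := hr hrI
      rw [e'] at e
      have : ‖deriv φ r‖ ^ 2 ≤ 0 := by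
        by_contra hc
        exact absurd e (not_le.2 (mul_pos (pos_of_mem hrI) (not_le.1 hc)))
      simpa using le_antisymm this (sq_nonneg _)
    · rw [(notMem_tsupport_iff_eventuallyEq.1 fun hc => hrI (h3 hc)).deriv_eq]
      simp
  have hder' : deriv φ = 0 := (Continuous.ae_eq_iff_eq volume hd continuous_const).1 hder
  have hconst : ∀ x y, φ x = φ y :=
    is_const_of_deriv_eq_zero (h1.differentiable (by simp)) fun x => congrFun hder' x
  have h0 : φ 0 = 0 := image_eq_zero_of_notMem_tsupport fun hc => (pos_of_mem (h3 hc)).ne' rfl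
  ext1 r
  rw [hconst r 0, h0]
  rfl

/-- The space `C_c^∞(I) ⊗ F` with the energy scalar product. -/
@[nolint unusedArguments]
def EnergySpace (_A : {A : F →ₗ[ℂ] F // A.IsPositive}) (b : EReal) (_w : ℝ≥0) : Type _ :=
  testSpace F b

variable (A : {A : F →ₗ[ℂ] F // A.IsPositive}) (b : EReal) (w : ℝ≥0)

instance : AddCommGroup (EnergySpace A b w) := inferInstanceAs (AddCommGroup (testSpace F b))

instance : Module ℂ (EnergySpace A b w) := inferInstanceAs (Module ℂ (testSpace F b))

/-- The identification of `EnergySpace` with the space of test functions. -/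
def EnergySpace.equiv : EnergySpace A b w ≃ₗ[ℂ] testSpace F b := LinearEquiv.refl ℂ (testSpace F b)

/-- The energy scalar product on test functions satisfies the laws of a scalar product. -/
@[reducible] def energyCore : InnerProductSpace.Core ℂ (EnergySpace A b w) where
  inner φ χ := energy A.1 b w (EnergySpace.equiv A b w φ : ℝ → F) (EnergySpace.equiv A b w χ)
  conj_inner_symm φ χ := by
    rw [energy, energy, ← integral_conj]
    congr 1
    ext1 r
    simp only [energyDensity, map_add, map_mul, Complex.conj_ofReal, inner_conj_symm]
    rw [← A.2.1]
  re_inner_nonneg φ := by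
    change 0 ≤ (energy A.1 b w _ _).re
    rw [energy_re A.1 w (EnergySpace.equiv A b w φ).2]
    refine setIntegral_nonneg (isOpen_interval b).measurableSet fun r hr => ?_
    exact (mul_nonneg (pos_of_mem hr).le (sq_nonneg _)).trans
      (energyDensity_self A.1 A.2 w _ (pos_of_mem hr))
  add_left φ χ ξ := by
    rw [energy, energy, energy, ← integral_add
      (integrableOn_energyDensity A.1 w (EnergySpace.equiv A b w φ).2 (EnergySpace.equiv A b w ξ).2)
      (integrableOn_energyDensity A.1 w (EnergySpace.equiv A b w χ).2
        (EnergySpace.equiv A b w ξ).2)]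
    congr 1
    ext1 r
    have h1 := (testSpace_spec (EnergySpace.equiv A b w φ).2).1.differentiable (by simp) r
    have h2 := (testSpace_spec (EnergySpace.equiv A b w χ).2).1.differentiable (by simp) r
    simp only [energyDensity, map_add, Submodule.coe_add, deriv_add h1 h2, Pi.add_apply,
      inner_add_left]
    ring
  smul_left φ χ c := by
    rw [energy, energy, ← integral_const_mul]
    congr 1
    ext1 r
    have h1 := (testSpace_spec (EnergySpace.equiv A b w φ).2).1.differentiable (by simp) r
    simp only [energyDensity, map_smul, Submodule.coe_smul, deriv_const_smul c h1, Pi.smul_apply,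
      inner_smul_left]
    ring
  definite φ h := by
    apply (EnergySpace.equiv A b w).injective
    apply Subtype.ext
    rw [map_zero]
    exact eq_zero_of_energy A.1 A.2 w (EnergySpace.equiv A b w φ).2 h

instance : NormedAddCommGroup (EnergySpace A b w) :=
  (energyCore A b w).toNormedAddCommGroup

instance : InnerProductSpace ℂ (EnergySpace A b w) :=
  InnerProductSpace.ofCore (energyCore A b w).toCore

/-- The completion of `C_c^∞(I) ⊗ F` with respect to the energy norm. -/
abbrev FormDomain : Type _ := UniformSpace.Completion (EnergySpace A b w)

/-- The canonical embedding of the completion into `L²(I, q) ⊗ F`, as a relation: the closure of the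
set of the pairs `(φ, φ)`, `φ ∈ C_c^∞(I) ⊗ F`. Hence `(x, ψ)` belongs to it if and only if there are
test functions that converge to `x` in the completion and to `ψ` in `L²(I, q) ⊗ F`. -/
def embedding (q : ℝ) : Submodule ℂ (FormDomain A b w × StateSpace F b q) :=
  (LinearMap.range (LinearMap.prod
    (UniformSpace.Completion.toComplₗᵢ (𝕜 := ℂ) (E := EnergySpace A b w)).toLinearMap
    (toState b q ∘ₗ (EnergySpace.equiv A b w).toLinearMap))).topologicalClosure

/-- The operator `r^{-p} (- r⁻¹ (r ψ')' + r⁻² A ψ + W ψ)` in `L²(I, q) ⊗ F`, in the distributional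
sense, with domain in the completion of the test functions: `ψ` is mapped to `χ` if `ψ` belongs to
(the image of) the completion and `⟨ψ, T φ⟩ = ⟨χ, φ⟩` for all test functions `φ`, where `T φ` is
the classical operator. -/
def hamiltonianGraph (W : ℝ → ℝ) (hW : ContinuousOn W (Ioi 0)) (p q : ℝ) :
    Submodule ℂ (StateSpace F b q × StateSpace F b q) where
  carrier := {ψχ | (∃ x : FormDomain A b w, (x, ψχ.1) ∈ embedding A b w q) ∧
    ∀ φ : testSpace F b, inner ℂ (hatOp A.1 W hW p b q φ) ψχ.1 = inner ℂ (toState b q φ) ψχ.2}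
  add_mem' := by
    rintro ⟨ψ, χ⟩ ⟨ψ', χ'⟩ ⟨⟨x, hx⟩, h⟩ ⟨⟨x', hx'⟩, h'⟩
    refine ⟨⟨x + x', (embedding A b w q).add_mem hx hx'⟩, fun φ => ?_⟩
    simp only [Prod.mk_add_mk, inner_add_right]
    rw [h φ, h' φ]
  zero_mem' := ⟨⟨0, (embedding A b w q).zero_mem⟩, fun φ => by simp⟩
  smul_mem' := by
    rintro c ⟨ψ, χ⟩ ⟨⟨x, hx⟩, h⟩
    refine ⟨⟨c • x, (embedding A b w q).smul_mem c hx⟩, fun φ => ?_⟩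
    simp only [Prod.smul_mk, inner_smul_right]
    rw [h φ]

/-- The operator with the graph `hamiltonianGraph`. -/
def hamiltonian (W : ℝ → ℝ) (hW : ContinuousOn W (Ioi 0)) (p q : ℝ) :
    StateSpace F b q →ₗ.[ℂ] StateSpace F b q :=
  (hamiltonianGraph A b w W hW p q).toLinearPMap

end Radial

/-! ### Unbounded operators in a Hilbert space -/

section Operators

variable {E : Type*} [NormedAddCommGroup E] [InnerProductSpace ℂ E]

/-- `E` is a Hilbert space and `T` is a densely defined selfadjoint operator in `E`. -/
def IsSelfAdjointOperator (T : E →ₗ.[ℂ] E) : Prop :=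
  ∃ _ : CompleteSpace E, Dense (T.domain : Set E) ∧ IsSelfAdjoint T

/-- `ψ` belongs to the domain of `T` and `T ψ = z ψ`. -/
def IsEigenSolution (T : E →ₗ.[ℂ] E) (z : ℂ) (ψ : E) : Prop :=
  ∃ h : ψ ∈ T.domain, T ⟨ψ, h⟩ = z • ψ

/-- The set of all `z` such that `T - z` has a bounded inverse defined on the whole space. -/
def resolventSet (T : E →ₗ.[ℂ] E) : Set ℂ :=
  {z | ∃ R : E →L[ℂ] E, (∀ χ, ∃ h : R χ ∈ T.domain, T ⟨R χ, h⟩ - z • R χ = χ) ∧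
    ∀ ψ : T.domain, R (T ψ - z • (ψ : E)) = ψ}

/-- The spectrum of `T` consists of eigenvalues and the eigenvectors span a dense subspace. -/
def HasPurePointSpectrum (T : E →ₗ.[ℂ] E) : Prop :=
  (∀ z, z ∉ resolventSet T → ∃ ψ, ψ ≠ 0 ∧ IsEigenSolution T z ψ) ∧
    (Submodule.span ℂ {ψ | ∃ z, IsEigenSolution T z ψ}).topologicalClosure = ⊤

end Operators

/-! ### The two Hamiltonians -/

section Hamiltonians

/-- `\bar V = α_M V / (n (n-1))`. -/
def Vbar (n : ℕ) (αM V : ℝ) : ℝ := αM / (n * (n - 1)) * V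

/-- The exponent `p₁ = 2`. -/
def p₁ : ℝ := 2

/-- The exponent `p₂ = 2(n-2)/n`. -/
def p₂ (n : ℕ) : ℝ := 2 * (n - 2) / n

/-- The terms of order zero of `H₁`: `-(16/n²) \bar V r² + (16/n²) κ r^{2(n-2)/n}`. -/
def potential₁ (n : ℕ) (αM V κ : ℝ) (r : ℝ) : ℝ :=
  -(16 / (n : ℝ) ^ 2) * Vbar n αM V * r ^ 2 +
    16 / (n : ℝ) ^ 2 * κ * r ^ (2 * ((n : ℝ) - 2) / n)

/-- The terms of order zero of `H₂`: `(16/n²) r²`. -/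
def potential₂ (n : ℕ) (r : ℝ) : ℝ := 16 / (n : ℝ) ^ 2 * r ^ 2

theorem continuousOn_potential₁ (n : ℕ) (αM V κ : ℝ) :
    ContinuousOn (potential₁ n αM V κ) (Ioi 0) := by
  refine ContinuousOn.add (by fun_prop) (continuousOn_const.mul fun r hr => ?_)
  exact (Real.continuousAt_rpow_const r _ (Or.inl (ne_of_gt hr))).continuousWithinAt

theorem continuousOn_potential₂ (n : ℕ) : ContinuousOn (potential₂ n) (Ioi 0) := by
  unfold potential₂
  fun_prop

variable (m : ℕ) (S : Type*) [EMetricSpace S] [ChartedSpace (EuclideanSpace ℝ (Fin m)) S]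
  [RiemannianBundle (fun x : S => TangentSpace (𝓡 m) x)] [MeasurableSpace S] [BorelSpace S]
  (n : ℕ) (αM : ℝ)

/-- The positive operator `(4/n²) a₀ Δ + (m-1)²/4` on `𝓗₀`. -/
def angularPos : {A : H₀ m S n αM →ₗ[ℂ] H₀ m S n αM // A.IsPositive} :=
  ⟨angular m S n αM, angular_isPositive m S n αM⟩

/-- `𝓗(I₁, p₁ + 1) = L²((0, r₀), p₁ + 1) ⊗ 𝓗₀`. -/
abbrev State₁ (r₀ : ℝ) : Type _ := StateSpace (H₀ m S n αM) r₀ (p₁ + 1)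

/-- `𝓗(I₂, p₂ + 1) = L²((0, ∞), p₂ + 1) ⊗ 𝓗₀`. -/
abbrev State₂ : Type _ := StateSpace (H₀ m S n αM) ⊤ (p₂ n + 1)

/-- `𝓗₁(0, r₀)`, the completion of `C_c^∞(0, r₀) ⊗ 𝓗₀` with respect to the norm
`‖ψ‖² = ∑ₖ ∫ {r |u_k'|² - r⁻¹ \bar μ_k |u_k|²} ‖η_k‖²`, `ψ = ∑ₖ u_k η_k`, `η_k ∈ E_{μ_k}`. -/
abbrev FormDomain₁ (r₀ : ℝ) : Type _ := FormDomain (angularPos m S n αM) r₀ 0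

/-- `𝓗₂(0, ∞)`, the completion of `C_c^∞(0, ∞) ⊗ 𝓗₀` with respect to the norm
`‖ψ‖² = ∑ₖ ∫ {r |u_k'|² - r⁻¹ \bar μ_k |u_k|² + r³ |u_k|²} ‖η_k‖²`. -/
abbrev FormDomain₂ : Type _ := FormDomain (angularPos m S n αM) ⊤ 1

/-- The Hamiltonian `Ĥ₁ = r^{-p₁} H₁` in `L²((0, r₀), p₁ + 1) ⊗ 𝓗₀`, where
`H₁ ψ = - r⁻¹ (r ψ')' - r⁻² (- (4/n²) a₀ Δ ψ - ((m-1)²/4) ψ) - (16/n²) \bar V r² ψ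
  + (16/n²) κ r^{2(n-2)/n} ψ`. -/
def hamiltonian₁ (V κ r₀ : ℝ) : State₁ m S n αM r₀ →ₗ.[ℂ] State₁ m S n αM r₀ :=
  hamiltonian (angularPos m S n αM) r₀ 0 (potential₁ n αM V κ) (continuousOn_potential₁ n αM V κ)
    p₁ (p₁ + 1)

/-- The Hamiltonian `Ĥ₂ = r^{-p₂} H₂` in `L²((0, ∞), p₂ + 1) ⊗ 𝓗₀`, where
`H₂ ψ = - r⁻¹ (r ψ')' - r⁻² (- (4/n²) a₀ Δ ψ - ((m-1)²/4) ψ) + (16/n²) r² ψ`. -/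
def hamiltonian₂ : State₂ m S n αM →ₗ.[ℂ] State₂ m S n αM :=
  hamiltonian (angularPos m S n αM) ⊤ 1 (potential₂ n) (continuousOn_potential₂ n) (p₂ n) (p₂ n + 1)

/-- The embedding of `𝓗₁(0, r₀)` into `𝓗(I₁, p₁ + 1)`. -/
abbrev embedding₁ (r₀ : ℝ) : Submodule ℂ (FormDomain₁ m S n αM r₀ × State₁ m S n αM r₀) :=
  embedding (angularPos m S n αM) r₀ 0 (p₁ + 1)

/-- The embedding of `𝓗₂(0, ∞)` into `𝓗(I₂, p₂ + 1)`. -/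
abbrev embedding₂ : Submodule ℂ (FormDomain₂ m S n αM × State₂ m S n αM) :=
  embedding (angularPos m S n αM) ⊤ 1 (p₂ n + 1)

end Hamiltonians

end WheelerDeWitt

end

noncomputable section

namespace WheelerDeWitt

/-! ### Operators with compact resolvent -/

/-! The spectral statements are an instance of the theory of semibounded forms with compact
embedding. Let `J` embed a form domain `E` into a Hilbert space `H`, compactly, injectively and with
dense range, and let `S` be a bounded symmetric operator on `E` with ε‖x‖² ≤ Re⟨Sx, x⟩ + C‖Jx‖².
Then S' = S + C J*J is invertible by Lax–Milgram, K = J S'⁻¹ J* is compact, symmetric and positive,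
and the operator T of the form is K⁻¹ - C. Selfadjointness, pure point spectrum and complete
eigenvectors of T are read off from K (`IsShiftedInverse.spectral_theorem`,
`IsFormOperator.spectral_theorem`).

For the radial operators `E` is the completion of the test functions in the energy norm. Integration
by parts (`inner_hatOp`) shows that r^{-p}H has the form energy + c₁⟨·,·⟩ in L²(r³dr) + c₂⟨·,·⟩ in
L²(r^{1+s}dr), so the distributional operator is the form operator (`isFormOperator_hamiltonian`).
Since ∫ r|φ'|² is bounded by the energy, |φ(r)|² ≤ (C/r)‖φ‖² for r < R (`PointBound`). Thus point
evaluation is an operator valued kernel that is square integrable for r^q dr, q ≥ 1, on (0, R), and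
the embedding is a norm limit of Hilbert–Schmidt operators as soon as the tails are uniformly small
(`TailBound`). On (0, r₀) there is no tail; on (0, ∞) the term r³|φ|² of the energy dominates
r^q|φ|² because q < 3. Coercivity follows in the first case from Ehrling's inequality, and in the
second because the form is at least min(1, 16/n²) times the energy.

The finite dimension of 𝓗₀ does not use the spectral theory of the Laplacian. On 𝓗₀ the condition μ̄
≤ 0 becomes ∫|df|² ≤ M∫|f|² (`exists_lintegral_gradInner_le`). Finitely many charts cover S in which
distance and volume are comparable with the Euclidean ones, and each is cut into small convex cells.
By the Poincaré inequality, ∫|f|² ≤ ½∫|f|² if f has mean zero on all cells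
(`IsLipschitzChart.exists_forms`). Hence the finitely many cell averages separate the points of 𝓗₀
(`finiteDimensional_H₀`). -/

theorem exists_monotone_reindex {ι : Type*} [Infinite ι] (f : ι → ℝ)
    (hf : ∀ R, {i | f i ≤ R}.Finite) :
    ∃ e : ℕ ≃ ι, Monotone (f ∘ e) ∧ Tendsto (f ∘ e) atTop atTop := by
  have hc : Countable ι := by
    rw [← countable_univ_iff]
    have : (univ : Set ι) = ⋃ N : ℕ, {i | f i ≤ N} := by
      ext i
      simpa using exists_nat_ge (f i)
    rw [this]
    exact countable_iUnion fun N => (hf N).countable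
  obtain ⟨g, hg⟩ := exists_injective_nat ι
  -- Ties of `f` are broken by an injection into ℕ. The order is then linear with finite lower sets
  -- and no maximum, which forces order type ℕ.
  let h : ι → ℝ ×ₗ ℕ := fun i => toLex (f i, g i)
  have hh : Function.Injective h := fun i j hij => hg (congrArg (fun p => (ofLex p).2) hij)
  let : LinearOrder ι := LinearOrder.lift' h hh
  have hle : ∀ i j : ι, i ≤ j → f i ≤ f j := by
    intro i j hij
    have : h i ≤ h j := hij
    rcases (Prod.Lex.le_iff).1 this with h1 | h1
    · exact h1.le
    · exact h1.1.le
  have hfin : ∀ i : ι, (Iic i).Finite := fun i => (hf (f i)).subset fun j hj => hle j i hj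
  let : LocallyFiniteOrder ι := LocallyFiniteOrder.ofFiniteIcc fun a b =>
    (hfin b).subset Icc_subset_Iic_self
  obtain ⟨i₀⟩ := (inferInstance : Nonempty ι)
  have hbot : ∃ a : ι, ∀ b, a ≤ b := by
    obtain ⟨a, ha, ha'⟩ := (hfin i₀).exists_minimal ⟨i₀, self_mem_Iic⟩
    refine ⟨a, fun b => ?_⟩
    rcases le_total a b with h1 | h1
    · exact h1
    · exact ha' (h1.trans ha) h1
  obtain ⟨a, ha⟩ := hbot
  let : OrderBot ι := { bot := a, bot_le := ha }
  have : NoMaxOrder ι := ⟨fun i => by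
    by_contra hcon
    push Not at hcon
    exact not_finite_iff_infinite.2 ‹Infinite ι›
      (finite_univ_iff.1 ((hfin i).subset fun j _ => hcon j))⟩
  let : SuccOrder ι := LinearLocallyFiniteOrder.succOrder ι
  let : PredOrder ι := LinearLocallyFiniteOrder.predOrder ι
  have : IsSuccArchimedean ι := inferInstance
  let e : ι ≃o ℕ := orderIsoNatOfLinearSuccPredArch
  have hmono : Monotone (f ∘ e.symm) := fun m n hmn => hle _ _ (e.symm.monotone hmn)
  refine ⟨e.symm.toEquiv, hmono, tendsto_atTop_atTop_of_monotone hmono fun R => ?_⟩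
  by_contra hcon
  push Not at hcon
  have : (univ : Set ι) ⊆ {i | f i ≤ R} := fun i _ => by
    have h1 : f (e.symm (e i)) < R := hcon (e i)
    rw [e.symm_apply_apply] at h1
    exact h1.le
  exact not_finite_iff_infinite.2 ‹Infinite ι› (finite_univ_iff.1 ((hf R).subset this))

variable {H : Type*} [NormedAddCommGroup H] [InnerProductSpace ℂ H] [CompleteSpace H]

/-- Orthonormal eigenvectors of a compact operator whose eigenvalues stay away from zero are
finitely many. -/
theorem finite_of_orthonormal_eigenvectors {K : H →L[ℂ] H} (hK : IsCompactOperator K) {ι : Type*}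
    {v : ι → H} (hv : Orthonormal ℂ v) {ν : ι → ℝ} (hν : ∀ i, K (v i) = (ν i : ℂ) • v i)
    {ε : ℝ} (hε : 0 < ε) : {i | ε ≤ ν i}.Finite := by
  by_contra hinf
  have hinf : {i | ε ≤ ν i}.Infinite := hinf
  let u := hinf.natEmbedding
  obtain ⟨C, hC, hsub⟩ := hK.image_closedBall_subset_compact (1 : ℝ)
  obtain ⟨a, -, φ, hφ, hlim⟩ := hC.tendsto_subseq (x := fun n => K (v (u n))) fun n =>
    hsub ⟨v (u n), by simp [hv.1], rfl⟩
  have hc := hlim.cauchySeq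
  rw [Metric.cauchySeq_iff'] at hc
  obtain ⟨N, hN⟩ := hc ε hε
  have h1 := hN (N + 1) (Nat.le_succ N)
  simp only [Function.comp_apply, dist_eq_norm, hν] at h1
  set i := (u (φ (N + 1)) : ι)
  set j := (u (φ N) : ι)
  have hij : i ≠ j := fun h => by
    have := hφ.injective (u.injective (Subtype.ext h))
    omega
  have hi : ε ≤ ν i := (u (φ (N + 1))).2
  -- The component along `v i` alone keeps the two images at distance at least ε, so the sequence of
  -- images has no Cauchy subsequence.
  have h2 : inner ℂ (v i) ((ν i : ℂ) • v i - (ν j : ℂ) • v j) = (ν i : ℂ) := by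
    rw [inner_sub_right, inner_smul_right, inner_smul_right, hv.2 hij,
      inner_self_eq_norm_sq_to_K, hv.1]
    simp
  have h3 := norm_inner_le_norm (𝕜 := ℂ) (v i) ((ν i : ℂ) • v i - (ν j : ℂ) • v j)
  rw [h2, hv.1, one_mul, Complex.norm_real, Real.norm_eq_abs] at h3
  linarith [le_abs_self (ν i)]

/-- The spectral theorem for compact, symmetric, positive operators in an infinite dimensional
Hilbert space. -/
theorem exists_eigenbasis {K : H →L[ℂ] H} (hK : IsCompactOperator K) (hs : K.IsSymmetric)
    (hpos : ∀ v, v ≠ 0 → 0 < (inner ℂ (K v) v).re) (hH : ¬ FiniteDimensional ℂ H) :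
    ∃ (lam : ℕ → ℝ) (ψ : ℕ → H), Monotone lam ∧ Tendsto lam atTop atTop ∧ (∀ j, 0 < lam j) ∧
      Orthonormal ℂ ψ ∧ (∀ j, K (ψ j) = ((lam j)⁻¹ : ℂ) • ψ j) ∧
      (Submodule.span ℂ (range ψ)).topologicalClosure = ⊤ := by
  classical
  have hinj : ∀ v, K v = 0 → v = 0 := by
    intro v hv
    by_contra h
    have := hpos v h
    simp [hv] at this
  let Λ := {μ : ℂ // Module.End.HasEigenvalue (K : Module.End ℂ H) μ}
  have hΛ : ∀ μ : Λ, (μ : ℂ) ≠ 0 := by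
    intro μ h0
    obtain ⟨v, hv⟩ := Module.End.HasEigenvalue.exists_hasEigenvector μ.2
    have := hv.apply_eq_smul
    rw [show ((μ : Λ) : ℂ) = 0 from h0, zero_smul] at this
    exact hv.2 (hinj v this)
  have hfd : ∀ μ : Λ, FiniteDimensional ℂ (Module.End.eigenspace (K : Module.End ℂ H) μ) :=
    fun μ => ContinuousLinearMap.finite_dimensional_eigenspace hK μ (hΛ μ)
  let ι := Σ μ : Λ, Fin (Module.finrank ℂ (Module.End.eigenspace (K : Module.End ℂ H) μ))
  let v : ι → H := fun i =>
    (stdOrthonormalBasis ℂ (Module.End.eigenspace (K : Module.End ℂ H) i.1) i.2 : H)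
  have hv : Orthonormal ℂ v :=
    (hs.orthogonalFamily_eigenspaces.comp (γ := Λ) Subtype.val_injective).orthonormal_sigma_orthonormal
      (v_family := fun μ => stdOrthonormalBasis ℂ (Module.End.eigenspace (K : Module.End ℂ H) μ))
      fun μ => (stdOrthonormalBasis ℂ _).orthonormal
  have hKv : ∀ i, K (v i) = (i.1 : ℂ) • v i := fun i =>
    Module.End.mem_eigenspace_iff.1
      (stdOrthonormalBasis ℂ (Module.End.eigenspace (K : Module.End ℂ H) i.1) i.2).2
  have hre : ∀ i : ι, (i.1 : ℂ) = ((i.1 : ℂ).re : ℂ) := fun i =>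
    (Complex.conj_eq_iff_re.1 (hs.conj_eigenvalue_eq_self i.1.2)).symm
  have hKv' : ∀ i, K (v i) = (((i.1 : ℂ).re : ℝ) : ℂ) • v i := fun i => by
    rw [← hre]
    exact hKv i
  have hνpos : ∀ i : ι, 0 < (i.1 : ℂ).re := by
    intro i
    have := hpos (v i) (hv.ne_zero i)
    rw [hKv', inner_smul_left, inner_self_eq_norm_sq_to_K, hv.1] at this
    simpa using this
  have hspan : (Submodule.span ℂ (range v)).topologicalClosure = ⊤ := by
    rw [Submodule.topologicalClosure_eq_top_iff, eq_bot_iff,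
      ← ContinuousLinearMap.orthogonalComplement_iSup_eigenspaces_eq_bot hK hs]
    apply Submodule.orthogonal_le
    refine iSup_le fun μ => ?_
    by_cases hμ : Module.End.HasEigenvalue (K : Module.End ℂ H) μ
    · intro w hw
      have : FiniteDimensional ℂ (Module.End.eigenspace (K : Module.End ℂ H) μ) := hfd ⟨μ, hμ⟩
      have := (stdOrthonormalBasis ℂ
        (Module.End.eigenspace (K : Module.End ℂ H) μ)).sum_repr ⟨w, hw⟩
      have h2 := congrArg Subtype.val this
      rw [Submodule.coe_sum] at h2
      rw [← show _ = w from h2]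
      refine Submodule.sum_mem _ fun k _ => Submodule.smul_mem _ _ (Submodule.subset_span ?_)
      exact ⟨⟨⟨μ, hμ⟩, k⟩, rfl⟩
    · rw [Module.End.hasEigenvalue_iff, not_not] at hμ
      rw [hμ]
      exact bot_le
  have : Infinite ι := by
    by_contra hcon
    rw [not_infinite_iff_finite] at hcon
    have h1 : FiniteDimensional ℂ (Submodule.span ℂ (range v)) :=
      FiniteDimensional.span_of_finite ℂ (finite_range v)
    rw [(Submodule.closed_of_finiteDimensional _).submodule_topologicalClosure_eq] at hspan
    rw [hspan] at h1
    exact hH (Module.Finite.equiv Submodule.topEquiv)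
  -- The inverse eigenvalues have finite sublevel sets: ν⁻¹ ≤ R means ν ≥ R⁻¹, which compactness
  -- allows only finitely often.
  obtain ⟨e, he1, he2⟩ := exists_monotone_reindex (fun i : ι => ((i.1 : ℂ).re)⁻¹) (by
    intro R
    rcases le_or_gt R 0 with hR | hR
    · convert finite_empty
      ext i
      simp only [mem_ofPred_eq, mem_empty_iff_false, iff_false, not_le]
      exact hR.trans_lt (inv_pos.2 (hνpos i))
    · refine (finite_of_orthonormal_eigenvectors hK hv hKv' (inv_pos.2 hR)).subset fun i hi => ?_
      exact (inv_le_comm₀ (hνpos i) hR).1 hi)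
  refine ⟨_, v ∘ e, he1, he2, fun j => inv_pos.2 (hνpos _), hv.comp e e.injective, fun j => ?_, ?_⟩
  · simp only [Function.comp_apply]
    rw [Complex.ofReal_inv, inv_inv]
    exact hKv' _
  · rw [e.surjective.range_comp]
    exact hspan

variable {K : H →L[ℂ] H} {C : ℝ} {T : H →ₗ.[ℂ] H}

theorem isEigenSolution_iff {z : ℂ} {ψ : H} : IsEigenSolution T z ψ ↔ (ψ, z • ψ) ∈ T.graph := by
  rw [LinearPMap.mem_graph_iff]
  constructor
  · rintro ⟨h, e⟩
    exact ⟨⟨ψ, h⟩, rfl, e⟩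
  · rintro ⟨⟨y, hy⟩, rfl, h⟩
    exact ⟨hy, h⟩

/-- `T = K⁻¹ - C`. -/
def IsShiftedInverse (T : H →ₗ.[ℂ] H) (K : H →L[ℂ] H) (C : ℝ) : Prop :=
  ∀ ψ χ, (ψ, χ) ∈ T.graph ↔ ψ = K (χ + (C : ℂ) • ψ)

theorem IsShiftedInverse.mem_graph (hT : IsShiftedInverse T K C) (ξ : H) :
    (K ξ, ξ - (C : ℂ) • K ξ) ∈ T.graph := by
  rw [hT]
  simp

/-- The domain contains the range of `K`. A vector w orthogonal to it is orthogonal to K(Kw), so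
‖Kw‖² = 0. -/
theorem IsShiftedInverse.dense_domain (hT : IsShiftedInverse T K C) (hs : K.IsSymmetric)
    (hinj : ∀ v, K v = 0 → v = 0) : Dense (T.domain : Set H) := by
  rw [Submodule.dense_iff_topologicalClosure_eq_top, Submodule.topologicalClosure_eq_top_iff,
    eq_bot_iff]
  intro w hw
  rw [Submodule.mem_orthogonal] at hw
  rw [Submodule.mem_bot]
  apply hinj
  have h1 : K (K w) ∈ T.domain := by
    obtain ⟨y, hy, -⟩ := (LinearPMap.mem_graph_iff T).1 (hT.mem_graph (K w))
    rw [← show _ = K (K w) from hy]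
    exact y.2
  have h2 := hw _ h1
  rw [hs.apply_clm, inner_self_eq_zero] at h2
  exact h2

/-- The graph of `T` is parametrized by ξ ↦ (Kξ, ξ - CKξ). Testing a pair (y, z) of the adjoint
graph against all ξ gives y = K(z + Cy), which is again membership in the graph of `T`. -/
theorem IsShiftedInverse.isSelfAdjointOperator (hT : IsShiftedInverse T K C)
    (hs : K.IsSymmetric) (hinj : ∀ v, K v = 0 → v = 0) : IsSelfAdjointOperator T := by
  have hd := hT.dense_domain hs hinj
  refine ⟨inferInstance, hd, ?_⟩
  rw [LinearPMap.isSelfAdjoint_def]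
  apply LinearPMap.eq_of_eq_graph
  ext ⟨y, z⟩
  rw [LinearPMap.adjoint_graph_eq_graph_adjoint hd, Submodule.mem_adjoint_iff, hT]
  constructor
  · intro h
    apply ext_inner_left ℂ
    intro ξ
    have := h _ _ (hT.mem_graph ξ)
    rw [inner_sub_left, inner_smul_left, Complex.conj_ofReal] at this
    rw [← hs.apply_clm, inner_add_right, inner_smul_right]
    linear_combination this
  · intro h a b hab
    rw [hT] at hab
    have h1 : inner ℂ (b + (C : ℂ) • a) y = inner ℂ a (z + (C : ℂ) • y) := by
      conv_lhs => rw [h]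
      conv_rhs => rw [hab]
      rw [hs.apply_clm]
    rw [inner_add_left, inner_add_right, inner_smul_left, inner_smul_right,
      Complex.conj_ofReal] at h1
    linear_combination h1

theorem IsShiftedInverse.isEigenSolution_of_apply (hT : IsShiftedInverse T K C) {lam : ℝ} {ψ : H}
    (hlam : lam ≠ 0) (h : K ψ = ((lam)⁻¹ : ℂ) • ψ) : IsEigenSolution T ((lam - C : ℝ) : ℂ) ψ := by
  rw [isEigenSolution_iff, hT, ← add_smul]
  have : ((lam - C : ℝ) : ℂ) + C = lam := by push_cast; ring
  rw [this, map_smul, h, smul_smul, mul_inv_cancel₀ (by exact_mod_cast hlam), one_smul]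

/-- With ψ = Kη one has (T - z)ψ = (1 - (z + C)K)η, so the resolvent is K composed with the inverse
of 1 - (z + C)K. -/
theorem IsShiftedInverse.mem_resolventSet (hT : IsShiftedInverse T K C) (z : ℂ)
    (hu : IsUnit (1 - (z + C) • K)) : z ∈ resolventSet T := by
  obtain ⟨u, hu⟩ := hu
  have e1 : ∀ v, u.1 (u.2 v) = v := fun v => by
    rw [← mul_apply_eq_comp, u.val_inv, one_apply_eq_self]
  have e2 : ∀ v, u.2 (u.1 v) = v := fun v => by
    rw [← mul_apply_eq_comp, u.inv_val, one_apply_eq_self]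
  have e3 : ∀ v, u.1 v = v - (z + C) • K v := fun v => by
    rw [hu]
    rfl
  refine ⟨K ∘L (u.2 : H →L[ℂ] H), fun χ => ?_, fun ψ => ?_⟩
  · obtain ⟨⟨y, hy⟩, h1, h2⟩ := (LinearPMap.mem_graph_iff T).1 (hT.mem_graph ((u.2 : H →L[ℂ] H) χ))
    obtain rfl : y = K ((u.2 : H →L[ℂ] H) χ) := h1
    refine ⟨hy, ?_⟩
    change T ⟨K ((u.2 : H →L[ℂ] H) χ), hy⟩ - z • K ((u.2 : H →L[ℂ] H) χ) = χ
    rw [h2]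
    conv_rhs => rw [← e1 χ, e3]
    rw [add_smul, sub_sub, add_comm]
  · have h1 : ((ψ : H), T ψ) ∈ T.graph := (LinearPMap.mem_graph_iff T).2 ⟨ψ, rfl, rfl⟩
    rw [hT] at h1
    have h2 : T ψ - z • (ψ : H) = u.1 (T ψ + (C : ℂ) • (ψ : H)) := by
      rw [e3, ← h1, add_smul]
      abel
    change K (u.2 _) = ψ
    rw [h2, e2, ← h1]

/-- The Fredholm alternative for `K` at (z + C)⁻¹; `K` and `T` share their eigenvectors. The value z
= -C is always in the resolvent set. -/
theorem IsShiftedInverse.exists_eigenvector (hT : IsShiftedInverse T K C)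
    (hK : IsCompactOperator K) {z : ℂ} (hz : z ∉ resolventSet T) :
    ∃ ψ, ψ ≠ 0 ∧ IsEigenSolution T z ψ := by
  by_cases h0 : z + C = 0
  · exact absurd (hT.mem_resolventSet z (by simp [h0])) hz
  · rcases hK.hasEigenvalue_or_mem_resolventSet (inv_ne_zero h0) with h | h
    · obtain ⟨v, hv⟩ := h.exists_hasEigenvector
      refine ⟨v, hv.2, ?_⟩
      rw [isEigenSolution_iff, hT, ← add_smul, map_smul]
      have : K v = (z + C)⁻¹ • v := hv.apply_eq_smul
      rw [this, smul_smul, mul_inv_cancel₀ h0, one_smul]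
    · refine absurd (hT.mem_resolventSet z ?_) hz
      rw [spectrum.mem_resolventSet_iff] at h
      have : (1 : H →L[ℂ] H) - (z + C) • K =
          (z + C) • (algebraMap ℂ (H →L[ℂ] H) (z + C)⁻¹ - K) := by
        rw [smul_sub, Algebra.algebraMap_eq_smul_one, smul_smul, mul_inv_cancel₀ h0, one_smul]
      rw [this]
      exact (isUnit_smul_iff (Units.mk0 _ h0) _).2 h

/-- `T` is selfadjoint with a pure point spectrum, and the eigenvalue problem `T ψ = z c ψ` is
solved by a complete orthonormal sequence. -/
theorem IsShiftedInverse.spectral_theorem (hT : IsShiftedInverse T K C)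
    (hK : IsCompactOperator K) (hs : K.IsSymmetric)
    (hpos : ∀ v, v ≠ 0 → 0 < (inner ℂ (K v) v).re) (hH : ¬ FiniteDimensional ℂ H)
    {c : ℝ} (hc : 0 < c) :
    IsSelfAdjointOperator T ∧ HasPurePointSpectrum T ∧
      ∃ (Λ : ℕ → ℝ) (ψ : ℕ → H), Monotone Λ ∧ Tendsto Λ atTop atTop ∧ Orthonormal ℂ ψ ∧
        (∀ j, IsEigenSolution T (Λ j * c) (ψ j)) ∧
        (∀ (z : ℂ) (χ : H), IsEigenSolution T (z * c) χ →
          χ ∈ Submodule.span ℂ (ψ '' {j | (Λ j : ℂ) = z})) ∧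
        (Submodule.span ℂ (range ψ)).topologicalClosure = ⊤ := by
  have hinj : ∀ v, K v = 0 → v = 0 := by
    intro v hv
    by_contra h
    have := hpos v h
    simp [hv] at this
  obtain ⟨lam, ψ, h1, h2, h3, h4, h5, h6⟩ := exists_eigenbasis hK hs hpos hH
  have hE : ∀ j, IsEigenSolution T ((lam j - C : ℝ) : ℂ) (ψ j) := fun j =>
    hT.isEigenSolution_of_apply (h3 j).ne' (h5 j)
  have hE' : ∀ j, IsEigenSolution T ((((lam j - C) / c : ℝ) : ℂ) * c) (ψ j) := fun j => by
    have : ((((lam j - C) / c : ℝ) : ℂ) * c) = ((lam j - C : ℝ) : ℂ) := by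
      rw [← Complex.ofReal_mul, div_mul_cancel₀ _ hc.ne']
    rw [this]
    exact hE j
  have hlim : Tendsto (fun j => (lam j - C) / c) atTop atTop :=
    (tendsto_atTop_add_const_right _ (-C) h2).atTop_div_const hc
  refine ⟨hT.isSelfAdjointOperator hs hinj, ⟨fun z => hT.exists_eigenvector hK, ?_⟩,
    fun j => (lam j - C) / c, ψ, fun i j hij => ?_, hlim, h4, hE', fun z χ hχ => ?_, h6⟩
  · rw [eq_top_iff, ← h6]
    apply Submodule.topologicalClosure_mono
    apply Submodule.span_mono
    rintro _ ⟨j, rfl⟩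
    exact ⟨_, hE j⟩
  · have := h1 hij
    dsimp only
    gcongr
  · set Z := {j | (((lam j - C) / c : ℝ) : ℂ) = z}
    -- The real eigenvalues eventually exceed Re z, so only finitely many of them equal z.
    have hZ : Z.Finite := by
      have h7 := (hlim.eventually (eventually_gt_atTop z.re))
      rw [eventually_atTop] at h7
      obtain ⟨N, hN⟩ := h7
      refine (finite_Iio N).subset fun j hj => ?_
      by_contra hcon
      have := hN j (not_lt.1 hcon)
      rw [← show _ = z from hj, Complex.ofReal_re] at this
      exact lt_irrefl _ this
    -- Since χ = (zc + C)Kχ, moving `K` to the other side multiplies the coefficient by (zc + C)/lam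
    -- j. It vanishes unless this factor is 1, that is, unless the j-th eigenvalue is z.
    have hcoef : ∀ j, j ∉ Z → inner ℂ (ψ j) χ = 0 := by
      intro j hj
      rw [isEigenSolution_iff, hT, ← add_smul] at hχ
      have e : inner ℂ (ψ j) χ = (z * c + C) * ((lam j : ℂ)⁻¹ * inner ℂ (ψ j) χ) := by
        conv_lhs => rw [hχ]
        rw [map_smul, inner_smul_right, ← hs.apply_clm, h5, inner_smul_left]
        simp only [map_inv₀, Complex.conj_ofReal]
      by_contra h0
      apply hj
      have hl : (lam j : ℂ) ≠ 0 := by exact_mod_cast (h3 j).ne'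
      have hc' : (c : ℂ) ≠ 0 := by exact_mod_cast hc.ne'
      have e2 : (z * c + C) * (lam j : ℂ)⁻¹ = 1 := by
        apply mul_right_cancel₀ h0
        rw [one_mul, mul_assoc]
        exact e.symm
      have e3 : z * c + C = lam j := by
        rw [← div_eq_mul_inv] at e2
        exact (div_eq_one_iff_eq hl).1 e2
      change (((lam j - C) / c : ℝ) : ℂ) = z
      push_cast
      rw [div_eq_iff hc']
      linear_combination -e3
    -- The difference is orthogonal to every `ψ i`, hence zero by completeness.
    have hsum : χ = ∑ j ∈ hZ.toFinset, inner ℂ (ψ j) χ • ψ j := by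
      rw [← sub_eq_zero]
      have : (Submodule.span ℂ (range ψ))ᗮ = ⊥ := (Submodule.topologicalClosure_eq_top_iff).1 h6
      rw [← Submodule.mem_bot ℂ, ← this, Submodule.mem_orthogonal]
      intro u hu
      induction hu using Submodule.span_induction with
      | mem u hu =>
        obtain ⟨i, rfl⟩ := hu
        rw [inner_sub_right, sub_eq_zero]
        by_cases hi : i ∈ hZ.toFinset
        · rw [h4.inner_right_sum _ hi]
        · rw [hcoef i fun h => hi (hZ.mem_toFinset.2 h), inner_sum]
          refine (Finset.sum_eq_zero fun j hj => ?_).symm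
          rw [inner_smul_right, h4.2 (fun h : i = j => hi (by rwa [h])), mul_zero]
      | zero => simp
      | add u v _ _ h h' => rw [inner_add_left, h, h', add_zero]
      | smul a u _ h => rw [inner_smul_left, h, mul_zero]
    rw [hsum]
    refine Submodule.sum_mem _ fun j hj => Submodule.smul_mem _ _ (Submodule.subset_span ?_)
    exact ⟨j, hZ.mem_toFinset.1 hj, rfl⟩

/-! ### Operators associated with forms on a compactly embedded space -/

variable {E : Type*} [NormedAddCommGroup E] [InnerProductSpace ℂ E] [CompleteSpace E]

/-- The operator `T` associated with the form `⟪y, S x⟫`, where the form domain `E` is embedded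
into `H` by `J`. -/
def IsFormOperator (T : H →ₗ.[ℂ] H) (J : E →L[ℂ] H) (S : E →L[ℂ] E) : Prop :=
  ∀ ψ χ, (ψ, χ) ∈ T.graph ↔ ∃ x, J x = ψ ∧ ∀ y, inner ℂ y (S x) = inner ℂ (J y) χ

/-- The form equation for x with right-hand side χ says S'x = J*(χ + CJx), where S' = S + C J*J is
coercive. Hence J S'⁻¹ J* is the inverse of T + C. It is compact because `J` is, and strictly
positive because J* is injective when `J` has dense range. -/
theorem IsFormOperator.spectral_theorem {J : E →L[ℂ] H} {S : E →L[ℂ] E}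
    (hT : IsFormOperator T J S) (hJ : IsCompactOperator J) (hJi : Function.Injective J)
    (hJd : DenseRange J) (hS : S.IsSymmetric) {ε : ℝ} (hε : 0 < ε)
    (hco : ∀ x, ε * ‖x‖ ^ 2 ≤ (inner ℂ (S x) x).re + C * ‖J x‖ ^ 2)
    (hH : ¬ FiniteDimensional ℂ H) {c : ℝ} (hc : 0 < c) :
    IsSelfAdjointOperator T ∧ HasPurePointSpectrum T ∧
      ∃ (Λ : ℕ → ℝ) (ψ : ℕ → H) (x : ℕ → E),
        Monotone Λ ∧ Tendsto Λ atTop atTop ∧ Orthonormal ℂ ψ ∧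
        (∀ j, IsEigenSolution T (Λ j * c) (ψ j)) ∧
        (∀ (z : ℂ) (χ : H), IsEigenSolution T (z * c) χ →
          χ ∈ Submodule.span ℂ (ψ '' {j | (Λ j : ℂ) = z})) ∧
        (∀ j, J (x j) = ψ j) ∧
        (Submodule.span ℂ (range x)).topologicalClosure = ⊤ ∧
        (Submodule.span ℂ (range ψ)).topologicalClosure = ⊤ := by
  let S' : E →L[ℂ] E := S + (C : ℂ) • (ContinuousLinearMap.adjoint J ∘L J)
  have hS'a : ∀ x y, inner ℂ y (S' x) = inner ℂ y (S x) + C * inner ℂ (J y) (J x) := by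
    intro x y
    simp [S', inner_add_right, ContinuousLinearMap.adjoint_inner_right]
  have hS's : S'.IsSymmetric := by
    intro x y
    change inner ℂ (S' x) y = inner ℂ x (S' y)
    rw [← inner_conj_symm, hS'a, hS'a, map_add, map_mul, inner_conj_symm, inner_conj_symm,
      Complex.conj_ofReal, hS.apply_clm]
  have hS'p : ∀ x, ε * ‖x‖ ^ 2 ≤ (inner ℂ (S' x) x).re := by
    intro x
    rw [hS's.apply_clm, hS'a, Complex.add_re, Complex.re_ofReal_mul,
      inner_self_eq_norm_sq_to_K, ← hS.apply_clm]
    have := hco x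
    have h2 : (((‖J x‖ : ℝ) : ℂ) ^ 2).re = ‖J x‖ ^ 2 := by
      rw [← Complex.ofReal_pow, Complex.ofReal_re]
    exact this.trans_eq (by rw [← h2]; rfl)
  -- Lax–Milgram.
  obtain ⟨u, hu⟩ : IsUnit S' := by
    refine ContinuousLinearMap.isUnit_of_forall_le_norm_inner_map S' (c := ⟨ε, hε.le⟩) hε
      fun x => ?_
    rw [mul_comm]
    exact (hS'p x).trans (Complex.re_le_norm _)
  have e1 : ∀ v, S' (u.2 v) = v := fun v => by
    rw [← hu, ← mul_apply_eq_comp, u.val_inv, one_apply_eq_self]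
  have e2 : ∀ v, u.2 (S' v) = v := fun v => by
    rw [← hu, ← mul_apply_eq_comp, u.inv_val, one_apply_eq_self]
  let K : H →L[ℂ] H := J ∘L (u.2 : E →L[ℂ] E) ∘L ContinuousLinearMap.adjoint J
  have hK : IsCompactOperator K :=
    hJ.comp_clm ((u.2 : E →L[ℂ] E) ∘L ContinuousLinearMap.adjoint J)
  have hKa : ∀ v w, inner ℂ (K v) w = inner ℂ (u.2 (ContinuousLinearMap.adjoint J v))
      (S' (u.2 (ContinuousLinearMap.adjoint J w))) := by
    intro v w
    rw [e1, ContinuousLinearMap.adjoint_inner_right]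
    rfl
  have hKs : K.IsSymmetric := by
    intro v w
    change inner ℂ (K v) w = inner ℂ v (K w)
    rw [hKa, ← inner_conj_symm v, hKa, inner_conj_symm, hS's.apply_clm]
  have hKpos : ∀ v, v ≠ 0 → 0 < (inner ℂ (K v) v).re := by
    intro v hv
    rw [hKa, ← hS's.apply_clm]
    refine lt_of_lt_of_le ?_ (hS'p _)
    have : u.2 (ContinuousLinearMap.adjoint J v) ≠ 0 := by
      intro h0
      have h1 : ContinuousLinearMap.adjoint J v = 0 := by
        rw [← e1 (ContinuousLinearMap.adjoint J v), h0, map_zero]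
      refine hv (hJd.eq_zero_of_inner_left ℂ fun x => ?_)
      rw [← ContinuousLinearMap.adjoint_inner_left, h1, inner_zero_left]
    have := norm_pos_iff.2 this
    positivity
  have hgraph : ∀ x ψ χ, (J x = ψ ∧ ∀ y, inner ℂ y (S x) = inner ℂ (J y) χ) ↔
      (J x = ψ ∧ x = u.2 (ContinuousLinearMap.adjoint J (χ + (C : ℂ) • ψ))) := by
    intro x ψ χ
    constructor
    · rintro ⟨rfl, h⟩
      refine ⟨rfl, ?_⟩
      rw [← e2 x]
      congr 1
      apply ext_inner_left ℂ
      intro y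
      rw [e2, hS'a, h, ContinuousLinearMap.adjoint_inner_right, inner_add_right, inner_smul_right]
    · rintro ⟨rfl, h⟩
      refine ⟨rfl, fun y => ?_⟩
      have h2 := congrArg (fun x => inner ℂ y (S' x)) h
      rw [e1, hS'a, ContinuousLinearMap.adjoint_inner_right, inner_add_right,
        inner_smul_right] at h2
      exact add_right_cancel h2
  have hTK : IsShiftedInverse T K C := by
    intro ψ χ
    rw [hT]
    constructor
    · rintro ⟨x, hx⟩
      obtain ⟨h1, h2⟩ := (hgraph x ψ χ).1 hx
      change ψ = J (u.2 (ContinuousLinearMap.adjoint J (χ + (C : ℂ) • ψ)))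
      rw [← h2, h1]
    · intro h
      exact ⟨_, (hgraph _ ψ χ).2 ⟨h.symm, rfl⟩⟩
  obtain ⟨hsa, hpp, Λ, ψ, h1, h2, h3, h4, h5, h6⟩ := hTK.spectral_theorem hK hKs hKpos hH hc
  have hx : ∀ j, ∃ x, J x = ψ j ∧ ∀ y, inner ℂ y (S x) = inner ℂ (J y) ((Λ j * c : ℂ) • ψ j) :=
    fun j => (hT _ _).1 (isEigenSolution_iff.1 (h4 j))
  choose x hx1 hx2 using hx
  refine ⟨hsa, hpp, Λ, ψ, x, h1, h2, h3, h4, h5, hx1, ?_, h6⟩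
  rw [Submodule.topologicalClosure_eq_top_iff, eq_bot_iff]
  intro w hw
  rw [Submodule.mem_orthogonal] at hw
  -- Completeness in the form domain reduces to completeness in `H`: S'x_j = (Λ_j c + C)J*ψ_j, so
  -- ⟨x_j, w⟩ = 0 turns into ⟨ψ_j, J S'⁻¹w⟩ = 0 for all j.
  have hJw : J (u.2 w) = 0 := by
    have hz : (Submodule.span ℂ (range ψ))ᗮ = ⊥ := (Submodule.topologicalClosure_eq_top_iff).1 h6
    rw [← Submodule.mem_bot ℂ, ← hz, Submodule.mem_orthogonal]
    intro v hv
    induction hv using Submodule.span_induction with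
    | mem v hv =>
      obtain ⟨j, rfl⟩ := hv
      have h7 : ∀ y, inner ℂ y (S' (x j)) = (Λ j * c + C : ℂ) * inner ℂ (J y) (ψ j) := by
        intro y
        rw [hS'a, hx2, hx1, inner_smul_right]
        ring
      -- If this factor vanished, S'x_j = 0 would give x_j = 0, contradicting that ψ_j = J x_j is a
      -- unit vector.
      have h8 : (Λ j * c + C : ℂ) ≠ 0 := by
        intro h0
        have h9 : S' (x j) = 0 := ext_inner_left ℂ fun y => by
          rw [h7, h0, zero_mul, inner_zero_right]
        have h10 := hx1 j
        rw [← e2 (x j), h9, map_zero, map_zero] at h10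
        exact h3.ne_zero j h10.symm
      have h9 := hw (x j) (Submodule.subset_span ⟨j, rfl⟩)
      rw [← e1 w, ← hS's.apply_clm, ← inner_conj_symm, h7, map_mul, inner_conj_symm] at h9
      exact (mul_eq_zero.1 h9).resolve_left ((map_ne_zero _).2 h8)
    | zero => simp
    | add u v _ _ h h' => rw [inner_add_left, h, h', add_zero]
    | smul a u _ h => rw [inner_smul_left, h, mul_zero]
  rw [Submodule.mem_bot, ← e1 w, hJi (hJw.trans (map_zero J).symm), map_zero]

/-! ### Pointwise bounds in the form domain -/

section PointBounds

variable {F : Type*} [NormedAddCommGroup F] [InnerProductSpace ℂ F]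
  (A : {A : F →ₗ[ℂ] F // A.IsPositive}) (b : EReal) (w : ℝ≥0)

/-- The test function underlying an element of the energy space. -/
def toFun (φ : EnergySpace A b w) : ℝ → F := (EnergySpace.equiv A b w φ : ℝ → F)

variable {A b w}

theorem toFun_mem (φ : EnergySpace A b w) : toFun A b w φ ∈ testSpace F b :=
  (EnergySpace.equiv A b w φ).2

theorem contDiff_toFun (φ : EnergySpace A b w) : ContDiff ℝ ∞ (toFun A b w φ) :=
  (testSpace_spec (toFun_mem φ)).1

theorem continuous_deriv_toFun (φ : EnergySpace A b w) : Continuous (deriv (toFun A b w φ)) :=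
  (contDiff_infty_iff_deriv.1 (contDiff_toFun φ)).2.continuous

theorem toFun_eq_zero (φ : EnergySpace A b w) {r : ℝ} (hr : r ∉ interval b) :
    toFun A b w φ r = 0 :=
  image_eq_zero_of_notMem_tsupport fun h => hr ((testSpace_spec (toFun_mem φ)).2.2 h)

theorem deriv_toFun_eq_zero (φ : EnergySpace A b w) {r : ℝ} (hr : r ∉ interval b) :
    deriv (toFun A b w φ) r = 0 := by
  rw [(notMem_tsupport_iff_eventuallyEq.1 fun hc =>
    hr ((testSpace_spec (toFun_mem φ)).2.2 hc)).deriv_eq]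
  simp

theorem inner_energySpace (φ χ : EnergySpace A b w) :
    inner ℂ φ χ = energy A.1 b w (toFun A b w φ) (toFun A b w χ) := rfl

theorem norm_sq_energySpace (φ : EnergySpace A b w) :
    ‖φ‖ ^ 2 = ∫ r in interval b, (energyDensity A.1 w (toFun A b w φ) (toFun A b w φ) r).re := by
  rw [norm_sq_eq_re_inner (𝕜 := ℂ), inner_energySpace]
  exact energy_re A.1 w (toFun_mem φ)

theorem le_energyDensity_self (φ : ℝ → F) {r : ℝ} (hr : 0 < r) :
    r * ‖deriv φ r‖ ^ 2 + w * r ^ 3 * ‖φ r‖ ^ 2 ≤ (energyDensity A.1 w φ φ r).re := by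
  have e1 : (inner ℂ (deriv φ r) (deriv φ r) : ℂ).re = ‖deriv φ r‖ ^ 2 :=
    (norm_sq_eq_re_inner (𝕜 := ℂ) _).symm
  have e2 : 0 ≤ (inner ℂ (A.1 (φ r)) (φ r) : ℂ).re := A.2.2 _
  have e3 : (inner ℂ (φ r) (φ r) : ℂ).re = ‖φ r‖ ^ 2 := (norm_sq_eq_re_inner (𝕜 := ℂ) _).symm
  rw [energyDensity, Complex.add_re, Complex.add_re, Complex.re_ofReal_mul, Complex.re_ofReal_mul,
    Complex.re_ofReal_mul, e1, e3]
  have := mul_nonneg (inv_nonneg.2 hr.le) e2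
  linarith

theorem integral_deriv_sq_le (φ : EnergySpace A b w) {r s : ℝ} (hr : 0 < r) :
    ∫ t in Ioc r s, t * ‖deriv (toFun A b w φ) t‖ ^ 2 ≤ ‖φ‖ ^ 2 := by
  rw [norm_sq_energySpace]
  have hI := (isOpen_interval b).measurableSet
  have hc : Continuous fun t => t * ‖deriv (toFun A b w φ) t‖ ^ 2 :=
    continuous_id.mul ((continuous_deriv_toFun φ).norm.pow 2)
  have h1 : ∫ t in Ioc r s, t * ‖deriv (toFun A b w φ) t‖ ^ 2 =
      ∫ t in Ioc r s ∩ interval b, t * ‖deriv (toFun A b w φ) t‖ ^ 2 := by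
    refine setIntegral_eq_of_subset_of_forall_sdiff_eq_zero measurableSet_Ioc inter_subset_left
      fun t ht => ?_
    rw [deriv_toFun_eq_zero φ fun h => ht.2 ⟨ht.1, h⟩]
    simp
  have hint : IntegrableOn (fun r => (energyDensity A.1 w (toFun A b w φ) (toFun A b w φ) r).re)
      (interval b) := (integrableOn_energyDensity A.1 w (toFun_mem φ) (toFun_mem φ)).re
  rw [h1]
  have hw : ∀ t ∈ interval b, (0 : ℝ) ≤ w * t ^ 3 * ‖toFun A b w φ t‖ ^ 2 := fun t ht =>
    mul_nonneg (mul_nonneg w.2 (pow_nonneg (pos_of_mem ht).le 3)) (sq_nonneg _)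
  refine (setIntegral_mono_on (g := fun r =>
    (energyDensity A.1 w (toFun A b w φ) (toFun A b w φ) r).re)
    ((hc.integrableOn_Ioc).mono_set inter_subset_left)
    (hint.mono_set inter_subset_right) (measurableSet_Ioc.inter hI) fun t ht => ?_).trans
    (setIntegral_mono_set hint ?_ inter_subset_right.eventuallyLE)
  · have := le_energyDensity_self (A := A) (w := w) (toFun A b w φ) (pos_of_mem ht.2)
    linarith [hw t ht.2]
  · filter_upwards [ae_restrict_mem hI] with t ht
    have := le_energyDensity_self (A := A) (w := w) (toFun A b w φ) (pos_of_mem ht)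
    have h2 := mul_nonneg (pos_of_mem ht).le (sq_nonneg ‖deriv (toFun A b w φ) t‖)
    exact (add_nonneg h2 (hw t ht)).trans this

theorem integral_cube_mul_sq_le (φ : EnergySpace A b w) :
    w * ∫ t in interval b, t ^ 3 * ‖toFun A b w φ t‖ ^ 2 ≤ ‖φ‖ ^ 2 := by
  rw [norm_sq_energySpace, ← integral_const_mul]
  have hI := (isOpen_interval b).measurableSet
  have hint := (integrableOn_energyDensity A.1 w (toFun_mem φ) (toFun_mem φ)).re
  refine integral_mono_of_nonneg ?_ hint ?_
  · filter_upwards [ae_restrict_mem hI] with t ht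
    exact mul_nonneg w.2 (mul_nonneg (pow_nonneg (pos_of_mem ht).le 3) (sq_nonneg _))
  · filter_upwards [ae_restrict_mem hI] with t ht
    have := le_energyDensity_self (A := A) (w := w) (toFun A b w φ) (pos_of_mem ht)
    have h2 := mul_nonneg (pos_of_mem ht).le (sq_nonneg ‖deriv (toFun A b w φ) t‖)
    rw [← mul_assoc]
    exact (le_add_of_nonneg_left h2).trans this

/-- Cauchy–Schwarz against the constant 1, obtained by expanding the squared deviation of `f` from
its mean. -/
theorem sq_integral_le {f : ℝ → ℝ} (hf : Continuous f) {r s : ℝ} (hrs : r < s) :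
    (∫ t in r..s, f t) ^ 2 ≤ (s - r) * ∫ t in r..s, f t ^ 2 := by
  set X := ∫ t in r..s, f t
  have hL : 0 < s - r := sub_pos.2 hrs
  have h0 : 0 ≤ ∫ t in r..s, (f t - X / (s - r)) ^ 2 :=
    intervalIntegral.integral_nonneg hrs.le fun t _ => sq_nonneg _
  have h1 : ∫ t in r..s, (f t - X / (s - r)) ^ 2 =
      (∫ t in r..s, f t ^ 2) - X ^ 2 / (s - r) := by
    have e : ∀ t, (f t - X / (s - r)) ^ 2 =
        f t ^ 2 - 2 * (X / (s - r)) * f t + (X / (s - r)) ^ 2 := fun t => by ring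
    simp only [e]
    rw [intervalIntegral.integral_add, intervalIntegral.integral_sub,
      intervalIntegral.integral_const_mul, intervalIntegral.integral_const, smul_eq_mul]
    · change _ - 2 * (X / (s - r)) * X + _ = _
      field_simp
      ring
    · exact (hf.pow 2).intervalIntegrable _ _
    · exact (continuous_const.mul hf).intervalIntegrable _ _
    · exact ((hf.pow 2).sub (continuous_const.mul hf)).intervalIntegrable _ _
    · exact continuous_const.intervalIntegrable _ _
  rw [h1, sub_nonneg, div_le_iff₀ hL] at h0
  linarith

variable [CompleteSpace F]

/-- On (r, s) the weight t of the energy is at least r, so ∫‖φ'‖² ≤ r⁻¹‖φ‖², and Cauchy–Schwarz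
bounds the increment of φ. -/
theorem norm_sub_sq_le (φ : EnergySpace A b w) {r s : ℝ} (hr : 0 < r) (hrs : r ≤ s) :
    ‖toFun A b w φ s - toFun A b w φ r‖ ^ 2 ≤ (s - r) / r * ‖φ‖ ^ 2 := by
  rcases hrs.eq_or_lt with rfl | hrs
  · simp
  have hd := continuous_deriv_toFun φ
  have h1 : ∫ t in r..s, deriv (toFun A b w φ) t = toFun A b w φ s - toFun A b w φ r :=
    intervalIntegral.integral_deriv_eq_sub
      (fun t _ => (contDiff_toFun φ).differentiable (by simp) t) (hd.intervalIntegrable _ _)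
  have h2 := intervalIntegral.norm_integral_le_integral_norm (f := deriv (toFun A b w φ))
    (μ := volume) hrs.le
  rw [h1] at h2
  have h3 := sq_integral_le hd.norm hrs
  have h4 : ∫ t in r..s, ‖deriv (toFun A b w φ) t‖ ^ 2 ≤ r⁻¹ * ‖φ‖ ^ 2 := by
    rw [← div_eq_inv_mul, le_div_iff₀ hr, mul_comm, ← intervalIntegral.integral_const_mul]
    refine le_trans ?_ (integral_deriv_sq_le φ (s := s) hr)
    rw [← intervalIntegral.integral_of_le hrs.le]
    refine intervalIntegral.integral_mono_on hrs.le
      ((continuous_const.mul (hd.norm.pow 2)).intervalIntegrable _ _)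
      ((continuous_id.mul (hd.norm.pow 2)).intervalIntegrable _ _) fun t ht => ?_
    exact mul_le_mul_of_nonneg_right ht.1 (sq_nonneg _)
  calc ‖toFun A b w φ s - toFun A b w φ r‖ ^ 2
      ≤ (∫ t in r..s, ‖deriv (toFun A b w φ) t‖) ^ 2 := by gcongr
    _ ≤ (s - r) * ∫ t in r..s, ‖deriv (toFun A b w φ) t‖ ^ 2 := h3
    _ ≤ (s - r) * (r⁻¹ * ‖φ‖ ^ 2) := mul_le_mul_of_nonneg_left h4 (sub_nonneg.2 hrs.le)
    _ = _ := by ring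

variable (A b w) in
/-- The energy norm controls the values of the test functions. -/
def PointBound : Prop :=
  ∀ R : ℝ, 0 < R → ∃ C : ℝ, 0 ≤ C ∧ ∀ (φ : EnergySpace A b w) (r : ℝ), 0 < r → r < R →
    ‖toFun A b w φ r‖ ^ 2 ≤ C / r * ‖φ‖ ^ 2

theorem norm_sq_le_two {x y : F} : ‖x‖ ^ 2 ≤ 2 * ‖y‖ ^ 2 + 2 * ‖y - x‖ ^ 2 := by
  have h : ‖x‖ ≤ ‖y‖ + ‖y - x‖ := by
    have := norm_sub_le y (y - x)
    rwa [sub_sub_cancel] at this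
  nlinarith [norm_nonneg x, sq_nonneg (‖y‖ - ‖y - x‖), norm_nonneg y, norm_nonneg (y - x)]

/-- The increment is taken up to the point max(R, r₀), where test functions vanish. -/
theorem pointBound_of_lt_top {r₀ : ℝ} : PointBound A (r₀ : EReal) w := by
  intro R hR
  refine ⟨max R r₀, hR.le.trans (le_max_left _ _), fun φ r hr hrR => ?_⟩
  have h := norm_sub_sq_le φ hr (hrR.le.trans (le_max_left R r₀))
  rw [toFun_eq_zero φ (r := max R r₀), zero_sub, norm_neg] at h
  · refine h.trans ?_
    gcongr
    linarith
  · rintro ⟨-, h⟩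
    exact (not_lt.2 (le_max_right R r₀)) (EReal.coe_lt_coe_iff.1 h)

/-- The term w r³|φ|² of the energy bounds the mean of |φ|² over (R, R + 1]. Some point s there has
a value no larger than the mean bound, and the increment estimate carries it down to r. -/
theorem pointBound_of_one_le (hw : 1 ≤ w) : PointBound A b w := by
  intro R hR
  -- The first summand comes from the value at s, enlarged by R/r ≥ 1 to have the form C/r; the
  -- second from the increment, since s - r ≤ R + 1. The factors 2 are those of `norm_sq_le_two`.
  refine ⟨2 * (R ^ 3)⁻¹ * R + 2 * (R + 1), by positivity, fun φ r hr hrR => ?_⟩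
  have hc : Continuous fun t => ‖toFun A b w φ t‖ ^ 2 := (contDiff_toFun φ).continuous.norm.pow 2
  have hcube : ∫ t in Ioc R (R + 1), ‖toFun A b w φ t‖ ^ 2 ≤ (R ^ 3)⁻¹ * ‖φ‖ ^ 2 := by
    rw [← div_eq_inv_mul, le_div_iff₀ (by positivity), mul_comm, ← integral_const_mul]
    have hI := (isOpen_interval b).measurableSet
    have h0 : 0 ≤ ∫ t in interval b, t ^ 3 * ‖toFun A b w φ t‖ ^ 2 :=
      setIntegral_nonneg hI fun t ht =>
        mul_nonneg (pow_nonneg (pos_of_mem ht).le 3) (sq_nonneg _)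
    have h1 := integral_cube_mul_sq_le φ
    have h2 : ∫ t in interval b, t ^ 3 * ‖toFun A b w φ t‖ ^ 2 ≤ ‖φ‖ ^ 2 := by
      refine le_trans ?_ h1
      exact le_mul_of_one_le_left h0 (by exact_mod_cast hw)
    refine le_trans ?_ h2
    have hcc : Continuous fun t => t ^ 3 * ‖toFun A b w φ t‖ ^ 2 := (continuous_id.pow 3).mul hc
    have hsupp : HasCompactSupport fun t => t ^ 3 * ‖toFun A b w φ t‖ ^ 2 := by
      refine (testSpace_spec (toFun_mem φ)).2.1.mono fun t ht => ?_
      rw [Function.mem_support] at ht ⊢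
      intro h
      apply ht
      rw [show toFun A b w φ t = 0 from h]
      simp
    have hint := (hcc.integrable_of_hasCompactSupport hsupp (μ := volume))
    have e : ∫ t in interval b, t ^ 3 * ‖toFun A b w φ t‖ ^ 2 =
        ∫ t in Ioi 0, t ^ 3 * ‖toFun A b w φ t‖ ^ 2 := by
      refine (setIntegral_eq_of_subset_of_forall_sdiff_eq_zero measurableSet_Ioi
        (fun t ht => pos_of_mem ht) fun t ht => ?_).symm
      rw [toFun_eq_zero φ ht.2]
      simp
    rw [e]
    refine le_trans (setIntegral_mono_on (g := fun t => t ^ 3 * ‖toFun A b w φ t‖ ^ 2)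
      (continuous_const.mul hc).integrableOn_Ioc
      hint.integrableOn measurableSet_Ioc fun t ht => ?_) (setIntegral_mono_set hint.integrableOn ?_
      (Ioc_subset_Ioi_self.trans (Ioi_subset_Ioi hR.le)).eventuallyLE)
    · have := ht.1.le
      gcongr
    · filter_upwards [ae_restrict_mem measurableSet_Ioi] with t ht
      exact mul_nonneg (pow_nonneg (le_of_lt ht) 3) (sq_nonneg _)
  obtain ⟨s, hs, hs2⟩ : ∃ s ∈ Ioc R (R + 1), ‖toFun A b w φ s‖ ^ 2 ≤ (R ^ 3)⁻¹ * ‖φ‖ ^ 2 := by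
    by_contra hcon
    push Not at hcon
    have h3 : ∫ t in Ioc R (R + 1), ((R ^ 3)⁻¹ * ‖φ‖ ^ 2) < ∫ t in Ioc R (R + 1),
        ‖toFun A b w φ t‖ ^ 2 := by
      rw [← intervalIntegral.integral_of_le (by linarith),
        ← intervalIntegral.integral_of_le (by linarith)]
      refine intervalIntegral.integral_lt_integral_of_continuousOn_of_le_of_exists_lt (by linarith)
        continuousOn_const hc.continuousOn (fun t ht => (hcon t ht).le)
        ⟨R + 1, ⟨by linarith, le_rfl⟩, hcon _ ⟨by linarith, le_rfl⟩⟩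
    rw [setIntegral_const] at h3
    simp only [measureReal_def, Real.volume_Ioc, add_sub_cancel_left, ENNReal.ofReal_one,
      ENNReal.toReal_one, one_smul] at h3
    linarith
  have h4 := norm_sub_sq_le φ hr (hrR.le.trans hs.1.le)
  have h5 : (s - r) / r * ‖φ‖ ^ 2 ≤ (R + 1) / r * ‖φ‖ ^ 2 := by
    have := hs.2
    gcongr
    linarith
  have h6 : (R ^ 3)⁻¹ * ‖φ‖ ^ 2 ≤ (R ^ 3)⁻¹ * R / r * ‖φ‖ ^ 2 := by
    have : 1 ≤ R / r := (one_le_div hr).2 hrR.le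
    rw [mul_div_assoc]
    gcongr
    exact le_mul_of_one_le_right (by positivity) this
  calc ‖toFun A b w φ r‖ ^ 2 ≤ 2 * ‖toFun A b w φ s‖ ^ 2 +
        2 * ‖toFun A b w φ s - toFun A b w φ r‖ ^ 2 := norm_sq_le_two
    _ ≤ 2 * ((R ^ 3)⁻¹ * R / r * ‖φ‖ ^ 2) + 2 * ((R + 1) / r * ‖φ‖ ^ 2) := by linarith
    _ = _ := by ring

/-- The evaluation at `r` on the energy space. -/
def evalCLM (h : PointBound A b w) (r : ℝ) : EnergySpace A b w →L[ℂ] F :=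
  if hr : 0 < r then
    LinearMap.mkContinuousOfExistsBound
      (LinearMap.proj r ∘ₗ (testSpace F b).subtype ∘ₗ (EnergySpace.equiv A b w).toLinearMap) (by
        obtain ⟨C, hC, hb⟩ := h (r + 1) (by linarith)
        refine ⟨√(C / r), fun φ => ?_⟩
        refine abs_le_of_sq_le_sq' ?_ (by positivity) |>.2
        rw [mul_pow, Real.sq_sqrt (by positivity)]
        exact hb φ r hr (by linarith))
  -- Test functions vanish for r ≤ 0, so this value is still the evaluation.
  else 0

theorem evalCLM_apply (h : PointBound A b w) (r : ℝ) (φ : EnergySpace A b w) :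
    evalCLM h r φ = toFun A b w φ r := by
  unfold evalCLM
  split_ifs with hr
  · rfl
  · rw [toFun_eq_zero φ fun h => hr (pos_of_mem h)]
    rfl

theorem norm_evalCLM_sq_le (h : PointBound A b w) {R : ℝ} (hR : 0 < R) :
    ∃ C : ℝ, 0 ≤ C ∧ ∀ r, 0 < r → r < R → ‖evalCLM h r‖ ^ 2 ≤ C / r := by
  obtain ⟨C, hC, hb⟩ := h R hR
  refine ⟨C, hC, fun r hr hrR => ?_⟩
  have : ‖evalCLM h r‖ ≤ √(C / r) := by
    refine ContinuousLinearMap.opNorm_le_bound _ (by positivity) fun φ => ?_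
    refine abs_le_of_sq_le_sq' ?_ (by positivity) |>.2
    rw [mul_pow, Real.sq_sqrt (by positivity), evalCLM_apply]
    exact hb φ r hr hrR
  calc ‖evalCLM h r‖ ^ 2 ≤ √(C / r) ^ 2 := by gcongr
    _ = _ := Real.sq_sqrt (by positivity)

/-- The increment estimate is uniform in φ, so continuity holds in operator norm. This makes the
evaluation strongly measurable as an operator valued function, as an element of L² has to be. -/
theorem continuousOn_evalCLM (h : PointBound A b w) : ContinuousOn (evalCLM h) (Ioi 0) := by
  have key : ∀ r s : ℝ, 0 < r → r ≤ s → ‖evalCLM h s - evalCLM h r‖ ≤ √((s - r) / r) := by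
    intro r s hr hrs
    have h0 : 0 ≤ (s - r) / r := div_nonneg (sub_nonneg.2 hrs) hr.le
    refine ContinuousLinearMap.opNorm_le_bound _ (by positivity) fun φ => ?_
    refine abs_le_of_sq_le_sq' ?_ (by positivity) |>.2
    rw [mul_pow, Real.sq_sqrt h0, sub_apply, evalCLM_apply, evalCLM_apply]
    exact norm_sub_sq_le φ hr hrs
  intro r hr
  have hr : 0 < r := hr
  refine ContinuousAt.continuousWithinAt ?_
  refine (tendsto_iff_norm_sub_tendsto_zero (f := evalCLM h) (b := evalCLM h r)).2 ?_
  have hlim : Tendsto (fun s : ℝ => √(|s - r| / min r s)) (𝓝 r) (𝓝 0) := by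
    have : ContinuousAt (fun s : ℝ => √(|s - r| / min r s)) r := by
      refine Real.continuous_sqrt.continuousAt.comp (ContinuousAt.div ?_ ?_ ?_)
      · fun_prop
      · fun_prop
      · simpa using hr.ne'
    simpa [ContinuousAt] using this
  refine squeeze_zero' (Eventually.of_forall fun s => norm_nonneg (evalCLM h s - evalCLM h r)) ?_ hlim
  filter_upwards [lt_mem_nhds hr] with s hs
  rcases le_total r s with hrs | hrs
  · rw [abs_of_nonneg (sub_nonneg.2 hrs), min_eq_left hrs]
    exact key r s hr hrs
  · rw [abs_of_nonpos (sub_nonpos.2 hrs), min_eq_right hrs, neg_sub]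
    exact (norm_sub_rev (evalCLM h s) (evalCLM h r)).trans_le (key s r hs hrs)

end PointBounds

/-! ### Compactness of the embedding of the form domain -/

section HilbertSchmidt

variable {X : Type*} [MeasurableSpace X] {μ : Measure X}
  {E : Type*} [NormedAddCommGroup E] [NormedSpace ℂ E]
  {F : Type*} [NormedAddCommGroup F] [NormedSpace ℂ F]

/-- The operator `x ↦ k(·) x` with the square integrable kernel `k`. -/
def kernelOp (k : Lp (E →L[ℂ] F) 2 μ) : E →L[ℂ] Lp F 2 μ :=
  (ContinuousLinearMap.compLpL₂ 2 μ (ContinuousLinearMap.apply ℂ F (E := E))).flip k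

theorem coeFn_kernelOp (k : Lp (E →L[ℂ] F) 2 μ) (x : E) :
    kernelOp k x =ᵐ[μ] fun t => k t x :=
  (ContinuousLinearMap.apply ℂ F x).coeFn_compLp' k

/-- The Hilbert–Schmidt argument: an indicator kernel gives an operator that factors through the
finite dimensional space `F`. Simple functions are dense in L², the operator depends continuously on
the kernel, and compact operators form a closed subspace. -/
theorem isCompactOperator_kernelOp [FiniteDimensional ℂ F] (k : Lp (E →L[ℂ] F) 2 μ) :
    IsCompactOperator (kernelOp k) := by
  have : CompleteSpace F := FiniteDimensional.complete ℂ F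
  induction k using Lp.induction with
  | hp_ne_top => simp
  | indicatorConst c hs hμs =>
    rename_i s
    let G : F →L[ℂ] Lp F 2 μ := LinearMap.toContinuousLinearMap
      { toFun := fun y => indicatorConstLp 2 hs hμs.ne y
        map_add' := fun y z => indicatorConstLp_add.symm
        map_smul' := fun a y => by
          apply Lp.ext
          grw [indicatorConstLp_coeFn, Lp.coeFn_smul, indicatorConstLp_coeFn]
          filter_upwards with t
          by_cases ht : t ∈ s <;> simp [ht] }
    have h : kernelOp ((Lp.simpleFunc.indicatorConst 2 hs hμs.ne c : Lp.simpleFunc _ 2 μ) :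
        Lp (E →L[ℂ] F) 2 μ) = G ∘L c := by
      ext1 x
      apply Lp.ext
      refine (coeFn_kernelOp _ x).trans ?_
      rw [Lp.simpleFunc.coe_indicatorConst]
      have h1 : G (c x) = indicatorConstLp 2 hs hμs.ne (c x) := rfl
      rw [ContinuousLinearMap.comp_apply, h1]
      filter_upwards [indicatorConstLp_coeFn (p := 2) (hs := hs) (hμs := hμs.ne) (c := c),
        indicatorConstLp_coeFn (p := 2) (hs := hs) (hμs := hμs.ne) (c := c x)] with t h2 h3
      rw [h2, h3]
      by_cases ht : t ∈ s <;> simp [ht]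
    rw [h]
    have hid : IsCompactOperator (id : F → F) :=
      isCompactOperator_id_iff_finiteDimensional (𝕜 := ℂ).2 inferInstance
    have := (hid.comp_clm c).clm_comp G
    exact this
  | add hf hg _ h1 h2 =>
    unfold kernelOp at *
    rw [map_add]
    exact h1.add h2
  | isClosed =>
    exact isClosed_setOfPred_isCompactOperator.preimage
      (ContinuousLinearMap.continuous
        (ContinuousLinearMap.compLpL₂ 2 μ (ContinuousLinearMap.apply ℂ F (E := E))).flip)

/-- The unit ball of `E'` lies in the closure of the image of the unit ball of `E`, so its image
under `T` lies in a compact closure already at hand. This transfers compactness from the test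
functions to their completion. -/
theorem IsCompactOperator.extend {E' : Type*} [NormedAddCommGroup E'] [NormedSpace ℂ E']
    {H : Type*} [NormedAddCommGroup H] [NormedSpace ℂ H] {T : E' →L[ℂ] H} {ι : E →L[ℂ] E'}
    (hι : ∀ x, ‖ι x‖ = ‖x‖) (hd : DenseRange ι) (h : IsCompactOperator (T ∘L ι)) :
    IsCompactOperator T := by
  refine (isCompactOperator_iff_isCompact_closure_image_ball T.toLinearMap one_pos).2 ?_
  have h1 := (isCompactOperator_iff_isCompact_closure_image_ball (T ∘L ι).toLinearMap one_pos).1 h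
  refine h1.of_isClosed_subset isClosed_closure (closure_minimal ?_ isClosed_closure)
  have h2 : Metric.ball (0 : E') 1 ⊆ closure (Metric.ball 0 1 ∩ range ι) :=
    hd.open_subset_closure_inter Metric.isOpen_ball
  rintro _ ⟨x, hx, rfl⟩
  have h3 : T x ∈ closure (T '' (Metric.ball 0 1 ∩ range ι)) :=
    image_closure_subset_closure_image T.continuous ⟨x, h2 hx, rfl⟩
  refine closure_mono ?_ h3
  rintro _ ⟨_, ⟨hy, ⟨y, rfl⟩⟩, rfl⟩
  refine ⟨y, ?_, rfl⟩
  rw [mem_ball_zero_iff] at hy ⊢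
  rwa [← hι]

end HilbertSchmidt

/-! ### The weighted measure r^q dr and its L² space -/

section RadialMeasure

variable {F : Type*} [NormedAddCommGroup F] [InnerProductSpace ℂ F] {b : EReal} {q : ℝ}

theorem measurable_ofReal_rpow : Measurable fun r : ℝ => ENNReal.ofReal (r ^ q) :=
  ENNReal.measurable_ofReal.comp (measurable_id.pow_const q)

theorem integral_radialMeasure {E : Type*} [NormedAddCommGroup E] [NormedSpace ℝ E] (f : ℝ → E) :
    ∫ r, f r ∂(radialMeasure b q) = ∫ r in interval b, r ^ q • f r := by
  rw [radialMeasure, integral_withDensity_eq_integral_toReal_smul measurable_ofReal_rpow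
    (Eventually.of_forall fun _ => ENNReal.ofReal_lt_top)]
  refine setIntegral_congr_fun (isOpen_interval b).measurableSet fun r hr => ?_
  rw [ENNReal.toReal_ofReal (Real.rpow_nonneg (pos_of_mem hr).le q)]

theorem integrable_radialMeasure_iff {E : Type*} [NormedAddCommGroup E] [NormedSpace ℝ E]
    {f : ℝ → E} :
    Integrable f (radialMeasure b q) ↔ IntegrableOn (fun r => r ^ q • f r) (interval b) := by
  rw [radialMeasure, integrable_withDensity_iff_integrable_smul' measurable_ofReal_rpow
    (Eventually.of_forall fun _ => ENNReal.ofReal_lt_top)]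
  refine integrable_congr ?_
  filter_upwards [ae_restrict_mem (isOpen_interval b).measurableSet] with r hr
  rw [ENNReal.toReal_ofReal (Real.rpow_nonneg (pos_of_mem hr).le q)]

theorem radialMeasure_absolutelyContinuous :
    radialMeasure b q ≪ volume.restrict (interval b) := withDensity_absolutelyContinuous _ _

theorem ae_radialMeasure {p : ℝ → Prop} (h : ∀ᵐ r ∂(radialMeasure b q), p r) :
    ∀ᵐ r ∂(volume.restrict (interval b)), p r := by
  rw [radialMeasure, ae_withDensity_iff measurable_ofReal_rpow] at h
  filter_upwards [h, ae_restrict_mem (isOpen_interval b).measurableSet] with r hr hI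
  exact hr (ENNReal.ofReal_pos.2 (Real.rpow_pos_of_pos (pos_of_mem hI) q)).ne'

theorem inner_toLp {f g : ℝ → F} (hf : MemLp f 2 (radialMeasure b q))
    (hg : MemLp g 2 (radialMeasure b q)) :
    inner ℂ (hf.toLp f) (hg.toLp g) = ∫ r in interval b, r ^ q • (inner ℂ (f r) (g r) : ℂ) := by
  rw [← integral_radialMeasure, L2.inner_def]
  refine integral_congr_ae ?_
  filter_upwards [hf.coeFn_toLp, hg.coeFn_toLp] with r h1 h2
  rw [h1, h2]

theorem norm_toLp_sq {f : ℝ → F} (hf : MemLp f 2 (radialMeasure b q)) :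
    ‖hf.toLp f‖ ^ 2 = ∫ r in interval b, r ^ q * ‖f r‖ ^ 2 := by
  have h1 : Integrable (fun r => (inner ℂ (f r) (f r) : ℂ)) (radialMeasure b q) := by
    refine (integrable_congr ?_).1 (L2.integrable_inner (𝕜 := ℂ) (hf.toLp f) (hf.toLp f))
    filter_upwards [hf.coeFn_toLp] with r h1
    rw [h1]
  rw [norm_sq_eq_re_inner (𝕜 := ℂ), inner_toLp]
  rw [integrable_radialMeasure_iff] at h1
  rw [← integral_re h1]
  refine integral_congr_ae (Eventually.of_forall fun r => ?_)
  simp only [RCLike.smul_re]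
  rw [← norm_sq_eq_re_inner]

end RadialMeasure

theorem isCompactOperator_of_approx {E H : Type*} [NormedAddCommGroup E] [NormedSpace ℂ E]
    [NormedAddCommGroup H] [NormedSpace ℂ H] [CompleteSpace H] {T : E →L[ℂ] H}
    (h : ∀ ε : ℝ, 0 < ε → ∃ T' : E →L[ℂ] H, IsCompactOperator T' ∧
      ∀ x, ‖T x - T' x‖ ≤ ε * ‖x‖) : IsCompactOperator T := by
  refine (isClosed_setOfPred_isCompactOperator (σ₁₂ := RingHom.id ℂ) (M₁ := E)
    (M₂ := H)).closure_subset_iff.2 subset_rfl ?_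
  refine Metric.mem_closure_iff.2 fun ε hε => ?_
  obtain ⟨T', hT', hb⟩ := h (ε / 2) (half_pos hε)
  refine ⟨T', hT', ?_⟩
  rw [dist_eq_norm]
  exact lt_of_le_of_lt (ContinuousLinearMap.opNorm_le_bound _ (half_pos hε).le hb)
    (half_lt_self hε)

/-! ### Operators given by a family of evaluations -/

section Kernel

variable {E : Type*} [NormedAddCommGroup E] [NormedSpace ℂ E]
  {F : Type*} [NormedAddCommGroup F] [InnerProductSpace ℂ F] {b : EReal} {q : ℝ}
  {k : ℝ → E →L[ℂ] F} {T : E → StateSpace F b q}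

/-- The integrand r^q‖k(r)‖² is at most C r^{q-1}, which is bounded on (0, R) because q ≥ 1. -/
theorem memLp_truncated (hk : ContinuousOn k (Ioi 0)) (hq : 1 ≤ q) {C R : ℝ}
    (hC : 0 ≤ C) (hb : ∀ r, 0 < r → r < R → ‖k r‖ ^ 2 ≤ C / r) :
    MemLp ((Iio R).indicator k) 2 (radialMeasure b q) := by
  have hm' : AEStronglyMeasurable ((Iio R).indicator k) (volume.restrict (interval b)) :=
    ((hk.mono fun r hr => pos_of_mem hr).aestronglyMeasurable
      (isOpen_interval b).measurableSet).indicator measurableSet_Iio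
  have hm := hm'.mono_ac (radialMeasure_absolutelyContinuous (q := q))
  rw [memLp_two_iff_integrable_sq_norm hm]
  have h1 : Integrable ((Ioo 0 R).indicator fun _ : ℝ => C * R ^ (q - 1)) volume :=
    (integrable_indicator_iff measurableSet_Ioo).2 (integrableOn_const (by simp))
  rw [integrable_radialMeasure_iff]
  refine Integrable.mono' h1.integrableOn ?_ ?_
  · have hc : AEStronglyMeasurable (fun r : ℝ => r ^ q) (volume.restrict (interval b)) :=
      (measurable_id.pow_const q).aestronglyMeasurable
    exact hc.smul (hm'.norm.pow 2)
  · filter_upwards [ae_restrict_mem (isOpen_interval b).measurableSet] with r hr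
    have hr0 := pos_of_mem hr
    by_cases hrR : r < R
    · rw [indicator_of_mem (show r ∈ Iio R from hrR),
        indicator_of_mem (show r ∈ Ioo 0 R from ⟨hr0, hrR⟩), smul_eq_mul, Real.norm_eq_abs,
        abs_of_nonneg (by positivity)]
      calc r ^ q * ‖k r‖ ^ 2 ≤ r ^ q * (C / r) := by gcongr; exact hb r hr0 hrR
        _ = C * r ^ (q - 1) := by
          rw [Real.rpow_sub_one hr0.ne']
          ring
        _ ≤ C * R ^ (q - 1) := by
          gcongr
    · rw [indicator_of_notMem (show r ∉ Iio R from hrR),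
        indicator_of_notMem (show r ∉ Ioo 0 R from fun hh => hrR hh.2)]
      simp

theorem norm_sub_kernelOp_sq {R : ℝ} (hT : ∀ x, T x =ᵐ[radialMeasure b q] fun r => k r x)
    (hR : MemLp ((Iio R).indicator k) 2 (radialMeasure b q)) (x : E) :
    ‖T x - kernelOp (hR.toLp _) x‖ ^ 2 =
      ∫ r in interval b ∩ Ici R, r ^ q * ‖k r x‖ ^ 2 := by
  have hx : MemLp (fun r => k r x) 2 (radialMeasure b q) := (Lp.memLp (T x)).ae_eq (hT x)
  have h1 : T x - kernelOp (hR.toLp _) x =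
      (hx.indicator measurableSet_Ici).toLp ((Ici R).indicator fun r => k r x) := by
    apply Lp.ext
    filter_upwards [Lp.coeFn_sub (T x) (kernelOp (hR.toLp _) x), hT x, hR.coeFn_toLp,
      (hx.indicator measurableSet_Ici).coeFn_toLp (f := (Ici R).indicator fun r => k r x),
      coeFn_kernelOp (hR.toLp _) x] with r h1 h2 h3 h4 h5
    rw [h1, h4, Pi.sub_apply, h5, h3, h2]
    by_cases hr : r < R
    · rw [indicator_of_mem (show r ∈ Iio R from hr),
        indicator_of_notMem (show r ∉ Ici R from not_le.2 hr), sub_self]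
    · rw [indicator_of_notMem (show r ∉ Iio R from hr),
        indicator_of_mem (show r ∈ Ici R from not_lt.1 hr)]
      simp
  rw [h1, norm_toLp_sq, ← setIntegral_indicator measurableSet_Ici]
  congr 1
  ext r
  by_cases hr : r ∈ Ici R <;> simp [hr]

variable (hk : ContinuousOn k (Ioi 0)) (hq : 1 ≤ q)
  (hb : ∀ R : ℝ, 0 < R → ∃ C : ℝ, 0 ≤ C ∧ ∀ r, 0 < r → r < R → ‖k r‖ ^ 2 ≤ C / r)
  (ht : ∀ ε : ℝ, 0 < ε → ∃ R : ℝ, 0 < R ∧ ∀ x,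
    ∫ r in interval b ∩ Ici R, r ^ q * ‖k r x‖ ^ 2 ≤ ε * ‖x‖ ^ 2)
include hk hq hb ht

/-- Cutting the kernel off at a large R makes it square integrable, and the error is exactly the
tail. No continuity of `T` is assumed: with ε = 1 the estimate yields its boundedness, and with ε →
0 its compactness. -/
theorem exists_norm_sub_kernelOp_le (hT : ∀ x, T x =ᵐ[radialMeasure b q] fun r => k r x)
    {ε : ℝ} (hε : 0 < ε) :
    ∃ κ : Lp (E →L[ℂ] F) 2 (radialMeasure b q), ∀ x, ‖T x - kernelOp κ x‖ ≤ ε * ‖x‖ := by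
  obtain ⟨R, hR, h⟩ := ht (ε ^ 2) (by positivity)
  obtain ⟨C, hC, hCb⟩ := hb R hR
  refine ⟨(memLp_truncated hk hq hC hCb).toLp _, fun x => ?_⟩
  refine abs_le_of_sq_le_sq' ?_ (by positivity) |>.2
  rw [mul_pow, norm_sub_kernelOp_sq hT]
  exact h x

theorem exists_norm_le_of_kernel (hT : ∀ x, T x =ᵐ[radialMeasure b q] fun r => k r x) :
    ∃ C : ℝ, ∀ x, ‖T x‖ ≤ C * ‖x‖ := by
  obtain ⟨κ, hκ⟩ := exists_norm_sub_kernelOp_le hk hq hb ht hT one_pos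
  refine ⟨1 + ‖kernelOp κ‖, fun x => ?_⟩
  have h1 := hκ x
  have h4 := norm_le_norm_add_norm_sub (kernelOp κ x) (T x)
  rw [norm_sub_rev] at h4
  have h5 := (kernelOp κ).le_opNorm x
  linarith

theorem isCompactOperator_of_kernel [FiniteDimensional ℂ F] (T : E →L[ℂ] StateSpace F b q)
    (hT : ∀ x, T x =ᵐ[radialMeasure b q] fun r => k r x) : IsCompactOperator T := by
  have : CompleteSpace F := FiniteDimensional.complete ℂ F
  refine isCompactOperator_of_approx fun ε hε => ?_
  obtain ⟨κ, hκ⟩ := exists_norm_sub_kernelOp_le hk hq hb ht hT hε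
  exact ⟨kernelOp κ, isCompactOperator_kernelOp κ, hκ⟩

end Kernel

/-! ### The form domain inside the state space -/

section Embedding

variable {F : Type*} [NormedAddCommGroup F] [InnerProductSpace ℂ F]
  (A : {A : F →ₗ[ℂ] F // A.IsPositive}) (b : EReal) (w : ℝ≥0) (q : ℝ)

/-- The canonical map of the energy space into `L²(I, q) ⊗ F`. -/
def energyToState : EnergySpace A b w →ₗ[ℂ] StateSpace F b q :=
  toState b q ∘ₗ (EnergySpace.equiv A b w).toLinearMap

/-- The energy norm controls the norm of `L²(I, q) ⊗ F`. -/
def IsEmbedded : Prop := ∃ C : ℝ, ∀ φ, ‖energyToState A b w q φ‖ ≤ C * ‖φ‖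

/-- Elements of the energy space are uniformly small in `L²(I, q) ⊗ F` near infinity. -/
def TailBound : Prop :=
  ∀ ε : ℝ, 0 < ε → ∃ R : ℝ, 0 < R ∧ ∀ φ : EnergySpace A b w,
    ∫ r in interval b ∩ Ici R, r ^ q * ‖toFun A b w φ r‖ ^ 2 ≤ ε * ‖φ‖ ^ 2

variable {A b w q}

theorem memLp_toFun (φ : EnergySpace A b w) : MemLp (toFun A b w φ) 2 (radialMeasure b q) :=
  memLp_radial (testSpace_spec (toFun_mem φ)).2.1 (testSpace_spec (toFun_mem φ)).2.2
    (contDiff_toFun φ).continuous.continuousOn fun _ hr => image_eq_zero_of_notMem_tsupport hr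

theorem energyToState_eq (φ : EnergySpace A b w) :
    energyToState A b w q φ = (memLp_toFun φ).toLp (toFun A b w φ) := rfl

theorem norm_energyToState_sq (φ : EnergySpace A b w) :
    ‖energyToState A b w q φ‖ ^ 2 = ∫ r in interval b, r ^ q * ‖toFun A b w φ r‖ ^ 2 := by
  rw [energyToState_eq, norm_toLp_sq]

theorem inner_energyToState (φ χ : EnergySpace A b w) :
    inner ℂ (energyToState A b w q φ) (energyToState A b w q χ) =
      ∫ r in interval b, r ^ q • (inner ℂ (toFun A b w φ r) (toFun A b w χ r) : ℂ) := by
  rw [energyToState_eq, energyToState_eq, inner_toLp]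

variable [CompleteSpace F]

theorem TailBound.isEmbedded (h : PointBound A b w) (hq : 1 ≤ q) (ht : TailBound A b w q) :
    IsEmbedded A b w q := by
  refine exists_norm_le_of_kernel (E := EnergySpace A b w) (k := evalCLM h)
    (T := energyToState A b w q) (continuousOn_evalCLM h) hq (fun R => norm_evalCLM_sq_le h)
    (fun ε hε => ?_) fun φ => ?_
  · obtain ⟨R, hR, hb⟩ := ht ε hε
    refine ⟨R, hR, fun φ => ?_⟩
    simp only [evalCLM_apply]
    exact hb φ
  · simp only [evalCLM_apply]
    exact (memLp_toFun φ).coeFn_toLp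

/-- The embedding of the energy space into `L²(I, q) ⊗ F` as a bounded operator. -/
def energyToStateL (hE : IsEmbedded A b w q) : EnergySpace A b w →L[ℂ] StateSpace F b q :=
  (energyToState A b w q).mkContinuousOfExistsBound hE

theorem TailBound.isCompactOperator [FiniteDimensional ℂ F] (h : PointBound A b w) (hq : 1 ≤ q)
    (ht : TailBound A b w q) (hE : IsEmbedded A b w q) :
    IsCompactOperator (energyToStateL hE) := by
  refine isCompactOperator_of_kernel (E := EnergySpace A b w) (k := evalCLM h)
    (continuousOn_evalCLM h) hq (fun R => norm_evalCLM_sq_le h)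
    (fun ε hε => ?_) (energyToStateL hE) fun φ => ?_
  · obtain ⟨R, hR, hb⟩ := ht ε hε
    refine ⟨R, hR, fun φ => ?_⟩
    simp only [evalCLM_apply]
    exact hb φ
  · simp only [evalCLM_apply]
    exact (memLp_toFun φ).coeFn_toLp

/-- The embedding of the form domain into `L²(I, q) ⊗ F`. -/
def formToState (hE : IsEmbedded A b w q) : FormDomain A b w →L[ℂ] StateSpace F b q :=
  (energyToStateL hE).extend UniformSpace.Completion.toComplL

theorem formToState_coe (hE : IsEmbedded A b w q) (φ : EnergySpace A b w) :
    formToState hE (φ : FormDomain A b w) = energyToState A b w q φ :=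
  ContinuousLinearMap.extend_eq _ UniformSpace.Completion.denseRange_coe
    (UniformSpace.Completion.isUniformInducing_coe _) φ

theorem TailBound.isCompactOperator_formToState [FiniteDimensional ℂ F] (h : PointBound A b w)
    (hq : 1 ≤ q) (ht : TailBound A b w q) (hE : IsEmbedded A b w q) :
    IsCompactOperator (formToState hE) := by
  refine IsCompactOperator.extend (ι := UniformSpace.Completion.toComplL)
    (fun x => UniformSpace.Completion.norm_coe x) UniformSpace.Completion.denseRange_coe ?_
  have : formToState hE ∘L UniformSpace.Completion.toComplL = energyToStateL hE := by
    ext1 φ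
    exact formToState_coe hE φ
  rw [this]
  exact ht.isCompactOperator h hq hE

/-- When the energy norm controls the L² norm, the closure of the diagonal of test functions is the
graph of the continuous extension: this graph is closed, and the test functions are dense in it. -/
theorem mem_embedding_iff (hE : IsEmbedded A b w q) (x : FormDomain A b w)
    (ψ : StateSpace F b q) : (x, ψ) ∈ embedding A b w q ↔ formToState hE x = ψ := by
  constructor
  · intro h
    have hcl : IsClosed {p : FormDomain A b w × StateSpace F b q | formToState hE p.1 = p.2} :=
      isClosed_eq ((formToState hE).continuous.comp continuous_fst) continuous_snd
    refine closure_minimal ?_ hcl h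
    rintro _ ⟨φ, rfl⟩
    exact formToState_coe hE φ
  · rintro rfl
    have h : ∀ x : FormDomain A b w, x ∈ closure (range ((↑) : EnergySpace A b w → FormDomain A b w)) :=
      UniformSpace.Completion.denseRange_coe
    have hc : Continuous fun x : FormDomain A b w => (x, formToState hE x) :=
      continuous_id.prodMk (formToState hE).continuous
    have h1 := image_closure_subset_closure_image hc ⟨x, h x, rfl⟩
    refine closure_mono ?_ h1
    rintro _ ⟨_, ⟨φ, rfl⟩, rfl⟩
    exact ⟨φ, Prod.ext rfl (formToState_coe hE φ).symm⟩

end Embedding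

/-! ### The quadratic form of the radial operator -/

section FormIdentity

variable {F : Type*} [NormedAddCommGroup F] [InnerProductSpace ℂ F]
  {A : {A : F →ₗ[ℂ] F // A.IsPositive}} {b : EReal} {w : ℝ≥0} {q : ℝ}

theorem integrableOn_inner {f g : ℝ → F} (hf : MemLp f 2 (radialMeasure b q))
    (hg : MemLp g 2 (radialMeasure b q)) :
    IntegrableOn (fun r => r ^ q • (inner ℂ (f r) (g r) : ℂ)) (interval b) := by
  rw [← integrable_radialMeasure_iff]
  refine (integrable_congr ?_).1 (L2.integrable_inner (𝕜 := ℂ) (hf.toLp f) (hg.toLp g))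
  filter_upwards [hf.coeFn_toLp, hg.coeFn_toLp] with r h1 h2
  rw [h1, h2]

theorem inner_real_smul_left (c : ℝ) (x y : F) : inner ℂ (c • x) y = (c : ℂ) * inner ℂ x y := by
  rw [← Complex.coe_smul, inner_smul_left, Complex.conj_ofReal]

/-- Integration by parts. -/
theorem integral_deriv_smul_deriv (φ χ : EnergySpace A b w) :
    IntegrableOn (fun r => inner ℂ (deriv (fun s : ℝ => s • deriv (toFun A b w φ) s) r)
        (toFun A b w χ r) + r * inner ℂ (deriv (toFun A b w φ) r) (deriv (toFun A b w χ) r))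
        (interval b) ∧
      ∫ r in interval b, (inner ℂ (deriv (fun s : ℝ => s • deriv (toFun A b w φ) s) r)
        (toFun A b w χ r) + r * inner ℂ (deriv (toFun A b w φ) r) (deriv (toFun A b w χ) r)) =
        (0 : ℂ) := by
  set f := toFun A b w φ
  set g := toFun A b w χ
  have hf : ContDiff ℝ ∞ f := contDiff_toFun φ
  have hg : ContDiff ℝ ∞ g := contDiff_toFun χ
  have hf1 : ContDiff ℝ ∞ (fun s : ℝ => s • deriv f s) :=
    contDiff_id.smul (contDiff_infty_iff_deriv.1 hf).2
  have hf2 : Continuous (deriv fun s : ℝ => s • deriv f s) :=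
    (contDiff_infty_iff_deriv.1 hf1).2.continuous
  have hg1 : Continuous (deriv g) := (contDiff_infty_iff_deriv.1 hg).2.continuous
  set D : ℝ → ℂ := fun r => inner ℂ (deriv (fun s : ℝ => s • deriv f s) r) (g r) +
    r * inner ℂ (deriv f r) (deriv g r)
  have hD : ∀ r, HasDerivAt (fun r => (inner ℂ (r • deriv f r) (g r) : ℂ)) (D r) r := by
    intro r
    have h := HasDerivAt.inner ℂ (hf1.differentiable (by simp) r).hasDerivAt
      (hg.differentiable (by simp) r).hasDerivAt
    rw [inner_real_smul_left, add_comm] at h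
    exact h
  have hsupp : ∀ r, r ∉ tsupport g → D r = 0 := by
    intro r hr
    have h1 : g r = 0 := image_eq_zero_of_notMem_tsupport hr
    have h2 : deriv g r = 0 := by
      rw [(notMem_tsupport_iff_eventuallyEq.1 hr).deriv_eq]
      simp
    simp [D, h1, h2]
  have hgs := testSpace_spec (toFun_mem χ)
  have hDc : Continuous D := (hf2.inner hg.continuous).add
    (Complex.continuous_ofReal.mul ((continuous_deriv_toFun φ).inner hg1))
  have hDi : Integrable D := hDc.integrable_of_hasCompactSupport
    (HasCompactSupport.intro hgs.2.1 hsupp)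
  refine ⟨hDi.integrableOn, ?_⟩
  rw [setIntegral_eq_integral_of_forall_compl_eq_zero
    fun r hr => hsupp r fun h => hr (hgs.2.2 h)]
  refine integral_eq_zero_of_hasDerivAt_of_integrable hD hDi ?_
  refine Continuous.integrable_of_hasCompactSupport (hf1.continuous.inner hg.continuous)
    (HasCompactSupport.intro hgs.2.1 fun r hr => ?_)
  rw [show g r = 0 from image_eq_zero_of_notMem_tsupport hr, inner_zero_right]

/-- The quadratic form of the operator with the potential `w r² + c₁ r² + c₂ r^s`. -/
theorem inner_hatOp {W : ℝ → ℝ} (hW : ContinuousOn W (Ioi 0)) {p s c₁ c₂ : ℝ} (hq : q = p + 1)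
    (hWeq : ∀ r, 0 < r → W r = w * r ^ 2 + c₁ * r ^ 2 + c₂ * r ^ s) (φ χ : EnergySpace A b w) :
    inner ℂ (hatOp A.1 W hW p b q (EnergySpace.equiv A b w φ)) (energyToState A b w q χ) =
      inner ℂ φ χ + c₁ * inner ℂ (energyToState A b w 3 φ) (energyToState A b w 3 χ) +
        c₂ * inner ℂ (energyToState A b w (1 + s) φ) (energyToState A b w (1 + s) χ) := by
  obtain ⟨hDi, hD⟩ := integral_deriv_smul_deriv φ χ
  have hi := integrableOn_energyDensity A.1 w (toFun_mem φ) (toFun_mem χ)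
  have h3 := integrableOn_inner (memLp_toFun (q := 3) φ) (memLp_toFun (q := 3) χ)
  have h4 := integrableOn_inner (memLp_toFun (q := 1 + s) φ) (memLp_toFun (q := 1 + s) χ)
  -- The vanishing integral from the integration by parts is subtracted from the energy integral.
  -- After this the two sides of the identity agree pointwise under the integral.
  have hsum := (integral_add ((hi.sub hDi).add (h3.const_mul (c₁ : ℂ))) (h4.const_mul (c₂ : ℂ)))
  have hsum2 := (integral_add (hi.sub hDi) (h3.const_mul (c₁ : ℂ)))
  have hsum3 := integral_sub hi hDi
  rw [hD, sub_zero] at hsum3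
  rw [integral_const_mul] at hsum hsum2
  rw [inner_energyToState, inner_energyToState, inner_energySpace, energy]
  refine Eq.trans ?_ (hsum.trans (congrArg (· + _) (hsum2.trans (congrArg (· + _) hsum3))))
  have hml : MemLp (fun r => r ^ (-p) • radialOp A.1 W (toFun A b w φ) r) 2 (radialMeasure b q) :=
    memLp_radial (testSpace_spec (toFun_mem φ)).2.1 (testSpace_spec (toFun_mem φ)).2.2
      (radialOp_props A.1 hW p (toFun_mem φ)).1 (radialOp_props A.1 hW p (toFun_mem φ)).2
  refine (inner_toLp hml (memLp_toFun χ)).trans ?_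
  refine setIntegral_congr_fun (isOpen_interval b).measurableSet fun r hr => ?_
  have hr0 := pos_of_mem hr
  have hc : (r : ℂ) ≠ 0 := by exact_mod_cast hr0.ne'
  -- This is the role of q = p + 1: the weight cancels r^{-p} up to the factor r, which brings
  -- -r⁻¹(rφ')' into divergence form.
  have hpow : ((r ^ q : ℝ) : ℂ) * ((r ^ (-p) : ℝ) : ℂ) = r := by
    rw [← Complex.ofReal_mul, ← Real.rpow_add hr0, hq, show p + 1 + -p = 1 by ring, Real.rpow_one]
  have h3' : ((r ^ (3 : ℝ) : ℝ) : ℂ) = (r : ℂ) ^ 3 := by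
    rw [← Complex.ofReal_pow, ← Real.rpow_natCast]
    norm_num
  have hs' : ((r ^ (1 + s) : ℝ) : ℂ) = r * ((r ^ s : ℝ) : ℂ) := by
    rw [← Complex.ofReal_mul, Real.rpow_add hr0, Real.rpow_one]
  simp only [radialOp, inner_real_smul_left, inner_add_left, inner_neg_left,
    Complex.real_smul, energyDensity, hWeq r hr0, Pi.add_apply, Pi.sub_apply]
  rw [← mul_assoc, hpow, h3', hs']
  push_cast
  field_simp
  ring

variable [CompleteSpace F]

theorem inner_hatOp_formToState {W : ℝ → ℝ} (hW : ContinuousOn W (Ioi 0)) {p s c₁ c₂ : ℝ}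
    (hq : q = p + 1) (hWeq : ∀ r, 0 < r → W r = w * r ^ 2 + c₁ * r ^ 2 + c₂ * r ^ s)
    (hE : IsEmbedded A b w q) (h3 : IsEmbedded A b w 3) (hs : IsEmbedded A b w (1 + s))
    (φ : EnergySpace A b w) (x : FormDomain A b w) :
    inner ℂ (hatOp A.1 W hW p b q (EnergySpace.equiv A b w φ)) (formToState hE x) =
      inner ℂ (φ : FormDomain A b w) x +
        c₁ * inner ℂ (formToState h3 (φ : FormDomain A b w)) (formToState h3 x) +
        c₂ * inner ℂ (formToState hs (φ : FormDomain A b w)) (formToState hs x) := by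
  induction x using UniformSpace.Completion.induction_on with
  | hp =>
    refine isClosed_eq ?_ ?_
    · exact continuous_const.inner (formToState hE).continuous
    · exact ((continuous_const.inner continuous_id).add (continuous_const.mul
        (continuous_const.inner (formToState h3).continuous))).add (continuous_const.mul
        (continuous_const.inner (formToState hs).continuous))
  | ih χ =>
    rw [formToState_coe, formToState_coe, formToState_coe, formToState_coe, formToState_coe,
      UniformSpace.Completion.inner_coe]
    exact inner_hatOp hW hq hWeq φ χ

theorem eq_of_forall_inner_coe {x y : FormDomain A b w}
    (h : ∀ φ : EnergySpace A b w, inner ℂ (φ : FormDomain A b w) x =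
      inner ℂ (φ : FormDomain A b w) y) : x = y :=
  UniformSpace.Completion.denseRange_coe.eq_of_inner_right ℂ h

/-- The form is closable: with the potential w r² there are no lower order terms, so ⟨φ, x⟩ is the
L² product of an operator applied to φ with the image of x. If the image is zero, x is orthogonal to
all test functions. -/
theorem formToState_injective (hE : IsEmbedded A b w q) (h3 : IsEmbedded A b w 3) :
    Function.Injective (formToState hE) := by
  rw [injective_iff_map_eq_zero]
  intro x hx
  apply eq_of_forall_inner_coe
  intro φ
  have h3' : IsEmbedded A b w (1 + 2) := by
    rwa [show (1 : ℝ) + 2 = 3 by norm_num]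
  have h := inner_hatOp_formToState (W := fun r => w * r ^ 2) (by fun_prop) (p := q - 1)
    (c₁ := 0) (c₂ := 0) (s := 2) (by ring) (fun r _ => by ring) hE h3 h3' φ x
  rw [hx, inner_zero_right] at h
  rw [inner_zero_right]
  simpa using h.symm

/-- The operator on the form domain that represents the quadratic form with the potential
`w r² + c₁ r² + c₂ r^s`. -/
def formOp {s : ℝ} (c₁ c₂ : ℝ) (h3 : IsEmbedded A b w 3) (hs : IsEmbedded A b w (1 + s)) :
    FormDomain A b w →L[ℂ] FormDomain A b w :=
  ContinuousLinearMap.id ℂ _ +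
    (c₁ : ℂ) • (ContinuousLinearMap.adjoint (formToState h3) ∘L formToState h3) +
    (c₂ : ℂ) • (ContinuousLinearMap.adjoint (formToState hs) ∘L formToState hs)

variable {s c₁ c₂ : ℝ} (h3 : IsEmbedded A b w 3) (hs : IsEmbedded A b w (1 + s))

theorem inner_formOp (x y : FormDomain A b w) :
    inner ℂ y (formOp c₁ c₂ h3 hs x) = inner ℂ y x +
      c₁ * inner ℂ (formToState h3 y) (formToState h3 x) +
      c₂ * inner ℂ (formToState hs y) (formToState hs x) := by
  simp only [formOp, add_apply, ContinuousLinearMap.id_apply,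
    smul_apply, ContinuousLinearMap.comp_apply, inner_add_right, inner_smul_right,
    ContinuousLinearMap.adjoint_inner_right]

theorem formOp_isSymmetric : (formOp c₁ c₂ h3 hs).IsSymmetric := by
  intro x y
  change inner ℂ (formOp c₁ c₂ h3 hs x) y = inner ℂ x (formOp c₁ c₂ h3 hs y)
  rw [← inner_conj_symm, inner_formOp, inner_formOp]
  simp only [map_add, map_mul, Complex.conj_ofReal, inner_conj_symm]

theorem re_inner_formOp (x : FormDomain A b w) :
    (inner ℂ (formOp c₁ c₂ h3 hs x) x).re = ‖x‖ ^ 2 + c₁ * ‖formToState h3 x‖ ^ 2 +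
      c₂ * ‖formToState hs x‖ ^ 2 := by
  rw [(formOp_isSymmetric h3 hs).apply_clm, inner_formOp, inner_self_eq_norm_sq_to_K,
    inner_self_eq_norm_sq_to_K, inner_self_eq_norm_sq_to_K]
  have e : ∀ t : ℝ, ((t : ℂ) ^ 2).re = t ^ 2 := fun t => by
    rw [← Complex.ofReal_pow, Complex.ofReal_re]
  simp [e]

end FormIdentity

/-! ### Density of the test functions and infinite dimension of the state space -/

section Density

variable {F : Type*} [NormedAddCommGroup F] [InnerProductSpace ℂ F] {b : EReal} {q : ℝ}

theorem isLocallyFiniteMeasure_radialMeasure (hq : 0 ≤ q) :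
    IsLocallyFiniteMeasure (radialMeasure b q) :=
  IsLocallyFiniteMeasure.withDensity_ofReal (Real.continuous_rpow_const hq)

/-- The fundamental lemma of the calculus of variations for r^q χ, which is locally integrable on
the open interval; the test functions are u ⊗ η with η ranging over `F`. -/
theorem eq_zero_of_forall_inner_toState [CompleteSpace F] (hq : 0 ≤ q) (χ : StateSpace F b q)
    (h : ∀ φ : testSpace F b, inner ℂ (toState b q φ) χ = 0) : χ = 0 := by
  have := isLocallyFiniteMeasure_radialMeasure (b := b) hq
  have hloc : LocallyIntegrableOn (fun r => r ^ q • χ r) (interval b) := by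
    rw [locallyIntegrableOn_iff (isOpen_interval b).isLocallyClosed]
    intro K hKI hK
    have h1 : IntegrableOn χ K (radialMeasure b q) :=
      ((Lp.memLp χ).locallyIntegrable (by norm_num)).integrableOn_isCompact hK
    rw [← integrable_indicator_iff hK.measurableSet, integrable_radialMeasure_iff] at h1
    refine (h1.mono_set hKI).congr_fun (fun r hr => ?_) hK.measurableSet
    simp only
    rw [indicator_of_mem hr]
  have hae := (isOpen_interval b).ae_eq_zero_of_integral_contDiff_smul_eq_zero hloc
    fun u hu hus huI => by
    -- Without integrability the Bochner integral is zero by convention, so that case needs no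
    -- argument.
    by_cases hint : Integrable fun r => u r • r ^ q • χ r
    · apply ext_inner_left ℂ
      intro η
      rw [inner_zero_right, ← integral_inner hint]
      have hu' : ContDiff ℝ ∞ fun r => (u r : ℂ) := Complex.ofRealCLM.contDiff.comp hu
      have hsub : Function.support (fun r => (u r : ℂ)) ⊆ Function.support u := fun r hr => by
        simpa using hr
      have hmem : (fun r => (u r : ℂ) • η) ∈ testSpace F b :=
        Submodule.subset_span ⟨fun r => (u r : ℂ), hu', hus.mono hsub,
          (closure_mono hsub).trans huI, η, rfl⟩
      have h1 := h ⟨_, hmem⟩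
      have hml : MemLp (fun r => (u r : ℂ) • η) 2 (radialMeasure b q) :=
        memLp_radial (testSpace_spec hmem).2.1 (testSpace_spec hmem).2.2
          (testSpace_spec hmem).1.continuous.continuousOn fun _ hr =>
            image_eq_zero_of_notMem_tsupport (f := fun r => (u r : ℂ) • η) hr
      have h2 := inner_toLp hml (Lp.memLp χ)
      rw [Lp.toLp_coeFn] at h2
      have h3 := h2.symm.trans h1
      rw [← h3, setIntegral_eq_integral_of_forall_compl_eq_zero]
      · congr 1
        ext r
        rw [← Complex.coe_smul, ← Complex.coe_smul, inner_smul_right, inner_smul_right,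
          inner_smul_left, Complex.conj_ofReal, Complex.real_smul]
        ring
      · intro r hr
        have : u r = 0 := image_eq_zero_of_notMem_tsupport fun hc => hr (huI hc)
        simp [this]
    · exact integral_undef hint
  rw [Lp.eq_zero_iff_ae_eq_zero]
  have h2 : ∀ᵐ r ∂(volume.restrict (interval b)), χ r = 0 := by
    rw [ae_restrict_iff' (isOpen_interval b).measurableSet]
    filter_upwards [hae] with r hr hI
    exact (smul_eq_zero.1 (hr hI)).resolve_left (Real.rpow_pos_of_pos (pos_of_mem hI) q).ne'
  exact radialMeasure_absolutelyContinuous.ae_le h2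

/-- The disjoint intervals (ρ/(k+2), ρ/(k+1)) accumulate at 0 and have positive finite measure;
their indicators times a fixed vector are orthogonal. Infinite dimension is what makes the
eigenvectors an infinite sequence. -/
theorem not_finiteDimensional_stateSpace [Nontrivial F] (hq : 0 ≤ q) (hb : 0 < b) :
    ¬ FiniteDimensional ℂ (StateSpace F b q) := by
  intro hfd
  have := isLocallyFiniteMeasure_radialMeasure (b := b) hq
  obtain ⟨ρ, hρ0, hρb⟩ : ∃ ρ : ℝ, 0 < ρ ∧ (ρ : EReal) < b := by
    obtain ⟨ρ, h1, h2⟩ := EReal.lt_iff_exists_real_btwn.1 hb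
    exact ⟨ρ, EReal.coe_lt_coe_iff.1 h1, h2⟩
  obtain ⟨η, hη⟩ := exists_ne (0 : F)
  let s : ℕ → Set ℝ := fun k => Ioo (ρ / (k + 2)) (ρ / (k + 1))
  have hsI : ∀ k, s k ⊆ interval b := fun k r hr => by
    have h1 : 0 < r := lt_trans (by positivity) hr.1
    have h2 : ρ / (k + 1) ≤ ρ := div_le_self hρ0.le (by linarith [k.cast_nonneg (α := ℝ)])
    exact ⟨h1, lt_trans (EReal.coe_lt_coe_iff.2 (hr.2.trans_le h2)) hρb⟩
  have hfin : ∀ k, radialMeasure b q (s k) ≠ ⊤ := fun k =>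
    ((measure_mono Ioo_subset_Icc_self).trans_lt isCompact_Icc.measure_lt_top).ne
  have hpos : ∀ k, radialMeasure b q (s k) ≠ 0 := by
    intro k h0
    have h1 : ∀ᵐ r ∂(radialMeasure b q), r ∉ s k := measure_eq_zero_iff_ae_notMem.1 h0
    have h2 := ae_radialMeasure h1
    rw [← measure_eq_zero_iff_ae_notMem, Measure.restrict_apply measurableSet_Ioo,
      inter_eq_left.2 (hsI k), Real.volume_Ioo, ENNReal.ofReal_eq_zero, sub_nonpos] at h2
    have : ρ / (k + 2 : ℝ) < ρ / (k + 1) := by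
      gcongr
      norm_num
    linarith
  let v : ℕ → StateSpace F b q := fun k => indicatorConstLp 2 measurableSet_Ioo (hfin k) η
  have hv0 : ∀ k, v k ≠ 0 := by
    intro k h0
    have h1 := norm_indicatorConstLp (p := 2) (hs := measurableSet_Ioo) (hμs := hfin k)
      (c := η) (by norm_num) (by norm_num)
    rw [show indicatorConstLp 2 measurableSet_Ioo (hfin k) η = 0 from h0, norm_zero] at h1
    have h2 : 0 < (radialMeasure b q).real (s k) := ENNReal.toReal_pos (hpos k) (hfin k)
    have := mul_pos (norm_pos_iff.2 hη) (Real.rpow_pos_of_pos h2 (1 / (2 : ℝ≥0∞).toReal))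
    exact absurd h1.symm this.ne'
  have hdisj : ∀ i j, i < j → Disjoint (s i) (s j) := by
    intro i j hij
    rw [Set.disjoint_left]
    intro r hi hj
    have : ρ / (j + 1 : ℝ) ≤ ρ / (i + 2) := by
      have : (i : ℝ) + 1 ≤ j := by exact_mod_cast hij
      exact div_le_div_of_nonneg_left hρ0.le (by positivity) (by linarith)
    linarith [hi.1, hj.2]
  have hort : ∀ i j, i ≠ j → inner ℂ (v i) (v j) = 0 := by
    intro i j hij
    have hd : Disjoint (s i) (s j) := by
      rcases lt_or_gt_of_ne hij with h | h
      · exact hdisj i j h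
      · exact (hdisj j i h).symm
    rw [L2.inner_def]
    refine integral_eq_zero_of_ae ?_
    filter_upwards [indicatorConstLp_coeFn (p := 2) (hs := measurableSet_Ioo) (hμs := hfin i)
      (c := η), indicatorConstLp_coeFn (p := 2) (hs := measurableSet_Ioo) (hμs := hfin j)
      (c := η)] with r h1 h2
    rw [h1, h2]
    by_cases hr : r ∈ s i
    · rw [indicator_of_notMem (Set.disjoint_left.1 hd hr), inner_zero_right]
      rfl
    · rw [indicator_of_notMem hr, inner_zero_left]
      rfl
  have hli : LinearIndependent ℂ v := linearIndependent_of_ne_zero_of_inner_eq_zero hv0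
    fun i j hij => hort i j hij
  exact not_finite_iff_infinite.2 (inferInstance : Infinite ℕ) hli.finite

end Density

/-! ### The radial Hamiltonian as a form operator -/

section RadialHamiltonian

variable {F : Type*} [NormedAddCommGroup F] [InnerProductSpace ℂ F] [CompleteSpace F]
  {A : {A : F →ₗ[ℂ] F // A.IsPositive}} {b : EReal} {w : ℝ≥0} {q : ℝ}

theorem denseRange_formToState (hq : 0 ≤ q) (hE : IsEmbedded A b w q) :
    DenseRange (formToState hE) := by
  rw [DenseRange, ← ContinuousLinearMap.coe_coe, ← LinearMap.coe_range,
    Submodule.dense_iff_topologicalClosure_eq_top, Submodule.topologicalClosure_eq_top_iff, eq_bot_iff]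
  intro χ hχ
  rw [Submodule.mem_orthogonal] at hχ
  refine eq_zero_of_forall_inner_toState hq χ fun φ => hχ _ ?_
  exact ⟨((EnergySpace.equiv A b w).symm φ : EnergySpace A b w), formToState_coe hE _⟩

variable {W : ℝ → ℝ} (hW : ContinuousOn W (Ioi 0)) {p s c₁ c₂ : ℝ}

/-- The relation is single valued: if ψ = 0, then χ is orthogonal to all test functions, hence zero.
Only then does it coincide with the graph of the partial map made from it. -/
theorem mem_graph_hamiltonian_iff (hq : 0 ≤ q) (ψ χ : StateSpace F b q) :
    (ψ, χ) ∈ (hamiltonian A b w W hW p q).graph ↔ (ψ, χ) ∈ hamiltonianGraph A b w W hW p q := by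
  rw [hamiltonian, Submodule.toLinearPMap_graph_eq]
  rintro ⟨ψ, χ⟩ h (rfl : ψ = 0)
  refine eq_zero_of_forall_inner_toState hq χ fun φ => ?_
  rw [← h.2 φ, inner_zero_right]

/-- On test functions the distributional equation is the form equation by the form identity, and
both sides are continuous in y, so it extends to the completion. -/
theorem isFormOperator_hamiltonian (hq : q = p + 1) (hq0 : 0 ≤ q)
    (hWeq : ∀ r, 0 < r → W r = w * r ^ 2 + c₁ * r ^ 2 + c₂ * r ^ s)
    (hE : IsEmbedded A b w q) (h3 : IsEmbedded A b w 3) (hs : IsEmbedded A b w (1 + s)) :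
    IsFormOperator (hamiltonian A b w W hW p q) (formToState hE) (formOp c₁ c₂ h3 hs) := by
  intro ψ χ
  rw [mem_graph_hamiltonian_iff hW hq0]
  have key : ∀ x, (∀ φ : testSpace F b, inner ℂ (hatOp A.1 W hW p b q φ) (formToState hE x) =
      inner ℂ (toState b q φ) χ) ↔
      ∀ y, inner ℂ y (formOp c₁ c₂ h3 hs x) = inner ℂ (formToState hE y) χ := by
    intro x
    have h1 : ∀ φ : EnergySpace A b w,
        inner ℂ (hatOp A.1 W hW p b q (EnergySpace.equiv A b w φ)) (formToState hE x) =
          inner ℂ (φ : FormDomain A b w) (formOp c₁ c₂ h3 hs x) := by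
      intro φ
      rw [inner_hatOp_formToState hW hq hWeq hE h3 hs, inner_formOp]
    have h2 : ∀ φ : EnergySpace A b w, formToState hE (φ : FormDomain A b w) =
        toState b q (EnergySpace.equiv A b w φ) := formToState_coe hE
    constructor
    · intro h y
      rw [← ContinuousLinearMap.adjoint_inner_right]
      congr 1
      apply eq_of_forall_inner_coe
      intro φ
      rw [← h1, h, ContinuousLinearMap.adjoint_inner_right, h2]
    · intro h φ
      have h3 := h (((EnergySpace.equiv A b w).symm φ : EnergySpace A b w) : FormDomain A b w)
      rwa [← h1, h2, LinearEquiv.apply_symm_apply] at h3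
  constructor
  · rintro ⟨⟨x, hx⟩, h⟩
    rw [mem_embedding_iff hE] at hx
    obtain rfl : formToState hE x = ψ := hx
    exact ⟨x, rfl, (key x).1 h⟩
  · rintro ⟨x, rfl, h⟩
    exact ⟨⟨x, (mem_embedding_iff hE _ _).2 rfl⟩, (key x).2 h⟩

/-- The conclusion of the spectral theorem for a radial Hamiltonian and the eigenvalue problem
`T ψ = z c ψ`. -/
theorem hamiltonian_spectral_theorem [FiniteDimensional ℂ F] [Nontrivial F] (hb : 0 < b)
    (hq : q = p + 1) (hq1 : 1 ≤ q)
    (hWeq : ∀ r, 0 < r → W r = w * r ^ 2 + c₁ * r ^ 2 + c₂ * r ^ s)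
    (hpt : PointBound A b w) (ht : TailBound A b w q)
    (hE : IsEmbedded A b w q) (h3 : IsEmbedded A b w 3) (hs : IsEmbedded A b w (1 + s))
    {ε C : ℝ} (hε : 0 < ε)
    (hco : ∀ φ : EnergySpace A b w, ε * ‖φ‖ ^ 2 ≤ ‖φ‖ ^ 2 + c₁ * ‖energyToState A b w 3 φ‖ ^ 2 +
      c₂ * ‖energyToState A b w (1 + s) φ‖ ^ 2 + C * ‖energyToState A b w q φ‖ ^ 2)
    {c : ℝ} (hc : 0 < c) :
    IsSelfAdjointOperator (hamiltonian A b w W hW p q) ∧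
      HasPurePointSpectrum (hamiltonian A b w W hW p q) ∧
      ∃ (Λ : ℕ → ℝ) (ψ : ℕ → StateSpace F b q) (x : ℕ → FormDomain A b w),
        Monotone Λ ∧ Tendsto Λ atTop atTop ∧ Orthonormal ℂ ψ ∧
        (∀ j, IsEigenSolution (hamiltonian A b w W hW p q) (Λ j * c) (ψ j)) ∧
        (∀ (z : ℂ) (χ : StateSpace F b q),
          IsEigenSolution (hamiltonian A b w W hW p q) (z * c) χ →
          χ ∈ Submodule.span ℂ (ψ '' {j | (Λ j : ℂ) = z})) ∧
        (∀ j, (x j, ψ j) ∈ embedding A b w q) ∧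
        (Submodule.span ℂ (range x)).topologicalClosure = ⊤ ∧
        (Submodule.span ℂ (range ψ)).topologicalClosure = ⊤ := by
  have hq0 : 0 ≤ q := zero_le_one.trans hq1
  -- Coercivity is a closed condition and passes from the test functions to the completion.
  have hco' : ∀ x : FormDomain A b w, ε * ‖x‖ ^ 2 ≤
      (inner ℂ (formOp c₁ c₂ h3 hs x) x).re + C * ‖formToState hE x‖ ^ 2 := by
    intro x
    rw [re_inner_formOp]
    induction x using UniformSpace.Completion.induction_on with
    | hp =>
      refine isClosed_le (by fun_prop) (by fun_prop)
    | ih φ =>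
      rw [formToState_coe, formToState_coe, formToState_coe, UniformSpace.Completion.norm_coe]
      exact hco φ
  obtain ⟨h1, h2, Λ, ψ, x, h4, h5, h6, h7, h8, h9, h10⟩ :=
    (isFormOperator_hamiltonian hW hq hq0 hWeq hE h3 hs).spectral_theorem
      (ht.isCompactOperator_formToState hpt hq1 hE) (formToState_injective hE h3)
      (denseRange_formToState hq0 hE) (formOp_isSymmetric h3 hs) hε hco'
      (not_finiteDimensional_stateSpace hq0 hb) hc
  exact ⟨h1, h2, Λ, ψ, x, h4, h5, h6, h7, h8, fun j => (mem_embedding_iff hE _ _).2 (h9 j), h10⟩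

end RadialHamiltonian

/-! ### Tail estimates and Ehrling's inequality -/

section Bounds

variable {F : Type*} [NormedAddCommGroup F] [InnerProductSpace ℂ F]
  {A : {A : F →ₗ[ℂ] F // A.IsPositive}} {b : EReal} {w : ℝ≥0} {q : ℝ}

theorem tailBound_of_lt_top {r₀ : ℝ} (hr₀ : 0 < r₀) : TailBound A (r₀ : EReal) w q := by
  intro ε hε
  refine ⟨r₀, hr₀, fun φ => ?_⟩
  have : interval (r₀ : EReal) ∩ Ici r₀ = ∅ := by
    ext r
    simp only [mem_inter_iff, mem_Ici, mem_empty_iff_false, iff_false, not_and, not_le]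
    exact fun h => EReal.coe_lt_coe_iff.1 h.2
  rw [this]
  simp only [Measure.restrict_empty, integral_zero_measure]
  positivity

theorem integrableOn_rpow_mul_sq (φ : EnergySpace A b w) (q : ℝ) :
    IntegrableOn (fun r => r ^ q * ‖toFun A b w φ r‖ ^ 2) (interval b) := by
  have h := (integrable_radialMeasure_iff (b := b) (q := q)).1
    (((memLp_two_iff_integrable_sq_norm (memLp_toFun (q := q) φ).1).1 (memLp_toFun φ)))
  simpa only [smul_eq_mul] using h

theorem integral_cube_le_norm_sq (hw : 1 ≤ w) (φ : EnergySpace A b w) :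
    ∫ r in interval b, r ^ (3 : ℝ) * ‖toFun A b w φ r‖ ^ 2 ≤ ‖φ‖ ^ 2 := by
  have h1 := integral_cube_mul_sq_le φ
  have e : ∫ r in interval b, r ^ (3 : ℝ) * ‖toFun A b w φ r‖ ^ 2 =
      ∫ t in interval b, t ^ 3 * ‖toFun A b w φ t‖ ^ 2 := by
    congr 1
    ext r
    rw [← Real.rpow_natCast]
    norm_num
  rw [e]
  refine le_trans (le_mul_of_one_le_left ?_ (by exact_mod_cast hw)) h1
  exact setIntegral_nonneg (isOpen_interval b).measurableSet fun t ht =>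
    mul_nonneg (pow_nonneg (pos_of_mem ht).le 3) (sq_nonneg _)

theorem norm_energyToState_three_le (hw : 1 ≤ w) (φ : EnergySpace A b w) :
    ‖energyToState A b w 3 φ‖ ^ 2 ≤ ‖φ‖ ^ 2 := by
  rw [norm_energyToState_sq]
  exact integral_cube_le_norm_sq hw φ

theorem isEmbedded_three_of_one_le (hw : 1 ≤ w) : IsEmbedded A b w 3 :=
  ⟨1, fun φ => by
    rw [one_mul]
    exact (abs_le_of_sq_le_sq' (norm_energyToState_three_le hw φ) (norm_nonneg _)).2⟩

/-- For r ≥ R one has r^q ≤ R^{-(3-q)} r³, and r³|φ|² is part of the energy; q < 3 makes the factor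
as small as desired. -/
theorem tailBound_of_one_le (hw : 1 ≤ w) (hq : q < 3) : TailBound A b w q := by
  intro ε hε
  obtain ⟨R, hR0, hR⟩ : ∃ R : ℝ, 0 < R ∧ R ^ (-(3 - q)) ≤ ε := by
    have h := (tendsto_rpow_neg_atTop (sub_pos.2 hq)).eventually (ge_mem_nhds hε)
    obtain ⟨R, h1, h2⟩ := (h.and (eventually_gt_atTop 0)).exists
    exact ⟨R, h2, h1⟩
  refine ⟨R, hR0, fun φ => ?_⟩
  have hI := (isOpen_interval b).measurableSet
  have h3 := integrableOn_rpow_mul_sq φ 3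
  have h3R : IntegrableOn (fun r => R ^ (-(3 - q)) * (r ^ (3 : ℝ) * ‖toFun A b w φ r‖ ^ 2))
      (interval b) := h3.const_mul _
  calc ∫ r in interval b ∩ Ici R, r ^ q * ‖toFun A b w φ r‖ ^ 2
      ≤ ∫ r in interval b ∩ Ici R, R ^ (-(3 - q)) * (r ^ (3 : ℝ) * ‖toFun A b w φ r‖ ^ 2) := by
        refine setIntegral_mono_on ((integrableOn_rpow_mul_sq φ q).mono_set inter_subset_left)
          (h3R.mono_set inter_subset_left) (hI.inter measurableSet_Ici) fun r hr => ?_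
        have hr0 := pos_of_mem hr.1
        rw [← mul_assoc]
        gcongr
        calc r ^ q = r ^ (-(3 - q)) * r ^ (3 : ℝ) := by
              rw [← Real.rpow_add hr0]
              congr 1
              ring
          _ ≤ R ^ (-(3 - q)) * r ^ (3 : ℝ) := by
              gcongr ?_ * _
              exact Real.rpow_le_rpow_of_nonpos hR0 hr.2 (by linarith)
    _ = R ^ (-(3 - q)) * ∫ r in interval b ∩ Ici R, r ^ (3 : ℝ) * ‖toFun A b w φ r‖ ^ 2 :=
        integral_const_mul _ _
    _ ≤ ε * ‖φ‖ ^ 2 := by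
        have h4 : ∫ r in interval b ∩ Ici R, r ^ (3 : ℝ) * ‖toFun A b w φ r‖ ^ 2 ≤
            ∫ r in interval b, r ^ (3 : ℝ) * ‖toFun A b w φ r‖ ^ 2 := by
          refine setIntegral_mono_set h3 ?_ inter_subset_left.eventuallyLE
          filter_upwards [ae_restrict_mem hI] with r hr
          have := pos_of_mem hr
          simp only [Pi.zero_apply]
          positivity
        refine mul_le_mul hR (h4.trans (integral_cube_le_norm_sq hw φ)) ?_ hε.le
        refine setIntegral_nonneg (hI.inter measurableSet_Ici) fun r hr => ?_
        have := pos_of_mem hr.1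
        positivity

/-- Ehrling's inequality for the embeddings of the energy space on a bounded interval. -/
theorem exists_norm_sq_le_add [CompleteSpace F] {r₀ s : ℝ} (hs0 : 0 ≤ s) (hs2 : s ≤ 2) {δ : ℝ}
    (hδ : 0 < δ) :
    ∃ C : ℝ, ∀ φ : EnergySpace A (r₀ : EReal) w, ‖energyToState A r₀ w (1 + s) φ‖ ^ 2 ≤
      δ * ‖φ‖ ^ 2 + C * ‖energyToState A r₀ w 3 φ‖ ^ 2 := by
  obtain ⟨C₀, hC₀, hb⟩ := pointBound_of_lt_top (A := A) (w := w) (r₀ := r₀) 1 one_pos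
  -- On (0, ρ) the pointwise bound and r^s ≤ 1 give at most ρC₀‖φ‖² ≤ δ‖φ‖²; for r ≥ ρ, r^{1+s} ≤
  -- ρ^{s-2} r³ because s ≤ 2. The summand 1 in C₀ + 1 keeps the quotient meaningful when C₀ = 0.
  set ρ := min 1 (δ / (C₀ + 1)) with hρ
  have hρ0 : 0 < ρ := lt_min one_pos (by positivity)
  refine ⟨ρ ^ (s - 2), fun φ => ?_⟩
  have hI := (isOpen_interval (r₀ : EReal)).measurableSet
  rw [norm_energyToState_sq, norm_energyToState_sq]
  have hi1 : Integrable ((Ioo 0 ρ).indicator fun _ : ℝ => C₀ * ‖φ‖ ^ 2) volume :=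
    (integrable_indicator_iff measurableSet_Ioo).2 (integrableOn_const (by simp))
  have hi2 := (integrableOn_rpow_mul_sq φ 3).const_mul (ρ ^ (s - 2))
  have h1 : ∫ r in interval (r₀ : EReal), r ^ (1 + s) * ‖toFun A r₀ w φ r‖ ^ 2 ≤
      ∫ r in interval (r₀ : EReal), ((Ioo 0 ρ).indicator (fun _ : ℝ => C₀ * ‖φ‖ ^ 2) r +
        ρ ^ (s - 2) * (r ^ (3 : ℝ) * ‖toFun A r₀ w φ r‖ ^ 2)) := by
    refine setIntegral_mono_on (integrableOn_rpow_mul_sq φ _) (hi1.integrableOn.add hi2) hI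
      fun r hr => ?_
    have hr0 := pos_of_mem hr
    by_cases hrρ : r < ρ
    · rw [indicator_of_mem (show r ∈ Ioo 0 ρ from ⟨hr0, hrρ⟩)]
      have hr1 : r < 1 := hrρ.trans_le (min_le_left _ _)
      have h2 : r ^ (1 + s) * ‖toFun A r₀ w φ r‖ ^ 2 ≤ C₀ * ‖φ‖ ^ 2 := by
        calc r ^ (1 + s) * ‖toFun A r₀ w φ r‖ ^ 2 ≤ r ^ (1 + s) * (C₀ / r * ‖φ‖ ^ 2) := by
              gcongr
              exact hb φ r hr0 hr1
          _ = r ^ s * (C₀ * ‖φ‖ ^ 2) := by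
              rw [Real.rpow_add hr0, Real.rpow_one]
              field_simp
          _ ≤ 1 * (C₀ * ‖φ‖ ^ 2) := by
              gcongr
              exact Real.rpow_le_one hr0.le hr1.le hs0
          _ = _ := one_mul _
      refine h2.trans (le_add_of_nonneg_right ?_)
      positivity
    · rw [indicator_of_notMem (show r ∉ Ioo 0 ρ from fun h => hrρ h.2), zero_add, ← mul_assoc]
      gcongr
      calc r ^ (1 + s) = r ^ (s - 2) * r ^ (3 : ℝ) := by
            rw [← Real.rpow_add hr0]
            congr 1
            ring
        _ ≤ ρ ^ (s - 2) * r ^ (3 : ℝ) := by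
            gcongr ?_ * _
            exact Real.rpow_le_rpow_of_nonpos hρ0 (not_lt.1 hrρ) (by linarith)
  refine h1.trans ?_
  rw [integral_add hi1.integrableOn hi2, integral_const_mul]
  gcongr
  calc ∫ r in interval (r₀ : EReal), (Ioo 0 ρ).indicator (fun _ : ℝ => C₀ * ‖φ‖ ^ 2) r
      ≤ ∫ r, (Ioo 0 ρ).indicator (fun _ : ℝ => C₀ * ‖φ‖ ^ 2) r :=
        setIntegral_le_integral hi1 (Eventually.of_forall fun r =>
          indicator_nonneg (fun _ _ => by positivity) r)
    _ = ρ * (C₀ * ‖φ‖ ^ 2) := by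
        rw [integral_indicator measurableSet_Ioo, setIntegral_const]
        simp [hρ0.le]
    _ ≤ δ / (C₀ + 1) * (C₀ * ‖φ‖ ^ 2) := by
        gcongr
        exact min_le_right _ _
    _ ≤ δ / (C₀ + 1) * ((C₀ + 1) * ‖φ‖ ^ 2) := by
        gcongr
        linarith
    _ = δ * ‖φ‖ ^ 2 := by
        field_simp

end Bounds

/-! ### The bounded interval and the half line -/

section Cases

variable {F : Type*} [NormedAddCommGroup F] [InnerProductSpace ℂ F] [CompleteSpace F]
  [FiniteDimensional ℂ F] [Nontrivial F] (A : {A : F →ₗ[ℂ] F // A.IsPositive})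
  {W : ℝ → ℝ} (hW : ContinuousOn W (Ioi 0)) {p q s c₁ c₂ : ℝ} {c : ℝ}

/-- The state space has the weight r³, so the c₁ term is absorbed by C‖·‖² whatever its sign.
Ehrling's inequality bounds the c₂ term by half the energy plus another multiple of this norm; δ is
chosen with |c₂|δ ≤ 1/2. -/
theorem hamiltonian_spectral_theorem_of_lt_top {r₀ : ℝ} (hr₀ : 0 < r₀) (hp : p = 2) (hq : q = 3)
    (hs0 : 0 ≤ s) (hs2 : s ≤ 2) (hWeq : ∀ r, 0 < r → W r = c₁ * r ^ 2 + c₂ * r ^ s) (hc : 0 < c) :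
    IsSelfAdjointOperator (hamiltonian A r₀ 0 W hW p q) ∧
      HasPurePointSpectrum (hamiltonian A r₀ 0 W hW p q) ∧
      ∃ (Λ : ℕ → ℝ) (ψ : ℕ → StateSpace F r₀ q) (x : ℕ → FormDomain A r₀ 0),
        Monotone Λ ∧ Tendsto Λ atTop atTop ∧ Orthonormal ℂ ψ ∧
        (∀ j, IsEigenSolution (hamiltonian A r₀ 0 W hW p q) (Λ j * c) (ψ j)) ∧
        (∀ (z : ℂ) (χ : StateSpace F r₀ q),
          IsEigenSolution (hamiltonian A r₀ 0 W hW p q) (z * c) χ →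
          χ ∈ Submodule.span ℂ (ψ '' {j | (Λ j : ℂ) = z})) ∧
        (∀ j, (x j, ψ j) ∈ embedding A r₀ 0 q) ∧
        (Submodule.span ℂ (range x)).topologicalClosure = ⊤ ∧
        (Submodule.span ℂ (range ψ)).topologicalClosure = ⊤ := by
  subst hp hq
  have hpt := pointBound_of_lt_top (A := A) (w := 0) (r₀ := r₀)
  have h3 : IsEmbedded A (r₀ : EReal) 0 3 :=
    (tailBound_of_lt_top hr₀).isEmbedded hpt (by norm_num)
  have hs : IsEmbedded A (r₀ : EReal) 0 (1 + s) :=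
    (tailBound_of_lt_top hr₀).isEmbedded hpt (by linarith)
  obtain ⟨C, hC⟩ := exists_norm_sq_le_add (A := A) (w := 0) (r₀ := r₀) hs0 hs2
    (δ := 1 / (2 * (|c₂| + 1))) (by positivity)
  refine hamiltonian_spectral_theorem hW (c₁ := c₁) (c₂ := c₂) (s := s) (ε := 1 / 2) (C := |c₁| + |c₂| * C)
    (by exact_mod_cast hr₀) (by norm_num) (by norm_num)
    (fun r hr => by rw [hWeq r hr]; simp) hpt (tailBound_of_lt_top hr₀) h3 h3 hs
    (by norm_num) (fun φ => ?_) hc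
  have h1 := mul_le_mul_of_nonneg_left (hC φ) (abs_nonneg c₂)
  have h2 := mul_le_mul_of_nonneg_right (neg_abs_le c₂)
    (sq_nonneg ‖energyToState A r₀ 0 (1 + s) φ‖)
  have h4 := mul_le_mul_of_nonneg_right (neg_abs_le c₁)
    (sq_nonneg ‖energyToState A r₀ 0 3 φ‖)
  have h5 : |c₂| * (1 / (2 * (|c₂| + 1)) * ‖φ‖ ^ 2) ≤ 1 / 2 * ‖φ‖ ^ 2 := by
    rw [← mul_assoc]
    gcongr
    rw [mul_one_div, div_le_div_iff₀ (by positivity) (by norm_num)]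
    linarith [abs_nonneg c₂]
  linarith

/-- The norm with weight r³ is at most the energy norm, so the form is at least min(1, 1 + c₁) times
the energy and C = 0 suffices. The condition p < 2 is q < 3, which the tail bound needs. -/
theorem hamiltonian_spectral_theorem_of_top (hq : q = p + 1) (hp0 : 0 ≤ p) (hp2 : p < 2)
    (hc₁ : -1 < c₁) (hWeq : ∀ r, 0 < r → W r = r ^ 2 + c₁ * r ^ 2) (hc : 0 < c) :
    IsSelfAdjointOperator (hamiltonian A ⊤ 1 W hW p q) ∧
      HasPurePointSpectrum (hamiltonian A ⊤ 1 W hW p q) ∧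
      ∃ (Λ : ℕ → ℝ) (ψ : ℕ → StateSpace F ⊤ q) (x : ℕ → FormDomain A ⊤ 1),
        Monotone Λ ∧ Tendsto Λ atTop atTop ∧ Orthonormal ℂ ψ ∧
        (∀ j, IsEigenSolution (hamiltonian A ⊤ 1 W hW p q) (Λ j * c) (ψ j)) ∧
        (∀ (z : ℂ) (χ : StateSpace F ⊤ q),
          IsEigenSolution (hamiltonian A ⊤ 1 W hW p q) (z * c) χ →
          χ ∈ Submodule.span ℂ (ψ '' {j | (Λ j : ℂ) = z})) ∧
        (∀ j, (x j, ψ j) ∈ embedding A ⊤ 1 q) ∧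
        (Submodule.span ℂ (range x)).topologicalClosure = ⊤ ∧
        (Submodule.span ℂ (range ψ)).topologicalClosure = ⊤ := by
  have hpt := pointBound_of_one_le (A := A) (b := ⊤) le_rfl
  have h3 : IsEmbedded A ⊤ 1 3 := isEmbedded_three_of_one_le le_rfl
  have hs : IsEmbedded A ⊤ 1 (1 + 2) := by
    rwa [show (1 : ℝ) + 2 = 3 by norm_num]
  have ht : TailBound A ⊤ 1 q := tailBound_of_one_le le_rfl (by linarith)
  refine hamiltonian_spectral_theorem hW (ε := min 1 (1 + c₁)) (C := 0) (c₁ := c₁) (c₂ := 0)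
    (s := 2)
    EReal.zero_lt_top hq (by linarith)
    (fun r hr => by rw [hWeq r hr]; simp) hpt ht (ht.isEmbedded hpt (by linarith)) h3 hs
    (lt_min one_pos (by linarith)) (fun φ => ?_) hc
  have h1 := norm_energyToState_three_le (A := A) (b := ⊤) le_rfl φ
  have h0 := sq_nonneg ‖energyToState A ⊤ 1 3 φ‖
  have h2 := sq_nonneg ‖φ‖
  rcases le_total 0 c₁ with h | h
  · have h4 := mul_nonneg h h0
    have h5 := mul_le_mul_of_nonneg_right (min_le_left 1 (1 + c₁)) h2
    linarith
  · have h4 := mul_le_mul_of_nonpos_left h1 h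
    have h5 := mul_le_mul_of_nonneg_right (min_le_right 1 (1 + c₁)) h2
    linarith

end Cases

/-! ### A Poincaré inequality on convex sets -/

section Poincare

theorem lintegral_pow_two_le {α : Type*} [MeasurableSpace α] {μ : Measure α}
    [IsProbabilityMeasure μ] {f : α → ℝ≥0∞} (hf : AEMeasurable f μ) :
    (∫⁻ a, f a ∂μ) ^ 2 ≤ ∫⁻ a, f a ^ 2 ∂μ := by
  have h := ENNReal.lintegral_mul_le_Lp_mul_Lq μ Real.HolderConjugate.two_two hf
    (aemeasurable_const (b := (1 : ℝ≥0∞)))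
  simp only [Pi.mul_apply, mul_one, ENNReal.one_rpow, lintegral_const, measure_univ] at h
  calc (∫⁻ a, f a ∂μ) ^ 2 ≤ ((∫⁻ a, f a ^ (2 : ℝ) ∂μ) ^ (1 / (2 : ℝ))) ^ 2 := by gcongr
    _ = ∫⁻ a, f a ^ 2 ∂μ := by
        rw [← ENNReal.rpow_natCast, ← ENNReal.rpow_mul]
        simp

/-- The mean, here 0, minimizes the mean square deviation. -/
theorem lintegral_enorm_sq_le_of_integral_eq_zero {α : Type*} [MeasurableSpace α] {μ : Measure α}
    [IsFiniteMeasure μ] {g : α → ℂ} (hg : MemLp g 2 μ) (h0 : ∫ x, g x ∂μ = 0) (c : ℂ) :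
    ∫⁻ x, ‖g x‖ₑ ^ 2 ∂μ ≤ ∫⁻ x, ‖g x - c‖ₑ ^ 2 ∂μ := by
  have hgc : MemLp (fun x => g x - c) 2 μ := hg.sub (memLp_const c)
  have e (f : α → ℂ) (hf : MemLp f 2 μ) :
      ∫⁻ x, ‖f x‖ₑ ^ 2 ∂μ = ENNReal.ofReal (∫ x, ‖f x‖ ^ 2 ∂μ) := by
    rw [ofReal_integral_eq_lintegral_ofReal (by simpa using hf.integrable_norm_pow (by simp))
      (ae_of_all _ fun x => by positivity)]
    simp [ENNReal.ofReal_pow]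
  rw [e g hg, e _ hgc]
  apply ENNReal.ofReal_le_ofReal
  have h1 : Integrable g μ := hg.integrable (by norm_num)
  have h2 : Integrable (fun x => ‖g x‖ ^ 2) μ := by simpa using hg.integrable_norm_pow (by simp)
  have h3 : Integrable (fun x => 2 * (g x * conj c).re) μ := (h1.mul_const _).re.const_mul 2
  have h4 : ∫ x, 2 * (g x * conj c).re ∂μ = 0 := by
    rw [integral_const_mul]
    have : ∫ x, (g x * conj c).re ∂μ = (∫ x, g x * conj c ∂μ).re := integral_re (h1.mul_const _)
    rw [this, integral_mul_const, h0]
    simp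
  have h5 : ∀ x, ‖g x - c‖ ^ 2 = ‖g x‖ ^ 2 - 2 * (g x * conj c).re + ‖c‖ ^ 2 := by
    intro x
    rw [Complex.sq_norm, Complex.sq_norm, Complex.sq_norm, Complex.normSq_sub]
    ring
  simp only [h5]
  have h6 : ∫ x, (‖g x‖ ^ 2 - 2 * (g x * conj c).re + ‖c‖ ^ 2) ∂μ =
      ∫ x, (‖g x‖ ^ 2 - 2 * (g x * conj c).re) ∂μ + ∫ _, ‖c‖ ^ 2 ∂μ :=
    integral_add (h2.sub h3) (integrable_const _)
  rw [h6, integral_sub h2 h3, h4]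
  simp only [sub_zero, le_add_iff_nonneg_right]
  exact integral_nonneg fun _ => by positivity

variable {E : Type*} [NormedAddCommGroup E] [NormedSpace ℝ E]

/-- The fundamental theorem of calculus along the segment from y to x, then Cauchy–Schwarz in t. -/
theorem enorm_sub_sq_le_lintegral_segment {B Q : Set E} (hB : IsOpen B) {g : E → ℂ}
    (hg : ContDiffOn ℝ 1 g B) (hQ : Convex ℝ Q) (hQB : Q ⊆ B) {x y : E} (hx : x ∈ Q)
    (hy : y ∈ Q) :
    ‖g x - g y‖ₑ ^ 2 ≤ edist x y ^ 2 *
      ∫⁻ t in Icc (0 : ℝ) 1, ‖fderiv ℝ g (y + t • (x - y))‖ₑ ^ 2 := by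
  have hmem : ∀ t ∈ Icc (0 : ℝ) 1, y + t • (x - y) ∈ B := fun t ht =>
    hQB (hQ.add_smul_sub_mem hy hx ht)
  have hline : Continuous fun t : ℝ => y + t • (x - y) := by fun_prop
  have hcont : ContinuousOn (fun t : ℝ => fderiv ℝ g (y + t • (x - y))) (Icc 0 1) :=
    (hg.continuousOn_fderiv_of_isOpen hB le_rfl).comp hline.continuousOn hmem
  have hderiv : ∀ t ∈ uIcc (0 : ℝ) 1, HasDerivAt (fun t : ℝ => g (y + t • (x - y)))
      (fderiv ℝ g (y + t • (x - y)) (x - y)) t := by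
    intro t ht
    rw [uIcc_of_le zero_le_one] at ht
    have h1 : HasFDerivAt g (fderiv ℝ g (y + t • (x - y))) (y + t • (x - y)) :=
      ((hg.contDiffAt (hB.mem_nhds (hmem t ht))).differentiableAt one_ne_zero).hasFDerivAt
    have h2 : HasDerivAt (fun t : ℝ => y + t • (x - y)) (x - y) t := by
      simpa using ((hasDerivAt_id t).smul_const (x - y)).const_add y
    exact h1.comp_hasDerivAt t h2
  have hcont' : ContinuousOn (fun t : ℝ => fderiv ℝ g (y + t • (x - y)) (x - y)) (Icc 0 1) :=
    hcont.clm_apply continuousOn_const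
  have hint : ∫ t in (0 : ℝ)..1, fderiv ℝ g (y + t • (x - y)) (x - y) = g x - g y := by
    rw [intervalIntegral.integral_eq_sub_of_hasDerivAt hderiv]
    · simp
    · rw [intervalIntegrable_iff_integrableOn_Icc_of_le zero_le_one]
      exact hcont'.integrableOn_compact isCompact_Icc
  have hprob : IsProbabilityMeasure (volume.restrict (Icc (0 : ℝ) 1)) := ⟨by simp⟩
  rw [intervalIntegral.integral_of_le zero_le_one, ← integral_Icc_eq_integral_Ioc] at hint
  calc ‖g x - g y‖ₑ ^ 2
      ≤ (∫⁻ t in Icc (0 : ℝ) 1, ‖fderiv ℝ g (y + t • (x - y)) (x - y)‖ₑ) ^ 2 := by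
        rw [← hint]
        gcongr
        exact enorm_integral_le_lintegral_enorm _
    _ ≤ ∫⁻ t in Icc (0 : ℝ) 1, ‖fderiv ℝ g (y + t • (x - y)) (x - y)‖ₑ ^ 2 :=
        lintegral_pow_two_le (hcont'.aestronglyMeasurable measurableSet_Icc).enorm
    _ ≤ ∫⁻ t in Icc (0 : ℝ) 1, edist x y ^ 2 * ‖fderiv ℝ g (y + t • (x - y))‖ₑ ^ 2 := by
        gcongr with t
        rw [edist_eq_enorm_sub, ← mul_pow, mul_comm]
        gcongr
        exact ContinuousLinearMap.le_opENorm _ _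
    _ = _ := by
        rw [lintegral_const_mul']
        exact ENNReal.pow_ne_top (edist_ne_top _ _)

variable [FiniteDimensional ℝ E] [MeasurableSpace E] [BorelSpace E] {μ : Measure E}
  [μ.IsAddHaarMeasure]

/-- The homothety x ↦ y + t(x - y) maps the convex set `Q` into itself, and its inverse Jacobian
t^{-dim} is at most 2^{dim} for t ≥ 1/2. -/
theorem lintegral_comp_segment_le {Q : Set E} (hQ : Convex ℝ Q) (hQm : MeasurableSet Q)
    {h : E → ℝ≥0∞} (hh : Measurable h) {y : E} (hy : y ∈ Q) {t : ℝ} (ht : t ∈ Icc (1 / 2 : ℝ) 1) :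
    ∫⁻ x in Q, h (y + t • (x - y)) ∂μ ≤ 2 ^ Module.finrank ℝ E * ∫⁻ z in Q, h z ∂μ := by
  have ht0 : 0 < t := by linarith [ht.1]
  have key : ∀ k : E → ℝ≥0∞, Measurable k → ∫⁻ x, k (y + t • (x - y)) ∂μ =
      ENNReal.ofReal |(t ^ Module.finrank ℝ E)⁻¹| * ∫⁻ x, k x ∂μ := by
    intro k hk
    have h1 : ∫⁻ x, k (t • x) ∂μ = ENNReal.ofReal |(t ^ Module.finrank ℝ E)⁻¹| * ∫⁻ x, k x ∂μ := by
      rw [← lintegral_map hk (measurable_const_smul t), Measure.map_addHaar_smul μ ht0.ne',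
        lintegral_smul_measure, smul_eq_mul]
    rw [← h1, ← lintegral_add_right_eq_self (fun x => k (t • x)) (t⁻¹ • (y - t • y))]
    congr 1
    ext x
    rw [smul_add, smul_inv_smul₀ ht0.ne']
    congr 1
    module
  have hc : ENNReal.ofReal |(t ^ Module.finrank ℝ E)⁻¹| ≤ 2 ^ Module.finrank ℝ E := by
    rw [abs_of_nonneg (by positivity), ← inv_pow, ENNReal.ofReal_pow (by positivity)]
    gcongr
    rw [← ENNReal.ofReal_ofNat]
    apply ENNReal.ofReal_le_ofReal
    rw [inv_le_comm₀ ht0 two_pos]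
    linarith [ht.1]
  calc ∫⁻ x in Q, h (y + t • (x - y)) ∂μ
      ≤ ∫⁻ x in Q, Q.indicator h (y + t • (x - y)) ∂μ := by
        refine setLIntegral_mono' hQm fun x hx => ?_
        rw [indicator_of_mem (hQ.add_smul_sub_mem hy hx ⟨ht0.le, ht.2⟩)]
    _ ≤ ∫⁻ x, Q.indicator h (y + t • (x - y)) ∂μ := setLIntegral_le_lintegral _ _
    _ ≤ 2 ^ Module.finrank ℝ E * ∫⁻ x, Q.indicator h x ∂μ := by
        rw [key _ (hh.indicator hQm)]
        gcongr
    _ = _ := by rw [lintegral_indicator hQm]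

/-- The Jacobian blows up as t → 0. For t ≤ 1/2 the roles of x and y are exchanged, which replaces t
by 1 - t. -/
theorem lintegral_lintegral_comp_segment_le {Q : Set E} (hQ : Convex ℝ Q) (hQm : MeasurableSet Q)
    {h : E → ℝ≥0∞} (hh : Measurable h) {t : ℝ} (ht : t ∈ Icc (0 : ℝ) 1) :
    ∫⁻ y in Q, ∫⁻ x in Q, h (y + t • (x - y)) ∂μ ∂μ ≤
      2 ^ Module.finrank ℝ E * (∫⁻ z in Q, h z ∂μ) * μ Q := by
  have key : ∀ t ∈ Icc (1 / 2 : ℝ) 1, ∫⁻ y in Q, ∫⁻ x in Q, h (y + t • (x - y)) ∂μ ∂μ ≤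
      2 ^ Module.finrank ℝ E * (∫⁻ z in Q, h z ∂μ) * μ Q := by
    intro t ht
    rw [← setLIntegral_const]
    exact setLIntegral_mono' hQm fun y hy => lintegral_comp_segment_le hQ hQm hh hy ht
  rcases le_total (1 / 2) t with h1 | h1
  · exact key t ⟨h1, ht.2⟩
  · have hm : Measurable (Function.uncurry fun y x : E => h (y + t • (x - y))) := by
      unfold Function.uncurry
      exact hh.comp (by fun_prop)
    rw [lintegral_lintegral_swap hm.aemeasurable]
    have e : ∀ x y : E, y + t • (x - y) = x + (1 - t) • (y - x) := fun x y => by module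
    simp only [e]
    exact key (1 - t) ⟨by linarith, by linarith [ht.1]⟩

/-- Multiplied by μ(Q), the left side is at most the double integral of |g(x) - g(y)|², since g has
mean zero. The segment estimate and an exchange of the integrals leave, for each t, a double
integral over `Q`. -/
theorem lintegral_enorm_sq_le_of_convex {B Q : Set E} (hB : IsOpen B) {g : E → ℂ}
    (hg : ContDiffOn ℝ 1 g B) (hQ : Convex ℝ Q) (hQm : MeasurableSet Q) (hQB : Q ⊆ B)
    {d : ℝ≥0∞} (hd : Metric.ediam Q ≤ d) (hgQ : MemLp g 2 (μ.restrict Q)) (hμ : μ Q ≠ ⊤)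
    (h0 : ∫ x in Q, g x ∂μ = 0) :
    ∫⁻ x in Q, ‖g x‖ₑ ^ 2 ∂μ ≤
      d ^ 2 * 2 ^ Module.finrank ℝ E * ∫⁻ x in Q, ‖fderiv ℝ g x‖ₑ ^ 2 ∂μ := by
  have hfin : IsFiniteMeasure (μ.restrict Q) := ⟨by simpa using hμ.lt_top⟩
  rcases eq_or_ne (μ Q) 0 with hQ0 | hQ0
  · simp [Measure.restrict_eq_zero.2 hQ0]
  set h : E → ℝ≥0∞ := fun z => ‖fderiv ℝ g z‖ₑ ^ 2 with hh_def
  have hh : Measurable h := (measurable_fderiv ℝ g).enorm.pow_const 2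
  rw [← ENNReal.mul_le_mul_iff_left hQ0 hμ]
  calc (∫⁻ x in Q, ‖g x‖ₑ ^ 2 ∂μ) * μ Q
      = ∫⁻ _ in Q, (∫⁻ x in Q, ‖g x‖ₑ ^ 2 ∂μ) ∂μ := by rw [setLIntegral_const]
    _ ≤ ∫⁻ y in Q, ∫⁻ x in Q, ‖g x - g y‖ₑ ^ 2 ∂μ ∂μ :=
        lintegral_mono fun y => lintegral_enorm_sq_le_of_integral_eq_zero hgQ h0 (g y)
    _ ≤ ∫⁻ y in Q, ∫⁻ x in Q, d ^ 2 * (∫⁻ t in Icc (0 : ℝ) 1, h (y + t • (x - y))) ∂μ ∂μ := by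
        refine setLIntegral_mono' hQm fun y hy => setLIntegral_mono' hQm fun x hx => ?_
        refine (enorm_sub_sq_le_lintegral_segment hB hg hQ hQB hx hy).trans ?_
        gcongr
        exact (Metric.edist_le_ediam_of_mem hx hy).trans hd
    _ = d ^ 2 * ∫⁻ t in Icc (0 : ℝ) 1, ∫⁻ y in Q, ∫⁻ x in Q, h (y + t • (x - y)) ∂μ ∂μ := by
        have hm1 : Measurable fun z : E × ℝ => ∫⁻ x in Q, h (z.1 + z.2 • (x - z.1)) ∂μ :=
          Measurable.lintegral_prod_right'
            (f := fun z : (E × ℝ) × E => h (z.1.1 + z.1.2 • (z.2 - z.1.1)))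
            (hh.comp (by fun_prop))
        have e : ∀ y, ∫⁻ x in Q, d ^ 2 * (∫⁻ t in Icc (0 : ℝ) 1, h (y + t • (x - y))) ∂μ =
            d ^ 2 * ∫⁻ t in Icc (0 : ℝ) 1, ∫⁻ x in Q, h (y + t • (x - y)) ∂μ := by
          intro y
          have hm2 : Measurable fun z : E × ℝ => h (y + z.2 • (z.1 - y)) :=
            hh.comp (by fun_prop)
          rw [lintegral_const_mul _ hm2.lintegral_prod_right',
            lintegral_lintegral_swap (f := fun x t => h (y + t • (x - y))) hm2.aemeasurable]
        simp only [e]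
        rw [lintegral_const_mul _ hm1.lintegral_prod_right', lintegral_lintegral_swap
          (f := fun y t => ∫⁻ x in Q, h (y + t • (x - y)) ∂μ) hm1.aemeasurable]
    _ ≤ d ^ 2 * ∫⁻ t in Icc (0 : ℝ) 1, 2 ^ Module.finrank ℝ E * (∫⁻ z in Q, h z ∂μ) * μ Q := by
        refine mul_le_mul_right ?_ _
        exact setLIntegral_mono' measurableSet_Icc fun t ht =>
          lintegral_lintegral_comp_segment_le hQ hQm hh ht
    _ = _ := by
        rw [setLIntegral_const]
        simp only [Real.volume_Icc, sub_zero, ENNReal.ofReal_one, mul_one, mul_assoc]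

/-- Half open cubes of side δ in linear coordinates. If the inverse coordinates are K-Lipschitz, δ =
d/(K + 1) keeps the diameters below d; boundedness of the coordinates leaves finitely many cubes. -/
theorem exists_cells {B : Set E} (hB : Bornology.IsBounded B) {d : ℝ} (hd : 0 < d) :
    ∃ (ι : Type) (_ : Finite ι) (Q : ι → Set E), (∀ i, MeasurableSet (Q i)) ∧
      (∀ i, Convex ℝ (Q i)) ∧ (∀ i, Metric.ediam (Q i) ≤ ENNReal.ofReal d) ∧
      Pairwise (Function.onFun Disjoint Q) ∧ B ⊆ ⋃ i, Q i := by
  let φ : E ≃L[ℝ] (Fin (Module.finrank ℝ E) → ℝ) := (Module.finBasis ℝ E).equivFunL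
  obtain ⟨K, hK⟩ : ∃ K, LipschitzWith K φ.symm := ⟨_, φ.symm.lipschitz⟩
  obtain ⟨L, hL⟩ : ∃ L, LipschitzWith L φ := ⟨_, φ.lipschitz⟩
  obtain ⟨R, hR⟩ := (hL.isBounded_image hB).exists_norm_le
  set δ : ℝ := d / (K + 1)
  have hδ : 0 < δ := by positivity
  have hcell : ∀ (x : ℝ) (k : ℤ), ⌊x / δ⌋ = k ↔ x ∈ Ico (k * δ) ((k + 1) * δ) := fun x k => by
    rw [Int.floor_eq_iff, le_div_iff₀ hδ, div_lt_iff₀ hδ, mem_Ico]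
  have hpre : ∀ k : Fin (Module.finrank ℝ E) → ℤ, {x : E | ∀ i, ⌊φ x i / δ⌋ = k i} =
      φ ⁻¹' univ.pi fun i => Ico (k i * δ) ((k i + 1) * δ) := fun k => by
    ext x
    simp only [hcell, mem_preimage, mem_univ_pi]
    rfl
  refine ⟨Icc (fun _ : Fin (Module.finrank ℝ E) => ⌊-R / δ⌋) (fun _ => ⌊R / δ⌋), toFinite _,
    fun k => {x | ∀ i, ⌊φ x i / δ⌋ = k.1 i}, fun k => ?_,
    fun k => ?_, fun k => ?_, fun k l hkl => ?_, fun x hx => ?_⟩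
  · beta_reduce
    rw [hpre]
    exact φ.continuous.measurable (MeasurableSet.univ_pi fun i => measurableSet_Ico)
  · beta_reduce
    rw [hpre]
    exact (convex_pi fun i _ => convex_Ico _ _).linear_preimage φ.toLinearEquiv.toLinearMap
  · refine Metric.ediam_le fun x hx y hy => ?_
    rw [edist_dist]
    apply ENNReal.ofReal_le_ofReal
    calc dist x y = dist (φ.symm (φ x)) (φ.symm (φ y)) := by simp
      _ ≤ K * dist (φ x) (φ y) := hK.dist_le_mul _ _
      _ ≤ K * δ := by
          gcongr
          rw [dist_pi_le_iff hδ.le]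
          intro i
          have h1 := (hcell _ _).1 (hx i)
          have h2 := (hcell _ _).1 (hy i)
          rw [Real.dist_eq, abs_le]
          constructor <;> linarith [h1.1, h1.2, h2.1, h2.2]
      _ ≤ d := by
          rw [mul_div_assoc', div_le_iff₀ (by positivity)]
          nlinarith [K.2]
  · rw [Function.onFun, disjoint_left]
    intro x hx hy
    exact hkl (Subtype.ext (funext fun i => (hx i).symm.trans (hy i)))
  · have h : ∀ i, |φ x i| ≤ R := fun i =>
      (norm_le_pi_norm (φ x) i).trans (hR _ (mem_image_of_mem _ hx))
    rw [mem_iUnion]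
    refine ⟨⟨fun i => ⌊φ x i / δ⌋, fun i => ?_, fun i => ?_⟩, fun i => rfl⟩
    · exact Int.floor_le_floor (by gcongr; exact (abs_le.1 (h i)).1)
    · exact Int.floor_le_floor (by gcongr; exact (abs_le.1 (h i)).2)

/-- Cells of diameter √(ε/2^{dim}) have Poincaré constant ε, and intersecting them with the convex
set `B` keeps them convex. The cells do not depend on g, so only finitely many linear conditions are
imposed. -/
theorem exists_forall_lintegral_enorm_sq_le {B : Set E} (hB : IsOpen B) (hBc : Convex ℝ B)
    (hBb : Bornology.IsBounded B) {ε : ℝ} (hε : 0 < ε) :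
    ∃ (ι : Type) (_ : Finite ι) (Q : ι → Set E), (∀ i, MeasurableSet (Q i)) ∧ (∀ i, Q i ⊆ B) ∧
      ∀ g : E → ℂ, ContDiffOn ℝ 1 g B → MemLp g 2 (μ.restrict B) →
        (∀ i, ∫ x in Q i, g x ∂μ = 0) →
        ∫⁻ x in B, ‖g x‖ₑ ^ 2 ∂μ ≤ ENNReal.ofReal ε * ∫⁻ x in B, ‖fderiv ℝ g x‖ₑ ^ 2 ∂μ := by
  obtain ⟨ι, hι, Q, hQm, hQc, hQd, hQdisj, hQB⟩ := exists_cells hBb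
    (d := √(ε / 2 ^ Module.finrank ℝ E)) (by positivity)
  have hm : ∀ i, MeasurableSet (Q i ∩ B) := fun i => (hQm i).inter hB.measurableSet
  have hd : Pairwise (Function.onFun Disjoint fun i => Q i ∩ B) := fun i j hij =>
    (hQdisj hij).mono inter_subset_left inter_subset_left
  have hU : ⋃ i, Q i ∩ B = B := by rw [← iUnion_inter, inter_eq_right.2 hQB]
  have hfin : μ B ≠ ⊤ := hBb.measure_lt_top.ne
  refine ⟨ι, hι, fun i => Q i ∩ B, hm, fun i => inter_subset_right, fun g hg hg2 h0 => ?_⟩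
  have e : ∀ f : E → ℝ≥0∞, ∫⁻ x in B, f x ∂μ = ∑' i, ∫⁻ x in Q i ∩ B, f x ∂μ := fun f => by
    conv_lhs => rw [← hU]
    exact lintegral_iUnion hm hd f
  rw [e, e, ← ENNReal.tsum_mul_left]
  refine ENNReal.tsum_le_tsum fun i => ?_
  refine (lintegral_enorm_sq_le_of_convex hB hg ((hQc i).inter hBc) (hm i) inter_subset_right
    ((Metric.ediam_mono inter_subset_left).trans (hQd i))
    (hg2.mono_measure (Measure.restrict_mono inter_subset_right le_rfl))
    (measure_ne_top_of_subset inter_subset_right hfin) (h0 i)).trans_eq ?_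
  congr 1
  rw [← ENNReal.ofReal_pow (by positivity), Real.sq_sqrt (by positivity),
    ENNReal.ofReal_div_of_pos (by positivity), ENNReal.ofReal_pow (by norm_num),
    ENNReal.ofReal_ofNat]
  exact ENNReal.div_mul_cancel (by positivity) (by finiteness)

end Poincare

/-! ### Charts of a Riemannian manifold are locally bi-Lipschitz -/

section Charts

open Manifold

variable {E : Type*} [NormedAddCommGroup E] [NormedSpace ℝ E] {H : Type*} [TopologicalSpace H]
  (I : ModelWithCorners ℝ E H) {M : Type*} [TopologicalSpace M] [ChartedSpace H M]
  [RiemannianBundle (fun x : M => TangentSpace I x)]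
  [IsManifold I 1 M] [IsContinuousRiemannianBundle E (fun x : M => TangentSpace I x)]

/-- The differential of the chart is the trivialization of the tangent bundle, and this is locally
bounded for a continuous metric. -/
theorem eventually_enorm_mfderiv_extChartAt_le (x : M) :
    ∃ C : ℝ≥0, ∀ᶠ y in 𝓝 x, ∀ v : TangentSpace I y,
      ‖(show E from mfderiv I 𝓘(ℝ, E) (extChartAt I x) y v)‖ₑ ≤ C * ‖v‖ₑ := by
  obtain ⟨C, C_pos, hC⟩ := eventually_norm_trivializationAt_lt E (TangentSpace I : M → Type _) x
  lift C to ℝ≥0 using C_pos.le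
  refine ⟨C, ?_⟩
  filter_upwards [hC, chart_source_mem_nhds H x] with y hy h'y v
  rw [← TangentBundle.continuousLinearMapAt_trivializationAt h'y]
  refine (ContinuousLinearMap.le_opENorm _ v).trans ?_
  gcongr
  rw [enorm_le_coe]
  exact hy.le

theorem eventually_enorm_mfderivWithin_extChartAt_symm_le (x : M) :
    ∃ C : ℝ≥0, ∀ᶠ y in 𝓝[range I] (extChartAt I x x), ∀ v : E,
      ‖(mfderivWithin 𝓘(ℝ, E) I (extChartAt I x).symm (range I) y v :
        TangentSpace I ((extChartAt I x).symm y))‖ₑ ≤ C * ‖v‖ₑ := by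
  obtain ⟨C, C_pos, hC⟩ := eventually_norm_symmL_trivializationAt_lt E (TangentSpace I : M → Type _) x
  lift C to ℝ≥0 using C_pos.le
  refine ⟨C, ?_⟩
  have h1 : 𝓝 x = 𝓝 ((extChartAt I x).symm (extChartAt I x x)) := by simp
  rw [h1] at hC
  have h2 : ContinuousAt (extChartAt I x).symm (extChartAt I x x) := continuousAt_extChartAt_symm _
  filter_upwards [nhdsWithin_le_nhds (h2.eventually hC),
    extChartAt_target_mem_nhdsWithin x] with y hy h'y v
  have h3 : (extChartAt I x).symm y ∈ (chartAt H x).source := by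
    simpa using (extChartAt I x).map_target h'y
  have h4 := TangentBundle.symmL_trivializationAt (𝕜 := ℝ) (I := I) h3
  rw [(extChartAt I x).right_inv h'y] at h4
  rw [← h4]
  refine (ContinuousLinearMap.le_opENorm _ v).trans ?_
  gcongr
  rw [enorm_le_coe]
  exact hy.le

variable {I}

/-- The image of the straight segment is a competitor for the Riemannian distance, and its length is
at most C times that of the segment. -/
theorem riemannianEDist_extChartAt_symm_le {x : M} {s : Set E} (hs : Convex ℝ s)
    (hst : s ⊆ (extChartAt I x).target) {C : ℝ≥0}
    (hC : ∀ y ∈ s, ∀ v : E, ‖(mfderivWithin 𝓘(ℝ, E) I (extChartAt I x).symm (range I) y v :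
        TangentSpace I ((extChartAt I x).symm y))‖ₑ ≤ C * ‖v‖ₑ) {a b : E} (ha : a ∈ s)
    (hb : b ∈ s) :
    riemannianEDist I ((extChartAt I x).symm a) ((extChartAt I x).symm b) ≤ C * edist a b := by
  let η := ContinuousAffineMap.lineMap (R := ℝ) a b
  set γ := (extChartAt I x).symm ∘ η
  have hη : Icc 0 1 ⊆ ⇑η ⁻¹' s := by
    simp only [← image_subset_iff, ContinuousAffineMap.coe_lineMap_eq,
     ← segment_eq_image_lineMap, η]
    exact hs.segment_subset ha hb
  have hη' : Icc 0 1 ⊆ ⇑η ⁻¹' (extChartAt I x).target := hη.trans (preimage_mono hst)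
  have η_smooth : ContMDiffOn 𝓘(ℝ, ℝ) 𝓘(ℝ, E) 1 η (Icc 0 1) := by
    apply ContMDiff.contMDiffOn
    rw [contMDiff_iff_contDiff]
    exact ContinuousAffineMap.contDiff _
  have : riemannianEDist I ((extChartAt I x).symm a) ((extChartAt I x).symm b) ≤
      pathELength I γ 0 1 := by
    apply riemannianEDist_le_pathELength _ _ _ zero_le_one
    · exact (contMDiffOn_extChartAt_symm x).comp η_smooth hη'
    · simp [γ, η, ContinuousAffineMap.coe_lineMap_eq]
    · simp [γ, η, ContinuousAffineMap.coe_lineMap_eq]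
  apply this.trans
  rw [← lintegral_fderiv_lineMap_eq_edist, pathELength_eq_lintegral_mfderivWithin_Icc,
    ← lintegral_const_mul' _ _ ENNReal.coe_ne_top]
  apply setLIntegral_mono' measurableSet_Icc (fun t ht ↦ ?_)
  have h1 : mfderivWithin 𝓘(ℝ, ℝ) I γ (Icc 0 1) t =
      (mfderivWithin 𝓘(ℝ, E) I (extChartAt I x).symm (range I) (η t)) ∘L
        (mfderivWithin 𝓘(ℝ, ℝ) 𝓘(ℝ, E) η (Icc 0 1) t) := by
    apply mfderivWithin_comp
    · exact mdifferentiableWithinAt_extChartAt_symm (hη' ht)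
    · exact η_smooth.mdifferentiableOn one_ne_zero t ht
    · exact hη'.trans (preimage_mono (extChartAt_target_subset_range x))
    · rw [uniqueMDiffWithinAt_iff_uniqueDiffWithinAt]
      exact uniqueDiffOn_Icc zero_lt_one t ht
  rw [h1]
  have h2 := hC (η t) (hη ht) (fderivWithin ℝ η (Icc 0 1) t 1)
  rw [mfderivWithin_eq_fderivWithin]
  exact h2

theorem edist_extChartAt_le_pathELength {x : M} {u : Set M} (hu : u ⊆ (chartAt H x).source)
    {C : ℝ≥0} (hC : ∀ y ∈ u, ∀ v : TangentSpace I y,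
      ‖(show E from mfderiv I 𝓘(ℝ, E) (extChartAt I x) y v)‖ₑ ≤ C * ‖v‖ₑ) {γ : ℝ → M}
    (hγ : ContMDiffOn 𝓘(ℝ, ℝ) I 1 γ (Icc 0 1)) (hγu : ∀ t ∈ Icc (0 : ℝ) 1, γ t ∈ u) :
    edist (extChartAt I x (γ 0)) (extChartAt I x (γ 1)) ≤ C * pathELength I γ 0 1 := by
  let γ' : ℝ → E := extChartAt I x ∘ γ
  have hC1 : ContMDiffOn 𝓘(ℝ, ℝ) 𝓘(ℝ, E) 1 γ' (Icc 0 1) :=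
    contMDiffOn_extChartAt.comp (I' := I) (t := (chartAt H x).source)
      hγ (fun t' ht' ↦ hu (hγu _ ht'))
  calc edist (γ' 0) (γ' 1) = ‖γ' 1 - γ' 0‖ₑ := by rw [edist_comm, edist_eq_enorm_sub]
    _ ≤ ∫⁻ t in Icc 0 1, ‖derivWithin γ' (Icc 0 1) t‖ₑ := by
      apply enorm_sub_le_lintegral_derivWithin_Icc_of_contDiffOn_Icc _ zero_le_one
      rwa [← contMDiffOn_iff_contDiffOn]
    _ ≤ ∫⁻ t in Icc 0 1, C * ‖mfderivWithin 𝓘(ℝ, ℝ) I γ (Icc 0 1) t 1‖ₑ := by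
      apply setLIntegral_mono' measurableSet_Icc (fun t ht ↦ ?_)
      have h1 : mfderivWithin 𝓘(ℝ, ℝ) 𝓘(ℝ, E) γ' (Icc 0 1) t =
          (mfderiv I 𝓘(ℝ, E) (extChartAt I x) (γ t)) ∘L
            (mfderivWithin 𝓘(ℝ, ℝ) I γ (Icc 0 1) t) := by
        apply mfderiv_comp_mfderivWithin
        · exact mdifferentiableAt_extChartAt (hu (hγu t ht))
        · exact hγ.mdifferentiableOn one_ne_zero _ ht
        · rw [uniqueMDiffWithinAt_iff_uniqueDiffWithinAt]
          exact uniqueDiffOn_Icc zero_lt_one _ ht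
      have h2 := hC (γ t) (hγu t ht) (mfderivWithin 𝓘(ℝ, ℝ) I γ (Icc 0 1) t (1 : ℝ))
      rw [mfderivWithin_eq_fderivWithin] at h1
      rw [← fderivWithin_derivWithin, h1]
      exact h2
    _ = C * pathELength I γ 0 1 := by
      rw [lintegral_const_mul' _ _ ENNReal.coe_ne_top, pathELength_eq_lintegral_mfderivWithin_Icc]

end Charts

section LipschitzCharts

open Manifold

variable {E : Type*} [NormedAddCommGroup E] [NormedSpace ℝ E] {H : Type*} [TopologicalSpace H]
  (I : ModelWithCorners ℝ E H) {M : Type*} [PseudoEMetricSpace M] [ChartedSpace H M]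
  [RiemannianBundle (fun x : M => TangentSpace I x)]
  [IsManifold I 1 M] [IsContinuousRiemannianBundle E (fun x : M => TangentSpace I x)]
  [IsRiemannianManifold I M]

/-- Two points within c/3 of x are joined by a curve shorter than 2c/3. It stays within distance c
of x, where the differential of the chart is bounded, so its image in the chart is short as well. -/
theorem exists_lipschitzOnWith_extChartAt (x : M) :
    ∃ C : ℝ≥0, ∃ u ∈ 𝓝 x, LipschitzOnWith C (extChartAt I x) u := by
  obtain ⟨C, hC⟩ := eventually_enorm_mfderiv_extChartAt_le I x
  obtain ⟨c, hc, hcs⟩ := EMetric.mem_nhds_iff.1 (inter_mem hC (chart_source_mem_nhds H x))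
  set c' := c / 3
  have hc' : 0 < c' := ENNReal.div_pos hc.ne' (by simp)
  have hcc : c' + c' + c' = c := ENNReal.add_thirds c
  have hpath : ∀ (y : M) (γ : ℝ → M) (r : ℝ≥0∞), γ 0 = y → ContMDiffOn 𝓘(ℝ, ℝ) I 1 γ (Icc 0 1) →
      pathELength I γ 0 1 < r → ∀ t ∈ Icc (0 : ℝ) 1, edist (γ t) y < r := by
    intro y γ r h0 hγ hr t ht
    rw [edist_comm, IsRiemannianManifold.out (I := I)]
    refine (riemannianEDist_le_pathELength (hγ.mono (Icc_subset_Icc le_rfl ht.2)) h0 rfl ht.1).trans_lt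
      ((pathELength_mono le_rfl ht.2).trans_lt hr)
  refine ⟨C, Metric.eball x c', Metric.eball_mem_nhds x hc', fun y hy z hz => ?_⟩
  have hyz : edist y z < c' + c' := (edist_triangle_right y z x).trans_lt (ENNReal.add_lt_add hy hz)
  -- The infimum defining the distance need not be attained, so the product is approached from above
  -- by a > C and b > edist y z.
  refine ENNReal.le_mul_of_forall_lt (Or.inr (ne_top_of_lt hyz)) (Or.inl ENNReal.coe_ne_top)
    fun a ha b hb => ?_
  have hlt : riemannianEDist I y z < min b (c' + c') := by
    rw [← IsRiemannianManifold.out (I := I)]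
    exact lt_min hb hyz
  obtain ⟨γ, h0, h1, hγ, hlen⟩ := exists_lt_of_riemannianEDist_lt hlt
  have hu : ∀ t ∈ Icc (0 : ℝ) 1, γ t ∈ Metric.eball x c := by
    intro t ht
    have := hpath y γ _ h0 hγ hlen t ht
    calc edist (γ t) x ≤ edist (γ t) y + edist y x := edist_triangle _ _ _
      _ < c' + c' + c' := ENNReal.add_lt_add (this.trans_le (min_le_right _ _)) hy
      _ = c := hcc
  have := edist_extChartAt_le_pathELength (fun y hy => (hcs hy).2) (fun y hy => (hcs hy).1) hγ hu
  rw [h0, h1] at this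
  exact this.trans (mul_le_mul' ha.le (hlen.le.trans (min_le_left _ _)))

end LipschitzCharts

/-! ### The Riemannian volume in charts -/

section Volume

variable {m : ℕ} {S : Type*} [EMetricSpace S] [ChartedSpace (EuclideanSpace ℝ (Fin m)) S]
  [RiemannianBundle (fun x : S => TangentSpace (𝓡 m) x)]

variable (m) in
/-- On the ball of radius `r` around the image of `x`, the inverse of the chart at `x` is
`C`-bi-Lipschitz, and its differential is bounded by `C`. -/
structure IsLipschitzChart (x : S) (C : ℝ≥0) (r : ℝ) : Prop where
  pos : 0 < r
  subset_target : Metric.ball (extChartAt (𝓡 m) x x) r ⊆ (extChartAt (𝓡 m) x).target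
  lipschitz_symm : LipschitzOnWith C (extChartAt (𝓡 m) x).symm
    (Metric.ball (extChartAt (𝓡 m) x x) r)
  lipschitz : LipschitzOnWith C (extChartAt (𝓡 m) x)
    ((extChartAt (𝓡 m) x).symm '' Metric.ball (extChartAt (𝓡 m) x x) r)
  enorm_le : ∀ y ∈ Metric.ball (extChartAt (𝓡 m) x x) r, ∀ v : EuclideanSpace ℝ (Fin m),
    ‖(mfderiv 𝓘(ℝ, EuclideanSpace ℝ (Fin m)) (𝓡 m) (extChartAt (𝓡 m) x).symm y v :
      TangentSpace (𝓡 m) ((extChartAt (𝓡 m) x).symm y))‖ₑ ≤ C * ‖v‖ₑ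

theorem exists_isLipschitzChart [IsManifold (𝓡 m) 1 S]
    [IsContinuousRiemannianBundle (EuclideanSpace ℝ (Fin m))
      (fun x : S => TangentSpace (𝓡 m) x)]
    [IsRiemannianManifold (𝓡 m) S] (x : S) : ∃ C r, IsLipschitzChart m x C r := by
  obtain ⟨C₁, u, hu, hC₁⟩ := exists_lipschitzOnWith_extChartAt (𝓡 m) x
  obtain ⟨C₂, hC₂⟩ := eventually_enorm_mfderivWithin_extChartAt_symm_le (𝓡 m) x
  have h1 : ∀ᶠ y in 𝓝 (extChartAt (𝓡 m) x x), y ∈ (extChartAt (𝓡 m) x).target ∧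
      (extChartAt (𝓡 m) x).symm y ∈ u ∧ ∀ v : EuclideanSpace ℝ (Fin m),
        ‖(mfderivWithin 𝓘(ℝ, EuclideanSpace ℝ (Fin m)) (𝓡 m) (extChartAt (𝓡 m) x).symm
          (range (𝓡 m)) y v : TangentSpace (𝓡 m) ((extChartAt (𝓡 m) x).symm y))‖ₑ
          ≤ C₂ * ‖v‖ₑ := by
    have hr : range (𝓡 m) = univ := (𝓡 m).range_eq_univ
    rw [hr, nhdsWithin_univ] at hC₂
    rw [hr]
    have h2 : 𝓝 x = 𝓝 ((extChartAt (𝓡 m) x).symm (extChartAt (𝓡 m) x x)) := by simp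
    rw [h2] at hu
    have h3 : ∀ᶠ y in 𝓝 (extChartAt (𝓡 m) x x), y ∈ (extChartAt (𝓡 m) x).target :=
      extChartAt_target_mem_nhds x
    exact h3.and (((continuousAt_extChartAt_symm x).eventually hu).and hC₂)
  obtain ⟨r, hr, hball⟩ := Metric.eventually_nhds_iff_ball.1 h1
  refine ⟨max C₁ C₂, r, hr, fun y hy => (hball y hy).1, fun a ha b hb => ?_, ?_,
    fun y hy v => ?_⟩
  · rw [IsRiemannianManifold.out (I := 𝓡 m)]
    refine (riemannianEDist_extChartAt_symm_le (convex_ball _ _) (fun y hy => (hball y hy).1)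
      (fun y hy => (hball y hy).2.2) ha hb).trans ?_
    gcongr
    exact le_max_right _ _
  · refine (hC₁.mono ?_).weaken (le_max_left _ _)
    rintro _ ⟨y, hy, rfl⟩
    exact (hball y hy).2.1
  · have := (hball y hy).2.2 v
    simp only [(𝓡 m).range_eq_univ, mfderivWithin_univ] at this
    refine this.trans ?_
    gcongr
    exact le_max_right _ _

variable [MeasurableSpace S] [BorelSpace S]

theorem _root_.LipschitzOnWith.euclideanHausdorffMeasure_image_le {X Y : Type*} [EMetricSpace X]
    [EMetricSpace Y] [MeasurableSpace X] [BorelSpace X] [MeasurableSpace Y] [BorelSpace Y]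
    {C : ℝ≥0} {f : X → Y} {s : Set X} (h : LipschitzOnWith C f s) (d : ℕ) :
    (μHE[d] : Measure Y) (f '' s) ≤ C ^ d * (μHE[d] : Measure X) s := by
  rw [Measure.euclideanHausdorffMeasure_def, Measure.euclideanHausdorffMeasure_def,
    Measure.smul_apply, Measure.smul_apply, mul_smul_comm]
  have := h.hausdorffMeasure_image_le (d := d) (by positivity)
  rw [ENNReal.rpow_natCast] at this
  gcongr

namespace IsLipschitzChart

variable {x : S} {C : ℝ≥0} {r : ℝ} (h : IsLipschitzChart m x C r)

include h

theorem isOpen_image :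
    IsOpen ((extChartAt (𝓡 m) x).symm '' Metric.ball (extChartAt (𝓡 m) x x) r) := by
  rw [(extChartAt (𝓡 m) x).symm_image_eq_source_inter_preimage h.subset_target]
  exact isOpen_extChartAt_preimage' x Metric.isOpen_ball

theorem mem_image :
    x ∈ (extChartAt (𝓡 m) x).symm '' Metric.ball (extChartAt (𝓡 m) x x) r :=
  ⟨_, Metric.mem_ball_self h.pos, by simp⟩

/-- A C-Lipschitz map enlarges m-dimensional Hausdorff measure by at most C^m. Applied to the chart
and its inverse, this makes volume and Lebesgue measure comparable without a formula for the volume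
density. -/
theorem vol_image_le {A : Set (EuclideanSpace ℝ (Fin m))}
    (hA : A ⊆ Metric.ball (extChartAt (𝓡 m) x x) r) :
    vol m S ((extChartAt (𝓡 m) x).symm '' A) ≤ C ^ m * volume A := by
  rw [← EuclideanSpace.euclideanHausdorffMeasure_eq_volume]
  exact (h.lipschitz_symm.mono hA).euclideanHausdorffMeasure_image_le m

theorem volume_le {A : Set (EuclideanSpace ℝ (Fin m))}
    (hA : A ⊆ Metric.ball (extChartAt (𝓡 m) x x) r) :
    volume A ≤ C ^ m * vol m S ((extChartAt (𝓡 m) x).symm '' A) := by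
  have := (h.lipschitz.mono (image_mono hA)).euclideanHausdorffMeasure_image_le m
  rw [image_image, EuclideanSpace.euclideanHausdorffMeasure_eq_volume] at this
  rwa [image_congr fun a ha => (extChartAt (𝓡 m) x).right_inv (h.subset_target (hA ha)),
    image_id'] at this

theorem aemeasurable_symm : AEMeasurable (extChartAt (𝓡 m) x).symm
    (volume.restrict (Metric.ball (extChartAt (𝓡 m) x x) r)) :=
  h.lipschitz_symm.continuousOn.aemeasurable measurableSet_ball

theorem map_symm_apply {s : Set S} (hs : MeasurableSet s) :
    (volume.restrict (Metric.ball (extChartAt (𝓡 m) x x) r)).map (extChartAt (𝓡 m) x).symm s =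
      volume ((extChartAt (𝓡 m) x).symm ⁻¹' s ∩ Metric.ball (extChartAt (𝓡 m) x x) r) := by
  rw [Measure.map_apply_of_aemeasurable h.aemeasurable_symm hs,
    Measure.restrict_apply' measurableSet_ball]

theorem restrict_vol_le :
    (vol m S).restrict ((extChartAt (𝓡 m) x).symm '' Metric.ball (extChartAt (𝓡 m) x x) r) ≤
      (C : ℝ≥0∞) ^ m • (volume.restrict (Metric.ball (extChartAt (𝓡 m) x x) r)).map
        (extChartAt (𝓡 m) x).symm := by
  refine Measure.le_iff.2 fun s hs => ?_
  rw [Measure.smul_apply, h.map_symm_apply hs, Measure.restrict_apply hs, smul_eq_mul, inter_comm,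
    ← image_inter_preimage, inter_comm]
  exact h.vol_image_le inter_subset_right

theorem map_symm_le :
    (volume.restrict (Metric.ball (extChartAt (𝓡 m) x x) r)).map (extChartAt (𝓡 m) x).symm ≤
      (C : ℝ≥0∞) ^ m • (vol m S).restrict
        ((extChartAt (𝓡 m) x).symm '' Metric.ball (extChartAt (𝓡 m) x x) r) := by
  refine Measure.le_iff.2 fun s hs => ?_
  rw [Measure.smul_apply, h.map_symm_apply hs, Measure.restrict_apply hs, smul_eq_mul, inter_comm s,
    ← image_inter_preimage, inter_comm _ (Metric.ball _ _)]
  exact h.volume_le inter_subset_left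

theorem lintegral_image_le {f : S → ℝ≥0∞} (hf : Measurable f) :
    ∫⁻ y in (extChartAt (𝓡 m) x).symm '' Metric.ball (extChartAt (𝓡 m) x x) r, f y ∂(vol m S) ≤
      C ^ m * ∫⁻ y in Metric.ball (extChartAt (𝓡 m) x x) r, f ((extChartAt (𝓡 m) x).symm y) := by
  refine (lintegral_mono' h.restrict_vol_le le_rfl).trans_eq ?_
  rw [lintegral_smul_measure, lintegral_map' hf.aemeasurable h.aemeasurable_symm, smul_eq_mul]

theorem lintegral_comp_symm_le {f : S → ℝ≥0∞} (hf : Measurable f) :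
    ∫⁻ y in Metric.ball (extChartAt (𝓡 m) x x) r, f ((extChartAt (𝓡 m) x).symm y) ≤
      C ^ m * ∫⁻ y, f y ∂(vol m S) := by
  rw [← lintegral_map' hf.aemeasurable h.aemeasurable_symm]
  refine (lintegral_mono' h.map_symm_le le_rfl).trans ?_
  rw [lintegral_smul_measure, smul_eq_mul]
  gcongr
  exact Measure.restrict_le_self

theorem vol_image_lt_top :
    vol m S ((extChartAt (𝓡 m) x).symm '' Metric.ball (extChartAt (𝓡 m) x x) r) < ⊤ :=
  (h.vol_image_le subset_rfl).trans_lt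
    (ENNReal.mul_lt_top (by finiteness) measure_ball_lt_top)

theorem vol_ne_zero : vol m S ≠ 0 := by
  intro h0
  have := h.volume_le subset_rfl
  rw [h0] at this
  simp only [Measure.coe_zero, Pi.zero_apply, mul_zero, nonpos_iff_eq_zero] at this
  exact (Metric.measure_ball_pos volume _ h.pos).ne' this

end IsLipschitzChart

variable [CompactSpace S] [IsManifold (𝓡 m) 1 S]
    [IsContinuousRiemannianBundle (EuclideanSpace ℝ (Fin m))
      (fun x : S => TangentSpace (𝓡 m) x)]
    [IsRiemannianManifold (𝓡 m) S]

variable (m S) in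
theorem exists_finite_cover_isLipschitzChart : ∃ (t : Finset S) (C : S → ℝ≥0) (r : S → ℝ),
    (∀ x, IsLipschitzChart m x (C x) (r x)) ∧
      ⋃ x ∈ t, (extChartAt (𝓡 m) x).symm '' Metric.ball (extChartAt (𝓡 m) x x) (r x) = univ := by
  choose C r h using exists_isLipschitzChart (m := m) (S := S)
  obtain ⟨t, ht⟩ := isCompact_univ.elim_finite_subcover _ (fun x => (h x).isOpen_image)
    (fun x _ => mem_iUnion.2 ⟨x, (h x).mem_image⟩)
  exact ⟨t, C, r, h, univ_subset_iff.1 ht⟩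

instance : IsFiniteMeasure (vol m S) := by
  obtain ⟨t, C, r, h, ht⟩ := exists_finite_cover_isLipschitzChart m S
  refine ⟨?_⟩
  rw [← ht]
  exact (measure_biUnion_finset_le _ _).trans_lt
    (ENNReal.sum_lt_top.2 fun x _ => (h x).vol_image_lt_top)

variable (m S) in
theorem vol_ne_zero [Nonempty S] : vol m S ≠ 0 := by
  obtain ⟨C, r, h⟩ := exists_isLipschitzChart (m := m) (Classical.arbitrary S)
  exact h.vol_ne_zero

end Volume

/-! ### Differentials in charts -/

section LinearAlgebra

/-- With P_{ki} = ⟨o_k, e_i⟩ the Gram matrix is G = PᵀP, hence P G⁻¹ Pᵀ = 1. The orthonormal basis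
of each tangent space is an arbitrary choice, whereas the Gram matrix of a local frame varies
continuously with the point. -/
theorem sum_orthonormalBasis_mul_conj {V κ ι : Type*} [NormedAddCommGroup V]
    [InnerProductSpace ℝ V] [Fintype κ] [Fintype ι] [DecidableEq ι]
    (o : OrthonormalBasis κ ℝ V) (e : Module.Basis ι ℝ V) (α β : V →ₗ[ℝ] ℂ) :
    ∑ k, α (o k) * conj (β (o k)) =
      ∑ i, ∑ j, (((Matrix.gram ℝ e)⁻¹ i j : ℝ) : ℂ) * (α (e i) * conj (β (e j))) := by
  classical
  set G := Matrix.gram ℝ e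
  have hG : IsUnit G.det :=
    ((Matrix.posDef_gram_of_linearIndependent e.linearIndependent).det_pos).ne'.isUnit
  let P : Matrix κ ι ℝ := .of fun k i => inner ℝ (o k) (e i)
  have hGP : G = P.transpose * P := by
    ext i j
    simp only [G, P, Matrix.gram_apply, Matrix.mul_apply, Matrix.transpose_apply, Matrix.of_apply]
    rw [← o.sum_inner_mul_inner]
    simp only [real_inner_comm]
  have h1 : G⁻¹ * P.transpose * P = 1 := by
    rw [Matrix.mul_assoc, ← hGP, Matrix.nonsing_inv_mul _ hG]
  have h2 : P * (G⁻¹ * P.transpose) = 1 :=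
    (Matrix.mul_eq_one_comm_of_equiv (o.toBasis.indexEquiv e)).2 h1
  have h3 : ∀ (γ : V →ₗ[ℝ] ℂ) i, γ (e i) = ∑ k, (P k i : ℂ) * γ (o k) := by
    intro γ i
    conv_lhs => rw [← o.sum_repr (e i)]
    simp [P, o.repr_apply_apply, map_sum]
  have h4 : ∀ k l, ∑ i, ∑ j, ((G⁻¹ i j : ℝ) : ℂ) * (P k i * P l j) = if k = l then 1 else 0 := by
    intro k l
    have h5 : ∑ i, ∑ j, G⁻¹ i j * (P k i * P l j) = (1 : Matrix κ κ ℝ) k l := by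
      rw [← h2]
      simp only [Matrix.mul_apply, Matrix.transpose_apply, Finset.mul_sum]
      refine Finset.sum_congr rfl fun i _ => Finset.sum_congr rfl fun j _ => by ring
    have := congrArg (fun x : ℝ => (x : ℂ)) h5
    simp only [Matrix.one_apply] at this
    push_cast at this
    rw [this]
    split_ifs <;> simp
  have swap : ∀ f : ι → ι → κ → ℂ, ∑ i, ∑ j, ∑ k, f i j k = ∑ k, ∑ i, ∑ j, f i j k := fun f =>
    (Finset.sum_congr rfl fun i _ => Finset.sum_comm).trans Finset.sum_comm
  symm
  calc ∑ i, ∑ j, ((G⁻¹ i j : ℝ) : ℂ) * (α (e i) * conj (β (e j)))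
      = ∑ i, ∑ j, ∑ k, ∑ l, (((G⁻¹ i j : ℝ) : ℂ) * (P k i * P l j)) *
          (α (o k) * conj (β (o l))) := by
        refine Finset.sum_congr rfl fun i _ => Finset.sum_congr rfl fun j _ => ?_
        rw [h3 α, h3 β]
        simp only [map_sum, map_mul, Complex.conj_ofReal]
        rw [Finset.sum_mul_sum]
        simp only [Finset.mul_sum]
        refine Finset.sum_congr rfl fun k _ => Finset.sum_congr rfl fun l _ => by ring
    _ = ∑ k, ∑ l, (∑ i, ∑ j, ((G⁻¹ i j : ℝ) : ℂ) * (P k i * P l j)) *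
          (α (o k) * conj (β (o l))) := by
        rw [swap]
        refine Finset.sum_congr rfl fun k _ => ?_
        rw [swap]
        simp only [Finset.sum_mul]
    _ = ∑ k, α (o k) * conj (β (o k)) := by
        simp only [h4, ite_mul, one_mul, zero_mul, Finset.sum_ite_eq, Finset.mem_univ, if_true]

theorem norm_sq_le_sum_orthonormalBasis {V κ : Type*} [NormedAddCommGroup V]
    [InnerProductSpace ℝ V] [Fintype κ] (o : OrthonormalBasis κ ℝ V) (α : V →ₗ[ℝ] ℂ) (v : V) :
    ‖α v‖ ^ 2 ≤ ‖v‖ ^ 2 * (∑ k, α (o k) * conj (α (o k))).re := by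
  have h1 : (∑ k, α (o k) * conj (α (o k))).re = ∑ k, ‖α (o k)‖ ^ 2 := by
    rw [Complex.re_sum]
    refine Finset.sum_congr rfl fun k _ => ?_
    rw [Complex.mul_conj, Complex.ofReal_re, Complex.sq_norm]
  rw [h1, ← o.sum_sq_norm_inner_right v]
  calc ‖α v‖ ^ 2 = ‖∑ k, (inner ℝ (o k) v) • α (o k)‖ ^ 2 := by
        conv_lhs => rw [← o.sum_repr v]
        simp [o.repr_apply_apply, map_sum]
    _ ≤ (∑ k, ‖inner ℝ (o k) v‖ * ‖α (o k)‖) ^ 2 := by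
        gcongr
        refine (norm_sum_le _ _).trans_eq ?_
        simp only [norm_smul]
    _ ≤ _ := Finset.sum_mul_sq_le_sq_mul_sq _ _ _

end LinearAlgebra

section GradInner

variable {m : ℕ} {S : Type*} [EMetricSpace S] [ChartedSpace (EuclideanSpace ℝ (Fin m)) S]
  [IsManifold (𝓡 m) ∞ S]

theorem contDiffOn_comp_extChartAt_symm {f : S → ℂ} (hf : ContMDiff (𝓡 m) 𝓘(ℝ, ℂ) ∞ f) (x : S) :
    ContDiffOn ℝ ∞ (f ∘ (extChartAt (𝓡 m) x).symm) (extChartAt (𝓡 m) x).target := by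
  rw [← contMDiffOn_iff_contDiffOn]
  exact hf.comp_contMDiffOn (contMDiffOn_extChartAt_symm x)

theorem fderiv_comp_extChartAt_symm {f : S → ℂ} (hf : ContMDiff (𝓡 m) 𝓘(ℝ, ℂ) ∞ f) {x : S}
    {y : EuclideanSpace ℝ (Fin m)} (hy : y ∈ (extChartAt (𝓡 m) x).target)
    (v : EuclideanSpace ℝ (Fin m)) :
    fderiv ℝ (f ∘ (extChartAt (𝓡 m) x).symm) y v =
      differential m f ((extChartAt (𝓡 m) x).symm y)
        (mfderiv 𝓘(ℝ, EuclideanSpace ℝ (Fin m)) (𝓡 m) (extChartAt (𝓡 m) x).symm y v) := by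
  have h1 : MDifferentiableAt 𝓘(ℝ, EuclideanSpace ℝ (Fin m)) (𝓡 m) (extChartAt (𝓡 m) x).symm y := by
    have := mdifferentiableWithinAt_extChartAt_symm hy
    rwa [(𝓡 m).range_eq_univ, mdifferentiableWithinAt_univ] at this
  have h2 := mfderiv_comp y ((hf.mdifferentiable (by simp)) ((extChartAt (𝓡 m) x).symm y)) h1
  rw [mfderiv_eq_fderiv] at h2
  rw [h2]
  rfl

theorem fderiv_comp_extChartAt_symm_extChartAt {f : S → ℂ} (hf : ContMDiff (𝓡 m) 𝓘(ℝ, ℂ) ∞ f)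
    {x₀ x : S} (hx : x ∈ (chartAt (EuclideanSpace ℝ (Fin m)) x₀).source)
    (v : EuclideanSpace ℝ (Fin m)) :
    fderiv ℝ (f ∘ (extChartAt (𝓡 m) x₀).symm) (extChartAt (𝓡 m) x₀ x) v = differential m f x
      ((trivializationAt (EuclideanSpace ℝ (Fin m)) (TangentSpace (𝓡 m)) x₀).symmL ℝ x v) := by
  have hx' : x ∈ (extChartAt (𝓡 m) x₀).source := by rwa [extChartAt_source]
  rw [fderiv_comp_extChartAt_symm hf ((extChartAt (𝓡 m) x₀).map_source hx'),
    TangentBundle.symmL_trivializationAt hx, (𝓡 m).range_eq_univ, mfderivWithin_univ]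
  -- The base point occurs in the type of the tangent vector; it is changed by viewing the vector in
  -- the model space.
  have key : ∀ z, z = x → ∀ w : EuclideanSpace ℝ (Fin m),
      differential m f z w = differential m f x w := by
    rintro _ rfl _
    rfl
  exact key _ ((extChartAt (𝓡 m) x₀).left_inv hx') _

variable [RiemannianBundle (fun x : S => TangentSpace (𝓡 m) x)]

theorem norm_differential_sq_le (f : S → ℂ) (x : S) (v : TangentSpace (𝓡 m) x) :
    ‖differential m f x v‖ ^ 2 ≤ ‖v‖ ^ 2 * (gradInner m f f x).re :=
  norm_sq_le_sum_orthonormalBasis (stdOrthonormalBasis ℝ (TangentSpace (𝓡 m) x))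
    (mfderiv (𝓡 m) 𝓘(ℝ, ℂ) f x).toLinearMap v

theorem gradInner_self_re_nonneg (f : S → ℂ) (x : S) : 0 ≤ (gradInner m f f x).re := by
  rw [gradInner, Complex.re_sum]
  refine Finset.sum_nonneg fun i _ => ?_
  rw [Complex.mul_conj, Complex.ofReal_re]
  exact Complex.normSq_nonneg _

theorem gradInner_eq_sum (η φ : S → ℂ) (x : S) {ι : Type*} [Fintype ι] [DecidableEq ι]
    (e : Module.Basis ι ℝ (TangentSpace (𝓡 m) x)) :
    gradInner m η φ x = ∑ i, ∑ j, (((Matrix.gram ℝ e)⁻¹ i j : ℝ) : ℂ) *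
      (differential m η x (e i) * conj (differential m φ x (e j))) :=
  sum_orthonormalBasis_mul_conj (stdOrthonormalBasis ℝ (TangentSpace (𝓡 m) x)) e
    (mfderiv (𝓡 m) 𝓘(ℝ, ℂ) η x).toLinearMap (mfderiv (𝓡 m) 𝓘(ℝ, ℂ) φ x).toLinearMap

/-- By the chain rule, the derivative of f in the chart is df applied to the differential of the
inverse chart, which has norm at most C. -/
theorem IsLipschitzChart.enorm_fderiv_sq_le {x : S} {C : ℝ≥0} {r : ℝ}
    (h : IsLipschitzChart m x C r) {f : S → ℂ} (hf : ContMDiff (𝓡 m) 𝓘(ℝ, ℂ) ∞ f)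
    {y : EuclideanSpace ℝ (Fin m)} (hy : y ∈ Metric.ball (extChartAt (𝓡 m) x x) r) :
    ‖fderiv ℝ (f ∘ (extChartAt (𝓡 m) x).symm) y‖ₑ ^ 2 ≤
      C ^ 2 * ENNReal.ofReal (gradInner m f f ((extChartAt (𝓡 m) x).symm y)).re := by
  have h0 := gradInner_self_re_nonneg (m := m) f ((extChartAt (𝓡 m) x).symm y)
  have h1 : ‖fderiv ℝ (f ∘ (extChartAt (𝓡 m) x).symm) y‖ ≤
      C * √(gradInner m f f ((extChartAt (𝓡 m) x).symm y)).re := by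
    refine ContinuousLinearMap.opNorm_le_bound _ (by positivity) fun v => ?_
    rw [fderiv_comp_extChartAt_symm hf (h.subset_target hy)]
    have h2 := h.enorm_le y hy v
    rw [← ofReal_norm, ← ofReal_norm, ← ENNReal.ofReal_coe_nnreal,
      ← ENNReal.ofReal_mul (by positivity), ENNReal.ofReal_le_ofReal_iff (by positivity)] at h2
    refine abs_le_of_sq_le_sq' ?_ (by positivity) |>.2
    refine (norm_differential_sq_le _ _ _).trans ?_
    rw [mul_right_comm, mul_pow, Real.sq_sqrt h0]
    gcongr
  rw [← ofReal_norm, ← ENNReal.ofReal_pow (norm_nonneg _), ← ENNReal.ofReal_coe_nnreal,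
    ← ENNReal.ofReal_pow (by positivity), ← ENNReal.ofReal_mul (by positivity)]
  apply ENNReal.ofReal_le_ofReal
  calc _ ≤ (C * √(gradInner m f f ((extChartAt (𝓡 m) x).symm y)).re) ^ 2 := by gcongr
    _ = _ := by rw [mul_pow, Real.sq_sqrt h0]

variable [IsContinuousRiemannianBundle (EuclideanSpace ℝ (Fin m))
      (fun x : S => TangentSpace (𝓡 m) x)]

/-- Near x₀ the product is G^{ij} ∂_iη conj(∂_jφ) in the coordinate frame, with G⁻¹ continuous since
the Gram determinant does not vanish. -/
theorem continuous_gradInner {η φ : S → ℂ} (hη : ContMDiff (𝓡 m) 𝓘(ℝ, ℂ) ∞ η)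
    (hφ : ContMDiff (𝓡 m) 𝓘(ℝ, ℂ) ∞ φ) : Continuous (gradInner m η φ) := by
  rw [continuous_iff_continuousAt]
  intro x₀
  let T := trivializationAt (EuclideanSpace ℝ (Fin m)) (TangentSpace (𝓡 m)) x₀
  let b := (EuclideanSpace.basisFun (Fin m) ℝ).toBasis
  let e := extChartAt (𝓡 m) x₀
  have hx₀ : x₀ ∈ T.baseSet := FiberBundle.mem_baseSet_trivializationAt' x₀
  have hframe : ∀ i, ContinuousAt (fun x => (⟨x, T.localFrame b i x⟩ :
      TotalSpace (EuclideanSpace ℝ (Fin m)) (TangentSpace (𝓡 m)))) x₀ := fun i =>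
    (contMDiffAt_localFrame_of_mem (I := 𝓡 m) (n := 0) T b i hx₀).continuousAt
  have hgram : ContinuousAt
      (fun x => (Matrix.gram ℝ fun i => T.localFrame b i x : Matrix (Fin m) (Fin m) ℝ)) x₀ :=
    continuousAt_pi.2 fun i => continuousAt_pi.2 fun j => (hframe i).inner_bundle (hframe j)
  have hbasis : ∀ x (hx : x ∈ T.baseSet),
      (fun i => T.localFrame b i x) = T.basisAt b hx := fun x hx => by
    ext1 i
    exact T.localFrame_apply_of_mem_baseSet b hx
  have hdet : (Matrix.gram ℝ fun i => T.localFrame b i x₀).det ≠ 0 := by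
    rw [hbasis x₀ hx₀]
    exact (Matrix.posDef_gram_of_linearIndependent
      (T.basisAt b hx₀).linearIndependent).det_pos.ne'
  have hinv : ContinuousAt
      (fun x => (Matrix.gram ℝ fun i => T.localFrame b i x : Matrix (Fin m) (Fin m) ℝ)⁻¹) x₀ := by
    refine ContinuousAt.comp (g := Inv.inv) (continuousAt_matrix_inv _ ?_) hgram
    rw [Ring.inverse_eq_inv']
    exact continuousAt_inv₀ hdet
  have hdiff : ∀ f : S → ℂ, ContMDiff (𝓡 m) 𝓘(ℝ, ℂ) ∞ f → ∀ i,
      ContinuousAt (fun x => fderiv ℝ (f ∘ e.symm) (e x) (b i)) x₀ := by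
    intro f hf i
    have h1 : ContinuousAt (fderiv ℝ (f ∘ e.symm)) (e x₀) :=
      ((contDiffOn_comp_extChartAt_symm hf x₀).continuousOn_fderiv_of_isOpen
        (isOpen_extChartAt_target x₀) (by simp)).continuousAt (extChartAt_target_mem_nhds x₀)
    exact (h1.comp (continuousAt_extChartAt x₀)).clm_apply continuousAt_const
  have heq : ∀ᶠ x in 𝓝 x₀, gradInner m η φ x = ∑ i, ∑ j,
      (((Matrix.gram ℝ fun i => T.localFrame b i x)⁻¹ i j : ℝ) : ℂ) *
      (fderiv ℝ (η ∘ e.symm) (e x) (b i) * conj (fderiv ℝ (φ ∘ e.symm) (e x) (b j))) := by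
    filter_upwards [T.open_baseSet.mem_nhds hx₀] with x hx
    have hx' : x ∈ (chartAt (EuclideanSpace ℝ (Fin m)) x₀).source := hx
    rw [gradInner_eq_sum η φ x (T.basisAt b hx), hbasis x hx]
    have hb : ∀ i, T.basisAt b hx i = T.symmL ℝ x (b i) := fun i => by
      rw [Trivialization.symmL_apply T hx, Trivialization.basisAt, Module.Basis.map_apply]
      rfl
    simp only [hb, e, T, fderiv_comp_extChartAt_symm_extChartAt hη hx',
      fderiv_comp_extChartAt_symm_extChartAt hφ hx']
  refine ContinuousAt.congr ?_ (heq.mono fun x hx => hx.symm)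
  refine tendsto_finsetSum _ fun i _ => tendsto_finsetSum _ fun j _ => ?_
  refine ContinuousAt.mul ?_ ((hdiff η hη i).mul (Complex.continuous_conj.continuousAt.comp
    (hdiff φ hφ j)))
  exact Complex.continuous_ofReal.continuousAt.comp
    (continuousAt_pi.1 (continuousAt_pi.1 hinv i) j)

end GradInner

/-! ### The space `𝓗₀` is finite dimensional -/

section FiniteDimensionality

variable {m : ℕ} {S : Type*} [EMetricSpace S] [CompactSpace S] [MeasurableSpace S] [BorelSpace S]
  [ChartedSpace (EuclideanSpace ℝ (Fin m)) S] [IsManifold (𝓡 m) ∞ S]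
  [RiemannianBundle (fun x : S => TangentSpace (𝓡 m) x)]
  [IsContinuousRiemannianBundle (EuclideanSpace ℝ (Fin m))
      (fun x : S => TangentSpace (𝓡 m) x)]
  [IsRiemannianManifold (𝓡 m) S]

theorem integrable_of_continuous {f : S → ℂ} (hf : Continuous f) : Integrable f (vol m S) :=
  hf.integrable_of_hasCompactSupport (HasCompactSupport.of_compactSpace f)

theorem gradInner_add_left {η ζ : S → ℂ} (hη : ContMDiff (𝓡 m) 𝓘(ℝ, ℂ) ∞ η)
    (hζ : ContMDiff (𝓡 m) 𝓘(ℝ, ℂ) ∞ ζ) (φ : S → ℂ) (x : S) :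
    gradInner m (η + ζ) φ x = gradInner m η φ x + gradInner m ζ φ x := by
  have h : ∀ v, differential m (η + ζ) x v = differential m η x v + differential m ζ x v := by
    intro v
    rw [differential, mfderiv_add (hη.mdifferentiable (by simp) x) (hζ.mdifferentiable (by simp) x)]
    rfl
  simp only [gradInner, h, add_mul, Finset.sum_add_distrib]

theorem gradInner_smul_left (c : ℂ) {η : S → ℂ} (hη : ContMDiff (𝓡 m) 𝓘(ℝ, ℂ) ∞ η)
    (φ : S → ℂ) (x : S) : gradInner m (c • η) φ x = c * gradInner m η φ x := by
  have h : ∀ v, differential m (c • η) x v = c * differential m η x v := by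
    intro v
    have h1 := hη.mdifferentiable (by simp) x
    have h2 : HasMFDerivAt (𝓡 m) 𝓘(ℝ, ℂ) (c • η) x
        (((ContinuousLinearMap.mul ℝ ℂ c).comp (mfderiv (𝓡 m) 𝓘(ℝ, ℂ) η x))) :=
      (ContinuousLinearMap.mul ℝ ℂ c).hasMFDerivAt.comp x h1.hasMFDerivAt
    rw [differential, h2.mfderiv]
    rfl
  simp only [gradInner, h, mul_assoc, Finset.mul_sum]

theorem IsNegLaplacian.add {η f ζ g : S → ℂ} (h : IsNegLaplacian m η f)
    (h' : IsNegLaplacian m ζ g) : IsNegLaplacian m (η + ζ) (f + g) where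
  smooth_left := h.smooth_left.add h'.smooth_left
  smooth_right := h.smooth_right.add h'.smooth_right
  integral_eq φ hφ := by
    have hφ' : Continuous fun x => conj (φ x) := Complex.continuous_conj.comp hφ.continuous
    simp only [gradInner_add_left h.smooth_left h'.smooth_left, Pi.add_apply, add_mul]
    rw [integral_add (integrable_of_continuous (continuous_gradInner h.smooth_left hφ))
      (integrable_of_continuous (continuous_gradInner h'.smooth_left hφ)),
      h.integral_eq φ hφ, h'.integral_eq φ hφ]
    exact (integral_add (integrable_of_continuous (h.smooth_right.continuous.mul hφ'))
      (integrable_of_continuous (h'.smooth_right.continuous.mul hφ'))).symm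

theorem IsNegLaplacian.smul {η f : S → ℂ} (h : IsNegLaplacian m η f) (c : ℂ) :
    IsNegLaplacian m (c • η) (c • f) where
  smooth_left := (contDiff_const_smul c).contMDiff.comp h.smooth_left
  smooth_right := (contDiff_const_smul c).contMDiff.comp h.smooth_right
  integral_eq φ hφ := by
    simp only [gradInner_smul_left c h.smooth_left, Pi.smul_apply, smul_eq_mul, mul_assoc]
    rw [integral_const_mul, integral_const_mul, h.integral_eq φ hφ]

theorem isNegLaplacian_const (c : ℂ) : IsNegLaplacian m (fun _ : S => c) 0 where
  smooth_left := contMDiff_const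
  smooth_right := contMDiff_const
  integral_eq φ hφ := by
    have h : ∀ x v, differential m (fun _ : S => c) x v = 0 := by
      intro x v
      rw [differential, mfderiv_const]
      rfl
    simp [gradInner, h]

/-- The smooth solutions already form a subspace, so taking the span adds nothing. -/
theorem exists_isNegLaplacian_of_mem_eigenspace {μ : ℝ} {F : Lp ℂ 2 (vol m S)}
    (hF : F ∈ eigenspace m S μ) :
    ∃ f, IsNegLaplacian m f (fun x => (μ : ℂ) * f x) ∧ F =ᵐ[vol m S] f := by
  rw [eigenspace] at hF
  induction hF using Submodule.span_induction with
  | mem F h => exact h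
  | zero =>
    refine ⟨fun _ => 0, ?_, Lp.coeFn_zero _ _ _⟩
    simp only [mul_zero]
    exact isNegLaplacian_const 0
  | add F F' _ _ h1 h2 =>
    obtain ⟨f, hf, hFf⟩ := h1
    obtain ⟨f', hf', hFf'⟩ := h2
    refine ⟨f + f', ?_, (Lp.coeFn_add _ _).trans (hFf.add hFf')⟩
    convert hf.add hf' using 1
    ext x
    simp [mul_add]
  | smul c F _ h1 =>
    obtain ⟨f, hf, hFf⟩ := h1
    refine ⟨c • f, ?_, (Lp.coeFn_smul _ _).trans (hFf.const_smul c)⟩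
    convert hf.smul c using 1
    ext x
    simp only [Pi.smul_apply, smul_eq_mul]
    ring

variable (n : ℕ) (αM : ℝ)

/-- Multiplication by μ on each eigenspace is the weak Laplacian of a smooth representative; this
links the algebraic operator to the Dirichlet integral. -/
theorem exists_isNegLaplacian (h : H₀ m S n αM) : ∃ f g : S → ℂ, IsNegLaplacian m f g ∧
    (h : Lp ℂ 2 (vol m S)) =ᵐ[vol m S] f ∧
    (negLaplacian m S n αM h : Lp ℂ 2 (vol m S)) =ᵐ[vol m S] g := by
  -- The operator acts on the subtype while the induction runs over ambient vectors, so membership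
  -- is carried inside the statement.
  have key : ∀ F ∈ H₀ m S n αM, ∃ hF : F ∈ H₀ m S n αM, ∃ f g : S → ℂ, IsNegLaplacian m f g ∧
      F =ᵐ[vol m S] f ∧
      (negLaplacian m S n αM ⟨F, hF⟩ : Lp ℂ 2 (vol m S)) =ᵐ[vol m S] g := by
    have hadd : ∀ F F' : Lp ℂ 2 (vol m S), (∃ hF : F ∈ H₀ m S n αM, ∃ f g : S → ℂ,
        IsNegLaplacian m f g ∧ F =ᵐ[vol m S] f ∧
        (negLaplacian m S n αM ⟨F, hF⟩ : Lp ℂ 2 (vol m S)) =ᵐ[vol m S] g) →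
        (∃ hF : F' ∈ H₀ m S n αM, ∃ f g : S → ℂ,
        IsNegLaplacian m f g ∧ F' =ᵐ[vol m S] f ∧
        (negLaplacian m S n αM ⟨F', hF⟩ : Lp ℂ 2 (vol m S)) =ᵐ[vol m S] g) →
        (∃ hF : F + F' ∈ H₀ m S n αM, ∃ f g : S → ℂ,
        IsNegLaplacian m f g ∧ (F + F' : Lp ℂ 2 (vol m S)) =ᵐ[vol m S] f ∧
        (negLaplacian m S n αM ⟨F + F', hF⟩ : Lp ℂ 2 (vol m S)) =ᵐ[vol m S] g) := by
      rintro F F' ⟨hF, f, g, h1, h2, h3⟩ ⟨hF', f', g', h1', h2', h3'⟩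
      refine ⟨add_mem hF hF', f + f', g + g', h1.add h1', (Lp.coeFn_add _ _).trans (h2.add h2'), ?_⟩
      have e : negLaplacian m S n αM ⟨F + F', add_mem hF hF'⟩ =
          negLaplacian m S n αM ⟨F, hF⟩ + negLaplacian m S n αM ⟨F', hF'⟩ := by
        rw [← map_add]
        rfl
      rw [e]
      exact (Lp.coeFn_add _ _).trans (h3.add h3')
    have hzero : ∃ hF : 0 ∈ H₀ m S n αM, ∃ f g : S → ℂ,
        IsNegLaplacian m f g ∧ (0 : Lp ℂ 2 (vol m S)) =ᵐ[vol m S] f ∧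
        (negLaplacian m S n αM ⟨0, hF⟩ : Lp ℂ 2 (vol m S)) =ᵐ[vol m S] g := by
      refine ⟨zero_mem _, fun _ => 0, 0, isNegLaplacian_const 0, Lp.coeFn_zero _ _ _, ?_⟩
      have e : negLaplacian m S n αM ⟨0, zero_mem _⟩ = 0 := map_zero _
      rw [e]
      exact Lp.coeFn_zero _ _ _
    intro F hF
    rw [H₀] at hF
    induction hF using Submodule.iSup_induction' with
    | mem k F hF =>
      have hle : lowEigenspace m S n αM k ≤ H₀ m S n αM := le_iSup (lowEigenspace m S n αM) k
      obtain ⟨f, h1, h2⟩ := exists_isNegLaplacian_of_mem_eigenspace hF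
      refine ⟨hle hF, f, _, h1, h2, ?_⟩
      rw [negLaplacian_apply m n αM k ⟨F, hle hF⟩ hF]
      refine (Lp.coeFn_smul _ _).trans ?_
      filter_upwards [h2] with x hx
      simp [hx]
    | zero => exact hzero
    | add F F' _ _ h1 h2 => exact hadd F F' h1 h2
  exact (key h h.2).2

end FiniteDimensionality

/-! ### The Dirichlet integral on 𝓗₀ -/

section EnergyBound

variable {m : ℕ} {S : Type*} [EMetricSpace S] [CompactSpace S] [MeasurableSpace S] [BorelSpace S]
  [ChartedSpace (EuclideanSpace ℝ (Fin m)) S] [IsManifold (𝓡 m) ∞ S]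
  [RiemannianBundle (fun x : S => TangentSpace (𝓡 m) x)]
  [IsContinuousRiemannianBundle (EuclideanSpace ℝ (Fin m))
      (fun x : S => TangentSpace (𝓡 m) x)]
  [IsRiemannianManifold (𝓡 m) S]

theorem inner_eq_integral_of_ae_eq {α : Type*} [MeasurableSpace α] {μ : Measure α}
    {F G : Lp ℂ 2 μ} {f g : α → ℂ} (hF : F =ᵐ[μ] f) (hG : G =ᵐ[μ] g) :
    inner ℂ F G = ∫ x, g x * conj (f x) ∂μ := by
  rw [L2.inner_def]
  refine integral_congr_ae ?_
  filter_upwards [hF, hG] with x h1 h2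
  rw [h1, h2, RCLike.inner_apply]

variable {n : ℕ} {αM : ℝ}

/-- Positivity of `angular` reads (4/n²)a₀⟨-Δh, h⟩ ≤ ((m-1)²/4)‖h‖², and the factor on the left is
positive. -/
theorem inner_negLaplacian_re_le (hn : 2 ≤ n) (hαM : 0 < αM) : ∃ M : ℝ, 0 ≤ M ∧
    ∀ h : H₀ m S n αM, (inner ℂ h (negLaplacian m S n αM h)).re ≤ M * ‖h‖ ^ 2 := by
  have hn' : (2 : ℝ) ≤ n := by exact_mod_cast hn
  have hd : 0 < 4 / (n : ℝ) ^ 2 * a₀ n αM := by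
    have : 0 < 2 * (n : ℝ) * (n - 1) := mul_pos (by linarith) (by linarith)
    exact mul_pos (by positivity) (div_pos this hαM)
  refine ⟨((m : ℝ) - 1) ^ 2 / 4 / (4 / (n : ℝ) ^ 2 * a₀ n αM), by positivity, fun h => ?_⟩
  have h1 := (angular_isPositive m S n αM).2 h
  rw [angular, LinearMap.sub_apply, LinearMap.smul_apply, LinearMap.smul_apply,
    LinearMap.id_apply, inner_sub_left, inner_smul_left, inner_smul_left, Complex.conj_ofReal,
    Complex.conj_ofReal, map_sub, RCLike.re_to_complex, RCLike.re_to_complex,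
    Complex.re_ofReal_mul, Complex.re_ofReal_mul, ← RCLike.re_to_complex,
    inner_self_eq_norm_sq] at h1
  have h2 := inner_re_symm (𝕜 := ℂ) (negLaplacian m S n αM h) h
  rw [div_mul_eq_mul_div, le_div_iff₀ hd]
  simp only [RCLike.re_to_complex] at h1 h2
  rw [h2] at h1
  linarith

theorem exists_lintegral_gradInner_le (hn : 2 ≤ n) (hαM : 0 < αM) : ∃ M : ℝ, 0 ≤ M ∧
    ∀ h : H₀ m S n αM, ∃ f : S → ℂ, ContMDiff (𝓡 m) 𝓘(ℝ, ℂ) ∞ f ∧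
      (h : Lp ℂ 2 (vol m S)) =ᵐ[vol m S] f ∧
      ∫⁻ x, ENNReal.ofReal (gradInner m f f x).re ∂(vol m S) ≤
        ENNReal.ofReal M * ∫⁻ x, ‖f x‖ₑ ^ 2 ∂(vol m S) := by
  obtain ⟨M, hM0, hM⟩ := inner_negLaplacian_re_le (m := m) (S := S) hn hαM
  refine ⟨M, hM0, fun h => ?_⟩
  obtain ⟨f, g, hfg, hf, hg⟩ := exists_isNegLaplacian n αM h
  refine ⟨f, hfg.smooth_left, hf, ?_⟩
  have hc := hfg.smooth_left.continuous
  have h1 := hM h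
  have h2 : ‖h‖ ^ 2 = ∫ x, ‖f x‖ ^ 2 ∂(vol m S) := by
    have := inner_eq_integral_of_ae_eq hf hf
    simp only [Complex.mul_conj', ← Complex.ofReal_pow] at this
    rw [integral_complex_ofReal] at this
    have h3 := inner_self_eq_norm_sq (𝕜 := ℂ) (h : Lp ℂ 2 (vol m S))
    rw [this] at h3
    simpa using h3.symm
  have h4 : ∫⁻ x, ‖f x‖ₑ ^ 2 ∂(vol m S) = ENNReal.ofReal (∫ x, ‖f x‖ ^ 2 ∂(vol m S)) := by
    have hc' : Continuous fun x => ‖f x‖ ^ 2 := hc.norm.pow 2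
    rw [ofReal_integral_eq_lintegral_ofReal
      (hc'.integrable_of_hasCompactSupport (HasCompactSupport.of_compactSpace _))
      (ae_of_all _ fun x => by positivity)]
    simp [ENNReal.ofReal_pow]
  have hint := integrable_of_continuous (m := m) (continuous_gradInner hfg.smooth_left hfg.smooth_left)
  have h5 : ∫⁻ x, ENNReal.ofReal (gradInner m f f x).re ∂(vol m S) =
      ENNReal.ofReal (inner ℂ h (negLaplacian m S n αM h)).re := by
    have hre : Integrable (fun x => (gradInner m f f x).re) (vol m S) := hint.re
    rw [← ofReal_integral_eq_lintegral_ofReal hre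
      (ae_of_all _ fun x => gradInner_self_re_nonneg f x), Submodule.coe_inner,
      inner_eq_integral_of_ae_eq hf hg, ← hfg.integral_eq f hfg.smooth_left]
    congr 1
    exact integral_re hint
  rw [h5, h4, ← h2, ← ENNReal.ofReal_mul hM0]
  exact ENNReal.ofReal_le_ofReal h1

end EnergyBound

/-! ### Averages as linear forms on L² -/

section Averages

variable {α : Type*} [MeasurableSpace α] {μ : Measure α} [IsFiniteMeasure μ]

theorem integrable_of_le_smul {ν : Measure α} {c : ℝ≥0∞} (hc : c ≠ ⊤) (hν : ν ≤ c • μ)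
    (h : Lp ℂ 2 μ) : Integrable h ν :=
  ((Lp.memLp h).integrable (by norm_num)).of_measure_le_smul hc hν

/-- The integral with respect to a measure that is bounded by a multiple of `μ`, as a linear form
on `L²(μ)`. -/
def integralForm {ν : Measure α} {c : ℝ≥0∞} (hc : c ≠ ⊤) (hν : ν ≤ c • μ) : Lp ℂ 2 μ →ₗ[ℂ] ℂ where
  toFun h := ∫ x, h x ∂ν
  map_add' h h' := by
    have hac : ν ≪ μ := Measure.absolutelyContinuous_of_le_smul hν
    rw [← integral_add (integrable_of_le_smul hc hν h) (integrable_of_le_smul hc hν h')]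
    exact integral_congr_ae (hac.ae_le (Lp.coeFn_add h h'))
  map_smul' a h := by
    have hac : ν ≪ μ := Measure.absolutelyContinuous_of_le_smul hν
    rw [RingHom.id_apply, ← integral_smul]
    exact integral_congr_ae (hac.ae_le (Lp.coeFn_smul a h))

end Averages

/-! ### Finitely many averages determine an element of 𝓗₀ -/

section Finiteness

variable {m : ℕ} {S : Type*} [EMetricSpace S] [CompactSpace S] [MeasurableSpace S] [BorelSpace S]
  [ChartedSpace (EuclideanSpace ℝ (Fin m)) S] [IsManifold (𝓡 m) ∞ S]
  [RiemannianBundle (fun x : S => TangentSpace (𝓡 m) x)]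
  [IsContinuousRiemannianBundle (EuclideanSpace ℝ (Fin m))
      (fun x : S => TangentSpace (𝓡 m) x)]
  [IsRiemannianManifold (𝓡 m) S]

/-- The forms are the integrals over the Poincaré cells, pushed forward to S. In the exponent 2m +
2, each of the two comparisons of measures contributes m, and the squared differential of the
inverse chart contributes 2. -/
theorem IsLipschitzChart.exists_forms {x : S} {C : ℝ≥0} {r : ℝ} (hx : IsLipschitzChart m x C r)
    {ε : ℝ} (hε : 0 < ε) : ∃ (ι : Type) (_ : Finite ι) (L : ι → Lp ℂ 2 (vol m S) →ₗ[ℂ] ℂ),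
      ∀ (h : Lp ℂ 2 (vol m S)) (f : S → ℂ), ContMDiff (𝓡 m) 𝓘(ℝ, ℂ) ∞ f → h =ᵐ[vol m S] f →
        (∀ i, L i h = 0) →
        ∫⁻ y in (extChartAt (𝓡 m) x).symm '' Metric.ball (extChartAt (𝓡 m) x x) r,
          ‖f y‖ₑ ^ 2 ∂(vol m S) ≤ ENNReal.ofReal ε * C ^ (2 * m + 2) *
            ∫⁻ y, ENNReal.ofReal (gradInner m f f y).re ∂(vol m S) := by
  set e := extChartAt (𝓡 m) x with he
  set B := Metric.ball (e x) r with hB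
  obtain ⟨ι, hι, Q, hQm, hQB, hQ⟩ := exists_forall_lintegral_enorm_sq_le (μ := volume)
    (Metric.isOpen_ball : IsOpen B) (convex_ball _ _) Metric.isBounded_ball hε
  have hae : ∀ i, AEMeasurable e.symm (volume.restrict (Q i)) := fun i =>
    hx.aemeasurable_symm.mono_measure (Measure.restrict_mono (hQB i) le_rfl)
  have hle : ∀ i, (volume.restrict (Q i)).map e.symm ≤ (C : ℝ≥0∞) ^ m • vol m S := fun i => by
    refine (Measure.map_mono_of_aemeasurable (Measure.restrict_mono (hQB i) le_rfl)
      hx.aemeasurable_symm).trans (hx.map_symm_le.trans ?_)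
    gcongr
    exact Measure.restrict_le_self
  have hC : (C : ℝ≥0∞) ^ m ≠ ⊤ := by finiteness
  refine ⟨ι, hι, fun i => integralForm hC (hle i), fun h f hf hhf h0 => ?_⟩
  have hg := contDiffOn_comp_extChartAt_symm hf x
  have hmem : MemLp (f ∘ e.symm) 2 (volume.restrict B) := by
    have hfin : IsFiniteMeasure (volume.restrict B) := ⟨by simp [hB, measure_ball_lt_top]⟩
    obtain ⟨c, hc⟩ := isCompact_univ.exists_bound_of_continuousOn hf.continuous.continuousOn
    exact MemLp.of_bound ((hg.continuousOn.mono hx.subset_target).aestronglyMeasurable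
      measurableSet_ball) c (ae_of_all _ fun y => hc _ (mem_univ _))
  have hav : ∀ i, ∫ y in Q i, (f ∘ e.symm) y = 0 := by
    intro i
    rw [← h0 i]
    change _ = ∫ y, h y ∂((volume.restrict (Q i)).map e.symm)
    rw [integral_congr_ae ((Measure.absolutelyContinuous_of_le_smul (hle i)).ae_le hhf),
      integral_map (hae i) hf.continuous.aestronglyMeasurable]
    rfl
  have hm1 : Measurable fun y => ‖f y‖ₑ ^ 2 := hf.continuous.enorm.measurable.pow_const 2
  have hm2 : Measurable fun y => ENNReal.ofReal (gradInner m f f y).re :=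
    (Complex.continuous_re.comp (continuous_gradInner hf hf)).measurable.ennreal_ofReal
  calc ∫⁻ y in e.symm '' B, ‖f y‖ₑ ^ 2 ∂(vol m S)
      ≤ C ^ m * ∫⁻ y in B, ‖f (e.symm y)‖ₑ ^ 2 := hx.lintegral_image_le hm1
    _ ≤ C ^ m * (ENNReal.ofReal ε * ∫⁻ y in B, ‖fderiv ℝ (f ∘ e.symm) y‖ₑ ^ 2) := by
        gcongr
        exact hQ (f ∘ e.symm) ((hg.mono hx.subset_target).of_le (by simp)) hmem hav
    _ ≤ C ^ m * (ENNReal.ofReal ε * ∫⁻ y in B,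
          C ^ 2 * ENNReal.ofReal (gradInner m f f (e.symm y)).re) := by
        gcongr 2
        exact setLIntegral_mono' measurableSet_ball fun y hy => hx.enorm_fderiv_sq_le hf hy
    _ ≤ C ^ m * (ENNReal.ofReal ε * (C ^ 2 * (C ^ m *
          ∫⁻ y, ENNReal.ofReal (gradInner m f f y).re ∂(vol m S)))) := by
        rw [lintegral_const_mul' _ _ (by finiteness)]
        gcongr
        exact hx.lintegral_comp_symm_le hm2
    _ = _ := by ring

variable {n : ℕ} {αM : ℝ}

theorem finiteDimensional_H₀ (hn : 2 ≤ n) (hαM : 0 < αM) :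
    FiniteDimensional ℂ (H₀ m S n αM) := by
  obtain ⟨M, hM0, hM⟩ := exists_lintegral_gradInner_le (m := m) (S := S) hn hαM
  obtain ⟨t, C, r, hchart, ht⟩ := exists_finite_cover_isLipschitzChart m S
  set K : ℝ := (∑ x ∈ t, (C x : ℝ) ^ (2 * m + 2)) * M
  have hK : 0 ≤ K := by positivity
  -- Summed over the cover, the Poincaré estimates give N ≤ εKN, and this ε ensures εK ≤ 1/2. As N
  -- is finite, it vanishes.
  have hε : 0 < 1 / (2 * (K + 1)) := by positivity
  choose ι hι L hL using fun x => (hchart x).exists_forms hε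
  let Φ : H₀ m S n αM →ₗ[ℂ] ((Σ x : t, ι x) → ℂ) :=
    LinearMap.pi fun i => L i.1 i.2 ∘ₗ (H₀ m S n αM).subtype
  have hfin : Finite (Σ x : t, ι x) := inferInstance
  refine FiniteDimensional.of_injective Φ ((injective_iff_map_eq_zero Φ).2 fun h h0 => ?_)
  obtain ⟨f, hf, hhf, hgrad⟩ := hM h
  set N := ∫⁻ x, ‖f x‖ₑ ^ 2 ∂(vol m S) with hN
  have hNtop : N ≠ ⊤ := by
    obtain ⟨c, hc⟩ := isCompact_univ.exists_bound_of_continuousOn hf.continuous.continuousOn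
    refine ne_top_of_le_ne_top (b := ∫⁻ _, ENNReal.ofReal c ^ 2 ∂(vol m S)) ?_
      (lintegral_mono fun x => ?_)
    · rw [lintegral_const]
      finiteness
    · rw [← ofReal_norm]
      gcongr
      exact hc x (mem_univ x)
  have hNle : N ≤ ENNReal.ofReal (1 / 2) * N := by
    calc N = ∫⁻ x in ⋃ x ∈ t, (extChartAt (𝓡 m) x).symm ''
            Metric.ball (extChartAt (𝓡 m) x x) (r x), ‖f x‖ₑ ^ 2 ∂(vol m S) := by
          rw [ht, Measure.restrict_univ]
      _ ≤ ∑ x ∈ t, ∫⁻ y in (extChartAt (𝓡 m) x).symm ''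
            Metric.ball (extChartAt (𝓡 m) x x) (r x), ‖f y‖ₑ ^ 2 ∂(vol m S) := by
          rw [← Finset.set_biUnion_coe, biUnion_eq_iUnion]
          refine (lintegral_iUnion_le _ _).trans_eq ?_
          rw [tsum_fintype]
          exact Finset.sum_coe_sort t fun x => ∫⁻ y in (extChartAt (𝓡 m) x).symm ''
            Metric.ball (extChartAt (𝓡 m) x x) (r x), ‖f y‖ₑ ^ 2 ∂(vol m S)
      _ ≤ ∑ x ∈ t, ENNReal.ofReal (1 / (2 * (K + 1))) * C x ^ (2 * m + 2) *
            (ENNReal.ofReal M * N) := by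
          refine Finset.sum_le_sum fun x hx => ?_
          refine (hL x h f hf hhf fun i => congrFun h0 ⟨⟨x, hx⟩, i⟩).trans ?_
          gcongr
      _ = ENNReal.ofReal (1 / (2 * (K + 1)) * K) * N := by
          rw [← Finset.sum_mul, ← Finset.mul_sum, ← mul_assoc]
          congr 1
          simp only [K]
          rw [ENNReal.ofReal_mul hε.le, ENNReal.ofReal_mul (by positivity),
            ENNReal.ofReal_sum_of_nonneg fun _ _ => by positivity, mul_assoc]
          congr 3
          ext x
          rw [ENNReal.ofReal_pow (by positivity), ENNReal.ofReal_coe_nnreal]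
      _ ≤ ENNReal.ofReal (1 / 2) * N := by
          gcongr
          rw [div_mul_eq_mul_div, div_le_iff₀ (by positivity)]
          linarith
  have hN0 : N = 0 := by
    have h1 := ENNReal.toReal_mono (by finiteness) hNle
    rw [ENNReal.toReal_mul, ENNReal.toReal_ofReal (by norm_num)] at h1
    have h2 : N.toReal = 0 := by linarith [ENNReal.toReal_nonneg (a := N)]
    exact ((ENNReal.toReal_eq_zero_iff N).1 h2).resolve_right hNtop
  rw [hN, lintegral_eq_zero_iff (hf.continuous.enorm.measurable.pow_const 2)] at hN0
  apply Subtype.ext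
  refine (Lp.eq_zero_iff_ae_eq_zero).2 ?_
  filter_upwards [hhf, hN0] with x h1 h2
  rw [h1]
  simpa using h2

/-- Constants are eigenfunctions for μ = 0, and then μ̄ = -(m-1)²/4 ≤ 0. They are nonzero in L²
because S has positive volume. -/
theorem nontrivial_H₀ [Nonempty S] : Nontrivial (H₀ m S n αM) := by
  have hmem : MemLp (fun _ : S => (1 : ℂ)) 2 (vol m S) := memLp_const 1
  have hmu : muBar m n αM 0 ≤ 0 := by
    simp only [muBar, mul_zero, zero_sub, Left.neg_nonpos_iff]
    positivity
  have h1 : hmem.toLp ∈ H₀ m S n αM := by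
    refine le_iSup (lowEigenspace m S n αM) ⟨0, hmu⟩ (Submodule.subset_span
      ⟨fun _ => 1, ?_, hmem.coeFn_toLp⟩)
    simp only [Complex.ofReal_zero, zero_mul]
    exact isNegLaplacian_const 1
  refine ⟨⟨⟨_, h1⟩, 0, fun h => vol_ne_zero m S ?_⟩⟩
  have h2 : hmem.toLp = 0 := congrArg Subtype.val h
  have h3 := hmem.coeFn_toLp.symm.trans (Lp.eq_zero_iff_ae_eq_zero.1 h2)
  rw [← Measure.measure_univ_eq_zero, ← nonpos_iff_eq_zero]
  refine (measure_mono fun x _ => ?_).trans_eq (ae_iff.1 h3)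
  simp

end Finiteness

end WheelerDeWitt

end

theorem theorem7p4 (m : ℕ) (hm : 1 ≤ m) (S : Type*) [EMetricSpace S] [CompactSpace S] [Nonempty S]
    [MeasurableSpace S] [BorelSpace S]
    [ChartedSpace (EuclideanSpace ℝ (Fin m)) S] [IsManifold (𝓡 m) ∞ S]
    [RiemannianBundle (fun x : S => TangentSpace (𝓡 m) x)]
    [IsContMDiffRiemannianBundle (𝓡 m) ∞ (EuclideanSpace ℝ (Fin m))
      (fun x : S => TangentSpace (𝓡 m) x)]
    [IsRiemannianManifold (𝓡 m) S]
    (n : ℕ) (hn : 2 ≤ n) (αM : ℝ) (hαM : 0 < αM) :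
    FiniteDimensional ℂ (WheelerDeWitt.H₀ m S n αM) ∧
    (∀ V κ r₀ : ℝ, 0 < r₀ →
      WheelerDeWitt.IsSelfAdjointOperator (E := WheelerDeWitt.State₁ m S n αM r₀)
        (WheelerDeWitt.hamiltonian₁ m S n αM V κ r₀) ∧
      WheelerDeWitt.HasPurePointSpectrum (E := WheelerDeWitt.State₁ m S n αM r₀)
        (WheelerDeWitt.hamiltonian₁ m S n αM V κ r₀) ∧
      ∃ (Λ : ℕ → ℝ) (ψ : ℕ → WheelerDeWitt.State₁ m S n αM r₀)
        (x : ℕ → WheelerDeWitt.FormDomain₁ m S n αM r₀),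
        Monotone Λ ∧ Tendsto Λ atTop atTop ∧ Orthonormal ℂ ψ ∧
        (∀ j, WheelerDeWitt.IsEigenSolution (E := WheelerDeWitt.State₁ m S n αM r₀)
          (WheelerDeWitt.hamiltonian₁ m S n αM V κ r₀) (Λ j * (16 / (n : ℂ) ^ 2)) (ψ j)) ∧
        (∀ (z : ℂ) (χ : WheelerDeWitt.State₁ m S n αM r₀),
          WheelerDeWitt.IsEigenSolution (E := WheelerDeWitt.State₁ m S n αM r₀)
            (WheelerDeWitt.hamiltonian₁ m S n αM V κ r₀) (z * (16 / (n : ℂ) ^ 2)) χ →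
          χ ∈ Submodule.span ℂ (ψ '' {j | (Λ j : ℂ) = z})) ∧
        (∀ j, (x j, ψ j) ∈ WheelerDeWitt.embedding₁ m S n αM r₀) ∧
        (Submodule.span ℂ (Set.range x)).topologicalClosure = ⊤ ∧
        (Submodule.span ℂ (Set.range ψ)).topologicalClosure = ⊤) ∧
    (∀ κ : ℝ, κ < 0 →
      WheelerDeWitt.IsSelfAdjointOperator (E := WheelerDeWitt.State₂ m S n αM)
        (WheelerDeWitt.hamiltonian₂ m S n αM) ∧
      WheelerDeWitt.HasPurePointSpectrum (E := WheelerDeWitt.State₂ m S n αM)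
        (WheelerDeWitt.hamiltonian₂ m S n αM) ∧
      ∃ (lam : ℕ → ℝ) (ψ : ℕ → WheelerDeWitt.State₂ m S n αM)
        (x : ℕ → WheelerDeWitt.FormDomain₂ m S n αM),
        Monotone lam ∧ Tendsto lam atTop atTop ∧ Orthonormal ℂ ψ ∧
        (∀ j, WheelerDeWitt.IsEigenSolution (E := WheelerDeWitt.State₂ m S n αM)
          (WheelerDeWitt.hamiltonian₂ m S n αM) (-lam j * κ * (16 / (n : ℂ) ^ 2)) (ψ j)) ∧
        (∀ (z : ℂ) (χ : WheelerDeWitt.State₂ m S n αM),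
          WheelerDeWitt.IsEigenSolution (E := WheelerDeWitt.State₂ m S n αM)
            (WheelerDeWitt.hamiltonian₂ m S n αM) (-z * κ * (16 / (n : ℂ) ^ 2)) χ →
          χ ∈ Submodule.span ℂ (ψ '' {j | (lam j : ℂ) = z})) ∧
        (∀ j, (x j, ψ j) ∈ WheelerDeWitt.embedding₂ m S n αM) ∧
        (Submodule.span ℂ (Set.range x)).topologicalClosure = ⊤ ∧
        (Submodule.span ℂ (Set.range ψ)).topologicalClosure = ⊤) := by
  have : IsContMDiffRiemannianBundle (𝓡 m) 0 (EuclideanSpace ℝ (Fin m))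
      (fun x : S => TangentSpace (𝓡 m) x) := .of_le (n := ∞) (by simp)
  have : IsContinuousRiemannianBundle (EuclideanSpace ℝ (Fin m))
      (fun x : S => TangentSpace (𝓡 m) x) := by
    obtain ⟨g, hg, hg'⟩ := this.exists_contMDiff
    exact ⟨g, hg.continuous, hg'⟩
  have hfin := WheelerDeWitt.finiteDimensional_H₀ (m := m) (S := S) hn hαM
  have hnon := WheelerDeWitt.nontrivial_H₀ (m := m) (S := S) (n := n) (αM := αM)
  have : CompleteSpace (WheelerDeWitt.H₀ m S n αM) := FiniteDimensional.complete ℂ _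
  have hn0 : (2 : ℝ) ≤ n := by exact_mod_cast hn
  have hc : (0 : ℝ) < 16 / (n : ℝ) ^ 2 := by positivity
  -- This number is both the exponent in the potential of the first Hamiltonian and the exponent p₂
  -- of the second. That it is strictly less than 2 matters only for the second.
  have hs0 : 0 ≤ 2 * ((n : ℝ) - 2) / n := div_nonneg (by linarith) (by linarith)
  have hs2 : 2 * ((n : ℝ) - 2) / n < 2 := by
    rw [div_lt_iff₀ (by linarith)]
    linarith
  refine ⟨hfin, fun V κ r₀ hr₀ => ?_, fun κ hκ => ?_⟩
  · have key := WheelerDeWitt.hamiltonian_spectral_theorem_of_lt_top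
      (A := WheelerDeWitt.angularPos m S n αM)
      (WheelerDeWitt.continuousOn_potential₁ n αM V κ) (p := WheelerDeWitt.p₁)
      (q := WheelerDeWitt.p₁ + 1) hr₀ rfl
      (by norm_num [WheelerDeWitt.p₁]) hs0 hs2.le
      (c₁ := -(16 / (n : ℝ) ^ 2) * WheelerDeWitt.Vbar n αM V)
      (c₂ := 16 / (n : ℝ) ^ 2 * κ) (fun r _ => rfl) hc
    have e : ((16 / (n : ℝ) ^ 2 : ℝ) : ℂ) = 16 / (n : ℂ) ^ 2 := by push_cast; rfl
    rw [e] at key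
    exact key
  · have key := WheelerDeWitt.hamiltonian_spectral_theorem_of_top
      (A := WheelerDeWitt.angularPos m S n αM)
      (WheelerDeWitt.continuousOn_potential₂ n) (p := WheelerDeWitt.p₂ n)
      (q := WheelerDeWitt.p₂ n + 1) rfl hs0 hs2
      -- The energy norm contains r³|u|² with coefficient 1, the operator has 16/n²; the difference
      -- c₁ exceeds -1 since 16/n² is positive.
      (c₁ := 16 / (n : ℝ) ^ 2 - 1) (by linarith)
      (fun r _ => by simp only [WheelerDeWitt.potential₂]; ring)
      -- The eigenvalue parameter is scaled by -κ·16/n²; its positivity, hence the order and the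
      -- limit of the eigenvalues, rests on κ < 0.
      (mul_pos (neg_pos.2 hκ) hc)
    have e (z : ℂ) : z * ((-κ * (16 / (n : ℝ) ^ 2) : ℝ) : ℂ) = -z * κ * (16 / (n : ℂ) ^ 2) := by
      push_cast
      ring
    simp only [e] at key
    exact key
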